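/- **Setting.** Let $G$ be a finite connected simple graph on $n$ vertices, all of degree at least $3$. A framework $G(P)$ assigns distinct points $P=(p_i)$ of $\mathbb{R}P^2$ to the vertices. Lines $\ell_1,\dots,\ell_k$ are in general position if their pairwise intersections form a set of exactly $k(k-1)/2$ points; $G(P)$ is in general position if, for every simple cycle of $G$ with at most $n-1$ vertices, the lines through its edges are in general position. A force is a $2$-form on $\mathbb{R}^3$; the line of force of $dp\wedge dq\neq 0$ is the line $pq$. A tensegrity on $G(P)$ consists of forces $F_{i,j}=-F_{j,i}$ acting along the lines $p_ip_j$ of the edges (zero forces allowed), with $\sum_j F_{i,j}=0$ at every $p_i$. A finite family of forces $F_1,\dots,F_s$ is non-parallelizable if no nonempty proper subfamily has sum $0$ and the lines of force of the sums $F_1+\sum_{i\ge 2}a_iF_i$, $a\in\{0,1\}^{s-1}\setminus\{(1,\dots,1)\}$, are pairwise distinct; a tensegrity is non-parallelizable if at each vertex the forces at the adjacent edges are. Let $\Xi_G(P)$ be the configuration space of the fixed points $P$ and, for each $i$, of $\deg p_i-3$ non-fixed lines $\ell_{i,a}$ through $p_i$. For every vertex $i$ fix a tree $T_i$ with all degrees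 $1$ or $3$, whose leaf edges correspond to the edges of $G$ at $i$ and whose interior edges are numbered by $a=1,\dots,\deg p_i-3$. A choice of the $\ell_{i,a}$ labels the trees by lines: $p_ip_j$ at the leaf edge of $ij$, and $\ell_{i,a}$ at the $a$-th interior edge of $T_i$. The choice is called generic if, for each $i$, adjacent edges of $T_i$ have distinct lines, and the leaf forces of the (unique up to a factor) nonzero assignment to the edges of $T_i$ of opposite forces along their lines, in equilibrium at all vertices of degree $3$, form a non-parallelizable family. *Operations.* Expressions are built from the points and lines of $\Xi_G(P)$ by intersecting two lines, joining two points, choosing a generic point on a line (distinct from two given points), and choosing a generic line through a point (distinct from a given line). The intersection of equal lines and the join of equal points is the symbol "true", and any expression or relation with an argument "true" is "true". *Surgery.* For a subtree of a labelled tree at $p$ with edges $v_1v_2,v_1v_3,v_1v_4,v_2v_5,v_2v_6$ labelled $l_{12},l_{13},l_{14},l_{25},l_{26}$, the surgery replaces it by edges $v_1'v_2',v_1'v_3,v_1'v_5,v_2'v_4,v_2'v_6$. Outer edges keep their lines, and $v_1'v_2'$ gets the line $pp'''$ constructed as follows: choose $p_\infty\in l_{12}$, $p_\infty\ne p$, a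 line $\ell_\infty\neq l_{12}$ through $p_\infty$, and $p'\in l_{13}$ with $p'\ne p$, $p'\notin\ell_\infty$; put $\hat\ell=(p',\,l_{12}\cap\ell_\infty)$, $p''=\hat\ell\cap l_{25}$ and $p'''=(p',\,l_{14}\cap\ell_\infty)\cap(p'',\,l_{26}\cap\ell_\infty)$. *Framing.* For edges $ij$, $ik$ with $j\ne k$, apply surgeries to $T_i$ until their two leaf edges share a vertex; $\ell_{jik}$ is the expression at the third edge at that vertex. Fix one such expression for each triple. *Conditions.* For each simple cycle $q_1\dots q_k$ of $G$ that does not contain all vertices (with one fixed labelling), frame each $q_m$ by the line $\ell_m=\ell_{q_{m-1}q_mq_{m+1}}$. While more than three vertices are left, replace the first two vertices $q_1,q_2$ by the vertex $q'=q_kq_1\cap q_2q_3$ framed by $(q',\,\ell_1\cap\ell_2)$. The condition of the cycle is that the three remaining framing lines have a common point. **Theorem.** For every such $G$ and every choice of the trees, the required framing expressions exist. For every choice of these expressions and of the labellings of the cycles, for every framework $G(P)$ in general position, and however the generic operations are performed, $G(P)$ admits a non-parallelizable tensegrity if and only if there is a generic choice of the non-fixed lines in $\Xi_G(P)$ for which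 the conditions of all simple cycles of $G$ that do not contain all vertices of $G$ are fulfilled. -/

import Mathlib

open Module
open scoped LinearAlgebra.Projectivization

noncomputable section

namespace Tensegrity

/-! ### Points and lines of the real projective plane -/

/-- Points of the real projective plane. -/
abbrev Point : Type := ℙ ℝ (Fin 3 → ℝ)

/-- Lines of the real projective plane: two-dimensional linear subspaces of `ℝ³`. -/
def Line : Type := {W : Submodule ℝ (Fin 3 → ℝ) // finrank ℝ W = 2}

instance : Membership Point Line := ⟨fun ℓ p => p.submodule ≤ ℓ.1⟩

theorem finrank_sup_of_ne {p q : Point} (h : p ≠ q) :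
    finrank ℝ (p.submodule ⊔ q.submodule : Submodule ℝ (Fin 3 → ℝ)) = 2 := by
  have hli := Projectivization.linearIndependent_pair_iff_ne.mpr h
  have h2 := finrank_span_eq_card hli
  rw [Projectivization.submodule_eq, Projectivization.submodule_eq, ← Submodule.span_union]
  rw [Matrix.range_cons, Matrix.range_cons, Matrix.range_empty, Set.union_empty] at h2
  simpa using h2

theorem finrank_inf_of_ne {ℓ m : Line} (h : ℓ ≠ m) :
    finrank ℝ (ℓ.1 ⊓ m.1 : Submodule ℝ (Fin 3 → ℝ)) = 1 := by
  have h1 := Submodule.finrank_sup_add_finrank_inf_eq ℓ.1 m.1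
  have h3 : finrank ℝ (ℓ.1 ⊔ m.1 : Submodule ℝ (Fin 3 → ℝ)) ≤ 3 := by
    simpa using Submodule.finrank_le (ℓ.1 ⊔ m.1)
  have h4 : finrank ℝ (ℓ.1 ⊔ m.1 : Submodule ℝ (Fin 3 → ℝ)) ≠ 2 := by
    intro h5
    have e1 : ℓ.1 = ℓ.1 ⊔ m.1 :=
      Submodule.eq_of_le_of_finrank_eq le_sup_left (by rw [h5, ℓ.2])
    have e2 : m.1 = ℓ.1 ⊔ m.1 :=
      Submodule.eq_of_le_of_finrank_eq le_sup_right (by rw [h5, m.2])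
    exact h (Subtype.ext (e1.trans e2.symm))
  have h6 : finrank ℝ ℓ.1 ≤ finrank ℝ (ℓ.1 ⊔ m.1 : Submodule ℝ (Fin 3 → ℝ)) :=
    Submodule.finrank_mono le_sup_left
  have h7 := ℓ.2
  have h8 := m.2
  omega

open Classical in
/-- The intersection point of two lines. The value `none` is the symbol "true", which is the
result when the two lines coincide. -/
def meet (ℓ m : Line) : Option Point :=
  if h : ℓ = m then none
  else some (Projectivization.mk'' (ℓ.1 ⊓ m.1) (finrank_inf_of_ne h))

open Classical in
/-- The line through two points. The value `none` is the symbol "true", which is the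
result when the two points coincide. -/
def join (p q : Point) : Option Line :=
  if h : p = q then none
  else some ⟨p.submodule ⊔ q.submodule, finrank_sup_of_ne h⟩

/-- Lines in general position: their pairwise intersections consist of exactly `n (n - 1) / 2`
points. -/
def LinesInGeneralPosition {n : ℕ} (ℓ : Fin n → Line) : Prop :=
  {q : Point | ∃ a b : Fin n, a ≠ b ∧ q ∈ ℓ a ∧ q ∈ ℓ b}.encard = ((n * (n - 1) / 2 : ℕ) : ℕ∞)

/-! ### Projective statics -/

/-- Forces in the projective plane: exterior 2-forms on `ℝ³` (all of them are decomposable). -/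
abbrev Force : Type := (Fin 3 → ℝ) [⋀^Fin 2]→ₗ[ℝ] ℝ

/-- The 2-form `dp ∧ dq`, that is `(x, y) ↦ (p ⬝ x) (q ⬝ y) - (q ⬝ x) (p ⬝ y)`. -/
def wedge (p q : Fin 3 → ℝ) : Force :=
  (Matrix.detRowAlternating (n := Fin 2) (R := ℝ)).compLinearMap (Matrix.of ![p, q]).mulVecLin

/-- `ℓ` is the line of force of the (nonzero) force `F`: `F = dp ∧ dq` where `p` and `q` span the
plane `ℓ`. -/
def IsLineOfForce (F : Force) (ℓ : Line) : Prop :=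
  ∃ p q : Fin 3 → ℝ, F = wedge p q ∧ ℓ.1 = Submodule.span ℝ {p, q}

/-- `F` is a force acting along `ℓ`; the zero force is allowed. -/
def ActsAlong (F : Force) (ℓ : Line) : Prop := F = 0 ∨ IsLineOfForce F ℓ

/-- A finite family of forces is non-parallelizable if no nonempty proper subfamily has sum zero and
if the lines of force of the sums over the proper subfamilies that contain a chosen member are
pairwise distinct. -/
def NonParallelizable {ι : Type*} [Fintype ι] (f : ι → Force) : Prop :=
  (∀ A : Finset ι, ∑ j ∈ A, f j = 0 → A = ∅ ∨ A = Finset.univ) ∧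
  ∀ (j₀ : ι) (A B : Finset ι), j₀ ∈ A → j₀ ∈ B → A ≠ Finset.univ → B ≠ Finset.univ → A ≠ B →
    ∀ ℓ : Line, ¬ (IsLineOfForce (∑ j ∈ A, f j) ℓ ∧ IsLineOfForce (∑ j ∈ B, f j) ℓ)

/-! ### Frameworks -/

section Frameworks

variable {V : Type*} [Fintype V] (G : SimpleGraph V) [DecidableRel G.Adj]

/-- `F` is an equilibrium force-load on the framework `G(P)`. -/
structure IsEquilibriumForceLoad (P : V → Point) (F : V → V → Force) : Prop where
  stress_along : ∀ i j, G.Adj i j → ∃ ℓ, join (P i) (P j) = some ℓ ∧ ActsAlong (F i j) ℓ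
  antisymm : ∀ i j, F i j + F j i = 0
  eq_zero : ∀ i j, ¬ G.Adj i j → F i j = 0
  equilibrium : ∀ i, ∑ j, F i j = 0

/-- The framework `G(P)` admits a non-parallelizable tensegrity. -/
def AdmitsNonParallelizableTensegrity (P : V → Point) : Prop :=
  ∃ F : V → V → Force, IsEquilibriumForceLoad G P F ∧
    ∀ i, NonParallelizable (fun j : G.neighborSet i => F i j)

variable {G} in
/-- The realization of a cycle is in general position: the lines through its edges are. -/
def CycleInGeneralPosition (P : V → Point) {u : V} (w : G.Walk u u) : Prop :=
  ∃ ℓ : Fin w.length → Line,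
    (∀ m : Fin w.length,
      join (P (w.getVert m.1)) (P (w.getVert (m.1 + 1))) = some (ℓ m)) ∧ LinesInGeneralPosition ℓ

/-- The framework `G(P)` is in general position: every simple cycle with at most `|V| - 1` vertices
is (a cycle has as many vertices as edges). -/
def FrameworkInGeneralPosition (P : V → Point) : Prop :=
  ∀ (u : V) (w : G.Walk u u), w.IsCycle → w.length < Fintype.card V → CycleInGeneralPosition P w

/-- The simple cycles of `G`, as subgraphs, that do not contain all the vertices. -/
def ShortCycle : Type _ :=
  {H : G.Subgraph // ∃ (u : V) (w : G.Walk u u),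
    w.IsCycle ∧ w.toSubgraph = H ∧ w.length < Fintype.card V}

/-- The number of non-fixed lines at each vertex. -/
def numLines (i : V) : ℕ := G.degree i - 3

end Frameworks

/-! ### Geometric conditions on configurations of fixed points and non-fixed lines -/

/-- The two sorts of geometric objects. -/
inductive GeomSort where
  | point
  | line

/-- The objects of the given sort. -/
abbrev GeomSort.Carrier : GeomSort → Type
  | .point => Point
  | .line => Line

/-- Compositions of geometric operations on points `p i` and non-fixed lines `ℓ i a`, where
`a < d i`: the intersection of two lines, the line through two points, the choice of a generic point
on a line (distinct from two given points), and the choice of a generic line through a point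
(distinct from a given line). -/
inductive GeomExpr {V : Type*} (d : V → ℕ) : GeomSort → Type _ where
  | fixedPoint (i : V) : GeomExpr d .point
  | freeLine (i : V) (a : Fin (d i)) : GeomExpr d .line
  | meet (ℓ m : GeomExpr d .line) : GeomExpr d .point
  | join (p q : GeomExpr d .point) : GeomExpr d .line
  | genericPoint (ℓ : GeomExpr d .line) (a b : GeomExpr d .point) : GeomExpr d .point
  | genericLine (p : GeomExpr d .point) (m : GeomExpr d .line) : GeomExpr d .line

/-- The configuration space of the fixed points `P i` and of `d i` non-fixed lines through each
`P i`. -/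
structure Config {V : Type*} (d : V → ℕ) (P : V → Point) where
  line : ∀ i, Fin (d i) → Line
  mem : ∀ i a, P i ∈ line i a

/-- A way to perform the generic operations. The choice may depend on the expression that
is being evaluated. -/
structure GenericChoice {V : Type*} (d : V → ℕ) where
  point : GeomExpr d .point → Line → Point → Point → Point
  point_mem : ∀ e ℓ a b, point e ℓ a b ∈ ℓ
  point_ne_left : ∀ e ℓ a b, point e ℓ a b ≠ a
  point_ne_right : ∀ e ℓ a b, point e ℓ a b ≠ b
  line : GeomExpr d .line → Point → Line → Line
  line_mem : ∀ e p m, p ∈ line e p m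
  line_ne : ∀ e p m, line e p m ≠ m

section Conditions

variable {V : Type*} {d : V → ℕ}

/-- The value of an expression at a configuration; `none` is the symbol "true". -/
def GeomExpr.eval (σ : GenericChoice d) {P : V → Point} (ξ : Config d P) :
    {s : GeomSort} → GeomExpr d s → Option s.Carrier
  | _, .fixedPoint i => some (P i)
  | _, .freeLine i a => some (ξ.line i a)
  | _, .meet ℓ m => Option.bind (α := Line) (ℓ.eval σ ξ) fun x =>
      Option.bind (α := Line) (m.eval σ ξ) fun y => Tensegrity.meet x y
  | _, .join p q => Option.bind (α := Point) (p.eval σ ξ) fun x =>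
      Option.bind (α := Point) (q.eval σ ξ) fun y => Tensegrity.join x y
  | _, .genericPoint ℓ a b => Option.bind (α := Line) (ℓ.eval σ ξ) fun x =>
      Option.bind (α := Point) (a.eval σ ξ) fun y => Option.bind (α := Point) (b.eval σ ξ) fun z =>
        some (σ.point (.genericPoint ℓ a b) x y z)
  | _, .genericLine p m => Option.bind (α := Point) (p.eval σ ξ) fun x =>
      Option.bind (α := Line) (m.eval σ ξ) fun y => some (σ.line (.genericLine p m) x y)

/-- A geometric condition: one geometric relation applied to compositions of operations. -/
inductive GeomCondition {V : Type*} (d : V → ℕ) : Type _ where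
  | threeLines (ℓ₁ ℓ₂ ℓ₃ : GeomExpr d .line)
  | threePoints (p₁ p₂ p₃ : GeomExpr d .point)
  | pointLine (p : GeomExpr d .point) (ℓ : GeomExpr d .line)

/-- The condition results in "true": some argument is "true", or the relation holds. -/
def GeomCondition.Holds (σ : GenericChoice d) {P : V → Point} (ξ : Config d P) :
    GeomCondition d → Prop
  | .threeLines ℓ₁ ℓ₂ ℓ₃ => ∀ x₁ x₂ x₃ : Line,
      ℓ₁.eval σ ξ = some x₁ → ℓ₂.eval σ ξ = some x₂ → ℓ₃.eval σ ξ = some x₃ →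
        ∃ q : Point, q ∈ x₁ ∧ q ∈ x₂ ∧ q ∈ x₃
  | .threePoints p₁ p₂ p₃ => ∀ x₁ x₂ x₃ : Point,
      p₁.eval σ ξ = some x₁ → p₂.eval σ ξ = some x₂ → p₃.eval σ ξ = some x₃ →
        ∃ m : Line, x₁ ∈ m ∧ x₂ ∈ m ∧ x₃ ∈ m
  | .pointLine p ℓ => ∀ (x : Point) (m : Line),
      p.eval σ ξ = some x → ℓ.eval σ ξ = some m → x ∈ m

/-- A vertex of a framed cycle together with its framing line, written as expressions. -/
structure FramedVertex (d : V → ℕ) where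
  pt : GeomExpr d .point
  framing : GeomExpr d .line

/-- The vertex that replaces the consecutive vertices `x, y` in the projection operation: the point
is `(z x) ∩ (y t)`, where `z` precedes `x` and `t` follows `y`, and its framing line joins it to the
intersection of the framing lines of `x` and `y`. -/
def projectVertices (z x y t : FramedVertex d) : FramedVertex d :=
  let p : GeomExpr d .point := .meet (.join z.pt x.pt) (.join y.pt t.pt)
  ⟨p, .join p (.meet x.framing y.framing)⟩

/-- The geometric condition of the framed cycle with consecutive vertices `x :: l`: the first two
vertices are replaced by their projection until a triangle is left, whose three framing lines have to
be concurrent. (Lists with fewer than three vertices do not occur.) -/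
def cycleCondition (x : FramedVertex d) : List (FramedVertex d) → GeomCondition d
  | [] => .threeLines x.framing x.framing x.framing
  | [_] => .threeLines x.framing x.framing x.framing
  | [y, z] => .threeLines x.framing y.framing z.framing
  | y :: t :: z :: l =>
      cycleCondition (projectVertices ((z :: l).getLast (List.cons_ne_nil z l)) x y t) (t :: z :: l)

end Conditions

/-! ### Resolution trees and surgeries -/

/-- An unrooted full binary tree whose leaves correspond to the edges of `G` at the vertex
`i` (an edge `i j` is given by its endpoint `j`, a leaf edge by its vertex of degree one), with an
enumeration of its interior edges. -/
structure ResolutionTree {V : Type*} [Fintype V] (G : SimpleGraph V) [DecidableRel G.Adj]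
    (i : V) where
  W : Type
  fintypeW : Fintype W
  graph : SimpleGraph W
  isTree : graph.IsTree
  degree_eq : ∀ v, (graph.neighborSet v).ncard = 1 ∨ (graph.neighborSet v).ncard = 3
  leaf : G.neighborSet i ≃ {v : W // (graph.neighborSet v).ncard = 1}
  enum : {e : Sym2 W // e ∈ graph.edgeSet ∧ ∀ v ∈ e, (graph.neighborSet v).ncard = 3} ≃
    Fin (numLines G i)

attribute [instance] ResolutionTree.fintypeW

/-- `G_H` as a subgraph of a tree: six distinct vertices with the edges
`v₁v₂, v₁v₃, v₁v₄, v₂v₅, v₂v₆`. -/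
structure IsHSubgraph {W : Type*} (T : SimpleGraph W) (v₁ v₂ v₃ v₄ v₅ v₆ : W) : Prop where
  nodup : [v₁, v₂, v₃, v₄, v₅, v₆].Nodup
  adj₁₂ : T.Adj v₁ v₂
  adj₁₃ : T.Adj v₁ v₃
  adj₁₄ : T.Adj v₁ v₄
  adj₂₅ : T.Adj v₂ v₅
  adj₂₆ : T.Adj v₂ v₆

/-- The tree after the surgery: `v₁, v₂` become the new vertices `v₁', v₂'`, where `v₁'` is adjacent
to `v₂', v₃, v₅` and `v₂'` is adjacent to `v₁', v₄, v₆`. -/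
def surgeryGraph {W : Type*} (T : SimpleGraph W) (v₁ v₂ v₄ v₅ : W) : SimpleGraph W :=
  T.deleteEdges {s(v₁, v₄), s(v₂, v₅)} ⊔ SimpleGraph.fromEdgeSet {s(v₁, v₅), s(v₂, v₄)}

section Surgeries

variable {V : Type*} {d : V → ℕ}

/-- The line `v₁'v₂'` of the surgery at the point `p` in terms of the lines of the edges
`v₁v₂, v₁v₃, v₁v₄, v₂v₅, v₂v₆`. The lines parallel to a given one are drawn in the affine chart
with the line `l∞` at infinity; the point `p'` of the line of `v₁v₃` is in this chart and is not
`p`. -/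
def surgeryLine (p : GeomExpr d .point) (l₁₂ l₁₃ l₁₄ l₂₅ l₂₆ : GeomExpr d .line) :
    GeomExpr d .line :=
  let pInf : GeomExpr d .point := .genericPoint l₁₂ p p
  let lInf : GeomExpr d .line := .genericLine pInf l₁₂
  let p' : GeomExpr d .point := .genericPoint l₁₃ p (.meet l₁₃ lInf)
  let lHat : GeomExpr d .line := .join p' (.meet l₁₂ lInf)
  let p'' : GeomExpr d .point := .meet lHat l₂₅
  let l' : GeomExpr d .line := .join p' (.meet l₁₄ lInf)
  let l'' : GeomExpr d .line := .join p'' (.meet l₂₆ lInf)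
  let p''' : GeomExpr d .point := .meet l' l''
  .join p p'''

open Classical in
/-- The lines at the edges of the tree after the surgery. -/
def surgeryLabel {W : Type*} (p : GeomExpr d .point) (Λ : Sym2 W → GeomExpr d .line)
    (v₁ v₂ v₃ v₄ v₅ v₆ : W) : Sym2 W → GeomExpr d .line := fun e =>
  if e = s(v₁, v₂) then
    surgeryLine p (Λ s(v₁, v₂)) (Λ s(v₁, v₃)) (Λ s(v₁, v₄)) (Λ s(v₂, v₅)) (Λ s(v₂, v₆))
  else if e = s(v₁, v₅) then Λ s(v₂, v₅)
  else if e = s(v₂, v₄) then Λ s(v₁, v₄)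
  else Λ e

/-- The labelled trees that are obtained from `(T, Λ)` by a sequence of surgeries. -/
inductive SurgeryReachable {W : Type*} (p : GeomExpr d .point) (T : SimpleGraph W)
    (Λ : Sym2 W → GeomExpr d .line) : SimpleGraph W → (Sym2 W → GeomExpr d .line) → Prop where
  | refl : SurgeryReachable p T Λ T Λ
  | surgery {T' : SimpleGraph W} {Λ' : Sym2 W → GeomExpr d .line} {v₁ v₂ v₃ v₄ v₅ v₆ : W} :
      SurgeryReachable p T Λ T' Λ' → IsHSubgraph T' v₁ v₂ v₃ v₄ v₅ v₆ →
      SurgeryReachable p T Λ (surgeryGraph T' v₁ v₂ v₄ v₅)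
        (surgeryLabel p Λ' v₁ v₂ v₃ v₄ v₅ v₆)

end Surgeries

section Quantizations

variable {V : Type*} [Fintype V] {G : SimpleGraph V} [DecidableRel G.Adj]

open Classical in
/-- The line of an edge of the resolution tree at `i`, written on the configuration space: the leaf
edge of `i j` carries the line `p_i p_j`, the interior edge with number `a` carries the non-fixed
line `ℓ_{i,a}`. -/
def ResolutionTree.edgeExpr {i : V} (T : ResolutionTree G i) (e : Sym2 T.W) :
    GeomExpr (numLines G) .line :=
  if h : e ∈ T.graph.edgeSet ∧ ∀ v ∈ e, (T.graph.neighborSet v).ncard = 3 then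
    .freeLine i (T.enum ⟨e, h⟩)
  else if h : ∃ j : G.neighborSet i, (T.leaf j : T.W) ∈ e then
    .join (.fixedPoint i) (.fixedPoint (h.choose : V))
  else .join (.fixedPoint i) (.fixedPoint i)

/-- `τ` expresses the associated framing of the pair of edges `i j`, `i k`: after a sequence of
surgeries the leaves of these edges have a common vertex `v`, and `τ` is the line of the third edge
at `v`. -/
def ResolutionTree.IsFraming {i : V} (T : ResolutionTree G i) (j k : G.neighborSet i)
    (τ : GeomExpr (numLines G) .line) : Prop :=
  ∃ (T' : SimpleGraph T.W) (Λ' : Sym2 T.W → GeomExpr (numLines G) .line) (v u : T.W),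
    SurgeryReachable (.fixedPoint i) T.graph T.edgeExpr T' Λ' ∧
    T'.Adj v (T.leaf j) ∧ T'.Adj v (T.leaf k) ∧ T'.Adj v u ∧ u ≠ T.leaf j ∧ u ≠ T.leaf k ∧
    τ = Λ' s(v, u)

/-- `F` is an equilibrium force-load on the resolution scheme `(T, L)`. -/
structure ResolutionTree.IsEquilibriumForceLoad {i : V} (T : ResolutionTree G i)
    (L : Sym2 T.W → Line) (F : T.W → T.W → Force) : Prop where
  stress_along : ∀ v w, T.graph.Adj v w → ActsAlong (F v w) (L s(v, w))
  antisymm : ∀ v w, F v w + F w v = 0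
  eq_zero : ∀ v w, ¬ T.graph.Adj v w → F v w = 0
  equilibrium : ∀ v, (T.graph.neighborSet v).ncard = 3 → ∑ w, F v w = 0

/-- The lines at adjacent edges are distinct. -/
def ResolutionTree.WeaklyGeneric {i : V} (T : ResolutionTree G i) (L : Sym2 T.W → Line) : Prop :=
  ∀ u v w, T.graph.Adj u v → T.graph.Adj v w → u ≠ w → L s(u, v) ≠ L s(v, w)

/-- The scheme is weakly generic, and the forces at the leaves of its nonzero equilibrium force-load
(which is unique up to a factor) form a non-parallelizable family. The force at the leaf `w` is the
only nonzero one among the `F v w`. -/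
def ResolutionTree.StronglyGeneric {i : V} (T : ResolutionTree G i) (L : Sym2 T.W → Line) : Prop :=
  T.WeaklyGeneric L ∧ ∃ F : T.W → T.W → Force, T.IsEquilibriumForceLoad L F ∧
    (∃ v w, F v w ≠ 0) ∧ NonParallelizable (fun j : G.neighborSet i => ∑ v, F v (T.leaf j))

/-- A quantization of `G(P)`: lines at the edges of all resolution trees, where the leaf edge of
`i j` carries the line `p_i p_j` (so both of its copies do) and the interior edges of the tree at `i`
carry lines through `p_i`. The values of `line` off the edges are irrelevant. -/
structure Quantization (T : ∀ i, ResolutionTree G i) (P : V → Point) where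
  line : ∀ i, Sym2 (T i).W → Line
  leaf_line : ∀ (i : V) (j : G.neighborSet i) (v : (T i).W), (T i).graph.Adj v ((T i).leaf j) →
    join (P i) (P j) = some (line i s(v, ((T i).leaf j : (T i).W)))
  interior_mem : ∀ i, ∀ e ∈ (T i).graph.edgeSet,
    (∀ v ∈ e, ((T i).graph.neighborSet v).ncard = 3) → P i ∈ line i e

/-- All resolution schemes are strongly generic. -/
def Quantization.Generic {T : ∀ i, ResolutionTree G i} {P : V → Point}
    (Q : Quantization T P) : Prop := ∀ i, (T i).StronglyGeneric (Q.line i)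

/-- The point of the configuration space that corresponds to a quantization. -/
def Quantization.toConfig {T : ∀ i, ResolutionTree G i} {P : V → Point}
    (Q : Quantization T P) : Config (numLines G) P where
  line i a := Q.line i ((T i).enum.symm a).1
  mem i a := Q.interior_mem i _ ((T i).enum.symm a).2.1 ((T i).enum.symm a).2.2

/-- The choices that are fixed when the system of geometric conditions is written down: for each
pair of edges at a vertex a sequence of operations that expresses the associated framing, and for
each simple cycle that misses a vertex a labelling `q_1 ... q_k` of its vertices in cyclic order. -/
structure SystemChoice (T : ∀ i, ResolutionTree G i) where
  framing : V → V → V → GeomExpr (numLines G) .line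
  isFraming : ∀ (i : V) (j k : G.neighborSet i), j ≠ k → (T i).IsFraming j k (framing i j k)
  base : ShortCycle G → V
  walk : ∀ c : ShortCycle G, G.Walk (base c) (base c)
  isCycle : ∀ c, (walk c).IsCycle
  toSubgraph_eq : ∀ c, (walk c).toSubgraph = c.1

namespace SystemChoice

variable {T : ∀ i, ResolutionTree G i} (Φ : SystemChoice T)

/-- The `m`-th vertex of the framed cycle associated to the cycle `c`, `m < k`, with the framing of
the two edges of the cycle at this vertex. -/
def framedVertex (c : ShortCycle G) (m : ℕ) : FramedVertex (numLines G) where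
  pt := .fixedPoint ((Φ.walk c).getVert m)
  framing := Φ.framing ((Φ.walk c).getVert m)
    ((Φ.walk c).getVert ((m + (Φ.walk c).length - 1) % (Φ.walk c).length))
    ((Φ.walk c).getVert (m + 1))

/-- The geometric condition on the configuration space for the cycle `c`. -/
def condition (c : ShortCycle G) : GeomCondition (numLines G) :=
  cycleCondition (Φ.framedVertex c 0)
    ((List.range ((Φ.walk c).length - 1)).map fun m => Φ.framedVertex c (m + 1))

/-- The system of geometric conditions is fulfilled at `P`: there is a choice of the non-fixed lines,
corresponding to a generic quantization, for which all the conditions result in "true". -/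
def FulfilledAt (P : V → Point) (σ : GenericChoice (numLines G)) : Prop :=
  ∃ ξ : Config (numLines G) P, (∃ Q : Quantization T P, Q.Generic ∧ Q.toConfig = ξ) ∧
    ∀ c : ShortCycle G, (Φ.condition c).Holds σ ξ

end SystemChoice

end Quantizations

end Tensegrity

end

/-! A force in the plane is a vector of `ℝ³` orthogonal to the plane of its line, so acting along a
line and passing through a point are linear conditions. A force through two distinct points acts
along their join (`actsAlong_of_through`). Almost every step is an argument of this kind.

Trees. In an equilibrium load on a resolution tree, the force at an edge is the sum of the leaf
forces beyond it. For a non-parallelizable family this sum is nonzero, so the label of the edge is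
its line of force. A surgery regroups four partial sums `f₃, f₄, f₅, f₆` of total zero, replacing
`f₃ + f₄` by `f₃ + f₅`, and the points of its construction are exactly those through which the new
resultant can be seen to pass (`eval_surgeryLine`). Labels therefore remain lines of partial sums,
the symbol "true" never arises, and the framing of `ij`, `ik` is the line of `f i j + f i k`,
whatever surgeries and generic choices are made. Conversely, non-parallelizable forces in
equilibrium at every vertex label the trees by their partial sums (`exists_quantization`).

Cycles. On a framed cycle, consider nonzero forces along the edges whose consecutive differences act
along the framing lines. Projecting two vertices eliminates one of these forces
(`exists_projection`); for a triangle, existence is concurrency of the framings. Since the framings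
are lines of `f i j + f i k`, such edge forces are the same as nonzero factors `lam` with `lam i • f
i j + lam j • f j i = 0` along the cycle (`IsLeafForces.condition_holds_iff`).

Gluing. The ratio of the two leaf forces of an edge is a gain in `ℝˣ`, and the condition of a cycle
says that the cycle carries a potential, so that its gain is trivial. A cycle through all vertices
has a chord because degrees are at least 3, and the chord splits it into two cycles that miss a
vertex; hence all gains are trivial and connectedness gives a global potential `lam`
(`exists_potential`). The forces `lam i • f i j` are the tensegrity. In the other direction the
forces of a tensegrity are themselves the leaf forces, with `lam = 1`. -/

noncomputable section

namespace Tensegrity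

/-! ### Forces as vectors -/

/-- The coordinates of a 2-form; the form `wedge p q` corresponds to the cross product. -/
def forceVec : Force →ₗ[ℝ] (Fin 3 → ℝ) where
  toFun F := ![F ![Pi.single 1 1, Pi.single 2 1], F ![Pi.single 2 1, Pi.single 0 1],
    F ![Pi.single 0 1, Pi.single 1 1]]
  map_add' F F' := by ext i; fin_cases i <;> simp
  map_smul' c F := by ext i; fin_cases i <;> simp

theorem forceVec_injective : Function.Injective forceVec := by
  rw [injective_iff_map_eq_zero]
  intro F h
  have h0 : F ![Pi.single 1 1, Pi.single 2 1] = 0 := congrFun h 0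
  have h1 : F ![Pi.single 2 1, Pi.single 0 1] = 0 := congrFun h 1
  have h2 : F ![Pi.single 0 1, Pi.single 1 1] = 0 := congrFun h 2
  have swap : ∀ x y : Fin 3 → ℝ, F ![x, y] = 0 → F ![y, x] = 0 := by
    intro x y hxy
    have := F.map_swap ![x, y] (i := 0) (j := 1) (by decide)
    have e : (![x, y] ∘ ⇑(Equiv.swap (0 : Fin 2) 1)) = ![y, x] := by
      ext i; fin_cases i <;> simp
    rw [e, hxy] at this
    simpa using this
  refine Basis.ext_alternating (Pi.basisFun ℝ (Fin 3)) fun v hv => ?_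
  have e : (fun i => Pi.basisFun ℝ (Fin 3) (v i)) =
      ![Pi.single (v 0) (1 : ℝ), Pi.single (v 1) (1 : ℝ)] := by
    ext i; fin_cases i <;> simp
  rw [e]
  have hne : v 0 ≠ v 1 := fun h => by simpa using hv h
  generalize v 0 = a at *
  generalize v 1 = b at *
  rw [AlternatingMap.zero_apply]
  fin_cases a <;> fin_cases b <;> simp at hne <;> first | assumption | (apply swap; assumption)

theorem wedge_apply (p q x y : Fin 3 → ℝ) :
    wedge p q ![x, y] = p ⬝ᵥ x * q ⬝ᵥ y - q ⬝ᵥ x * p ⬝ᵥ y := by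
  refine (Matrix.det_fin_two _).trans ?_
  change ((Matrix.of ![p, q]).mulVecLin x) 0 * ((Matrix.of ![p, q]).mulVecLin y) 1 -
    ((Matrix.of ![p, q]).mulVecLin x) 1 * ((Matrix.of ![p, q]).mulVecLin y) 0 = _
  simp [Matrix.mulVec]

theorem forceVec_wedge (p q : Fin 3 → ℝ) : forceVec (wedge p q) = crossProduct p q := by
  ext i
  fin_cases i <;> simp [forceVec, wedge_apply, cross_apply, dotProduct_single] <;> ring

theorem forceVec_eq_zero {F : Force} : forceVec F = 0 ↔ F = 0 :=
  map_eq_zero_iff forceVec forceVec_injective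

/-- The line of force of `F` passes through `p`, or `F` is zero. -/
def Through (F : Force) (p : Point) : Prop := forceVec F ⬝ᵥ p.rep = 0

theorem Through.add {F F' : Force} {p : Point} (h : Through F p) (h' : Through F' p) :
    Through (F + F') p := by
  simp_all [Through]

theorem Through.neg {F : Force} {p : Point} (h : Through F p) : Through (-F) p := by
  simp_all [Through]

theorem Through.sub {F F' : Force} {p : Point} (h : Through F p) (h' : Through F' p) :
    Through (F - F') p := by
  simp_all [Through]

theorem Through.smul {F : Force} {p : Point} (c : ℝ) (h : Through F p) : Through (c • F) p := by
  simp_all [Through]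

theorem Through.sum {ι : Type*} {p : Point} {f : ι → Force} (A : Finset ι)
    (h : ∀ i ∈ A, Through (f i) p) : Through (∑ i ∈ A, f i) p := by
  simp only [Through, map_sum, sum_dotProduct]
  exact Finset.sum_eq_zero h

theorem exists_span_pair (ℓ : Line) :
    ∃ p q : Fin 3 → ℝ, ℓ.1 = Submodule.span ℝ {p, q} ∧ LinearIndependent ℝ ![p, q] := by
  have b := Module.finBasisOfFinrankEq ℝ ℓ.1 ℓ.2
  refine ⟨b 0, b 1, ?_, ?_⟩
  · have := b.span_eq
    have h2 := congrArg (Submodule.map ℓ.1.subtype) this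
    rw [Submodule.map_span, Submodule.map_top, Submodule.range_subtype] at h2
    refine h2.symm.trans (congrArg (Submodule.span ℝ) (Set.ext fun x => ⟨?_, ?_⟩))
    · rintro ⟨_, ⟨i, rfl⟩, rfl⟩
      fin_cases i
      exacts [Or.inl rfl, Or.inr rfl]
    · rintro (rfl | rfl)
      exacts [⟨_, ⟨0, rfl⟩, rfl⟩, ⟨_, ⟨1, rfl⟩, rfl⟩]
  · have h := b.linearIndependent.map' ℓ.1.subtype (Submodule.ker_subtype _)
    have e : ![(b 0 : Fin 3 → ℝ), b 1] = ℓ.1.subtype ∘ b := by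
      funext i
      fin_cases i <;> rfl
    rw [e]
    exact h

/-- The orthogonal complement of a plane is spanned by the cross product of a basis. In this form
the zero force needs no separate treatment, and the forces along a line visibly form a linear space.
-/
theorem actsAlong_iff {F : Force} {ℓ : Line} :
    ActsAlong F ℓ ↔ ∀ x ∈ ℓ.1, forceVec F ⬝ᵥ x = 0 := by
  constructor
  · rintro (rfl | ⟨p, q, rfl, h⟩) x hx
    · simp
    · rw [h, Submodule.mem_span_pair] at hx
      obtain ⟨a, b, rfl⟩ := hx
      simp [forceVec_wedge, dotProduct_comm (crossProduct p q)]
  · intro h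
    obtain ⟨p, q, hs, hli⟩ := exists_span_pair ℓ
    have hc := crossProduct_ne_zero_iff_linearIndependent.2 hli
    have hp : forceVec F ⬝ᵥ p = 0 := h p (hs ▸ Submodule.subset_span (by simp))
    have hq : forceVec F ⬝ᵥ q = 0 := h q (hs ▸ Submodule.subset_span (by simp))
    -- By the triple product formula, a vector orthogonal to `p` and `q` has zero cross product with
    -- `p × q`, hence is a multiple of it.
    have h0 : crossProduct (crossProduct p q) (forceVec F) = 0 := by
      rw [cross_cross_eq_smul_sub_smul]
      rw [dotProduct_comm] at hp hq
      simp [hp, hq]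
    have hnl : ¬ LinearIndependent ℝ ![crossProduct p q, forceVec F] := fun hh =>
      crossProduct_ne_zero_iff_linearIndependent.2 hh h0
    rw [LinearIndependent.pair_iff' hc] at hnl
    push Not at hnl
    obtain ⟨c, hcF⟩ := hnl
    have hF : F = wedge (c • p) q := by
      apply forceVec_injective
      rw [forceVec_wedge, ← hcF]
      simp
    by_cases hc0 : c = 0
    · left
      rw [← forceVec_eq_zero, ← hcF, hc0, zero_smul]
    · right
      refine ⟨c • p, q, hF, ?_⟩
      rw [hs, Submodule.span_insert, Submodule.span_insert,
        Submodule.span_singleton_smul_eq (IsUnit.mk0 c hc0)]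

theorem IsLineOfForce.ne_zero {F : Force} {ℓ : Line} (h : IsLineOfForce F ℓ) : F ≠ 0 := by
  obtain ⟨p, q, rfl, hs⟩ := h
  intro h0
  have h1 : crossProduct p q = 0 := by rw [← forceVec_wedge, h0, map_zero]
  have hli : ¬ LinearIndependent ℝ ![p, q] := fun h =>
    crossProduct_ne_zero_iff_linearIndependent.2 h h1
  apply hli
  rw [linearIndependent_iff_card_eq_finrank_span]
  have : Set.range ![p, q] = {p, q} := by simp [Matrix.range_cons, Matrix.range_empty, Set.pair_comm]
  rw [Set.finrank, this, ← hs, ℓ.2]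
  rfl

theorem isLineOfForce_iff {F : Force} {ℓ : Line} :
    IsLineOfForce F ℓ ↔ F ≠ 0 ∧ ActsAlong F ℓ :=
  ⟨fun h => ⟨h.ne_zero, Or.inr h⟩, fun h => h.2.resolve_left h.1⟩

theorem ActsAlong.add {F F' : Force} {ℓ : Line} (h : ActsAlong F ℓ) (h' : ActsAlong F' ℓ) :
    ActsAlong (F + F') ℓ := by
  rw [actsAlong_iff] at *
  intro x hx
  simp [h x hx, h' x hx]

theorem ActsAlong.smul {F : Force} {ℓ : Line} (c : ℝ) (h : ActsAlong F ℓ) :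
    ActsAlong (c • F) ℓ := by
  rw [actsAlong_iff] at *
  intro x hx
  simp [h x hx]

theorem ActsAlong.neg {F : Force} {ℓ : Line} (h : ActsAlong F ℓ) : ActsAlong (-F) ℓ := by
  rw [← neg_one_smul ℝ F]
  exact h.smul (-1)

theorem ActsAlong.sub {F F' : Force} {ℓ : Line} (h : ActsAlong F ℓ) (h' : ActsAlong F' ℓ) :
    ActsAlong (F - F') ℓ := by
  rw [sub_eq_add_neg]
  exact h.add h'.neg

theorem rep_mem_submodule (p : Point) : p.rep ∈ p.submodule := by
  rw [Projectivization.submodule_eq]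
  exact Submodule.mem_span_singleton_self _

theorem ActsAlong.through {F : Force} {ℓ : Line} (h : ActsAlong F ℓ) {p : Point} (hp : p ∈ ℓ) :
    Through F p :=
  actsAlong_iff.1 h _ (hp (rep_mem_submodule p))

theorem eq_of_le {ℓ m : Line} (h : ℓ.1 ≤ m.1) : ℓ = m :=
  Subtype.ext (Submodule.eq_of_le_of_finrank_eq h (ℓ.2.trans m.2.symm))

theorem sup_eq_of_mem {p q : Point} {ℓ : Line} (h : p ≠ q) (hp : p ∈ ℓ) (hq : q ∈ ℓ) :
    p.submodule ⊔ q.submodule = ℓ.1 :=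
  Submodule.eq_of_le_of_finrank_eq (sup_le hp hq) ((finrank_sup_of_ne h).trans ℓ.2.symm)

theorem line_unique {p q : Point} {ℓ m : Line} (h : p ≠ q) (hp : p ∈ ℓ) (hq : q ∈ ℓ)
    (hp' : p ∈ m) (hq' : q ∈ m) : ℓ = m :=
  Subtype.ext ((sup_eq_of_mem h hp hq).symm.trans (sup_eq_of_mem h hp' hq'))

theorem point_unique {p q : Point} {ℓ m : Line} (h : ℓ ≠ m) (hp : p ∈ ℓ) (hq : q ∈ ℓ)
    (hp' : p ∈ m) (hq' : q ∈ m) : p = q := by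
  by_contra hne
  exact h (line_unique hne hp hq hp' hq')

/-- The two points span the plane of the line, and orthogonality is linear. This is the main tool
for finding the line of an unknown resultant. -/
theorem actsAlong_of_through {F : Force} {p q : Point} {ℓ : Line} (h : p ≠ q) (hp : p ∈ ℓ)
    (hq : q ∈ ℓ) (h1 : Through F p) (h2 : Through F q) : ActsAlong F ℓ := by
  rw [actsAlong_iff]
  intro x hx
  rw [← sup_eq_of_mem h hp hq, Projectivization.submodule_eq, Projectivization.submodule_eq,
    ← Submodule.span_union, Set.singleton_union, Submodule.mem_span_pair] at hx
  obtain ⟨a, b, rfl⟩ := hx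
  simp only [Through] at h1 h2
  simp [h1, h2]

/-- The plane of vectors on which a nonzero force vanishes. -/
theorem exists_isLineOfForce {F : Force} (h : F ≠ 0) :
    ∃ ℓ, IsLineOfForce F ℓ ∧ ∀ x, forceVec F ⬝ᵥ x = 0 → x ∈ ℓ.1 := by
  have hv : forceVec F ≠ 0 := fun h' => h (forceVec_eq_zero.1 h')
  let φ : (Fin 3 → ℝ) →ₗ[ℝ] ℝ := dotProductBilin ℝ ℝ (forceVec F)
  have hφ : ∀ x, φ x = forceVec F ⬝ᵥ x := fun x => rfl
  have hφ0 : φ ≠ 0 := by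
    intro h0
    apply hv
    have : φ (forceVec F) = 0 := by rw [h0]; rfl
    rw [hφ] at this
    exact dotProduct_self_eq_zero.1 this
  have hr := LinearMap.finrank_range_add_finrank_ker φ
  rw [LinearMap.range_eq_top.2 (LinearMap.surjective hφ0)] at hr
  simp at hr
  exact ⟨⟨LinearMap.ker φ, by omega⟩,
    isLineOfForce_iff.2 ⟨h, actsAlong_iff.2 fun x hx => hx⟩, fun x hx => hx⟩

theorem IsLineOfForce.mem_of_through {F : Force} {ℓ : Line} {p : Point} (h : IsLineOfForce F ℓ)
    (hp : Through F p) : p ∈ ℓ := by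
  obtain ⟨h0, ha⟩ := isLineOfForce_iff.1 h
  obtain ⟨m, hm, hm'⟩ := exists_isLineOfForce h0
  have : ℓ = m := eq_of_le fun x hx => hm' x (actsAlong_iff.1 ha x hx)
  rw [this]
  intro x hx
  rw [Projectivization.submodule_eq, Submodule.mem_span_singleton] at hx
  obtain ⟨a, rfl⟩ := hx
  exact m.1.smul_mem a (hm' _ hp)

theorem ActsAlong.mem_of_through {F : Force} {ℓ : Line} {p : Point} (h : ActsAlong F ℓ)
    (h0 : F ≠ 0) (hp : Through F p) : p ∈ ℓ :=
  (isLineOfForce_iff.2 ⟨h0, h⟩).mem_of_through hp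

theorem ActsAlong.eq_line {F : Force} {ℓ m : Line} (h : ActsAlong F ℓ) (h' : ActsAlong F m)
    (h0 : F ≠ 0) : ℓ = m := by
  obtain ⟨k, hk, hk'⟩ := exists_isLineOfForce h0
  rw [eq_of_le (m := k) fun x hx => hk' x (actsAlong_iff.1 h x hx),
    eq_of_le (m := k) fun x hx => hk' x (actsAlong_iff.1 h' x hx)]

theorem ActsAlong.eq_zero {F : Force} {ℓ m : Line} (h : ActsAlong F ℓ) (h' : ActsAlong F m)
    (hne : ℓ ≠ m) : F = 0 := by
  by_contra h0
  exact hne (h.eq_line h' h0)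

theorem IsLineOfForce.eq_line {F : Force} {ℓ m : Line} (h : IsLineOfForce F ℓ)
    (h' : IsLineOfForce F m) : ℓ = m :=
  ActsAlong.eq_line (Or.inr h) (Or.inr h') h.ne_zero

theorem IsLineOfForce.neg {F : Force} {ℓ : Line} (h : IsLineOfForce F ℓ) :
    IsLineOfForce (-F) ℓ := by
  rw [isLineOfForce_iff] at *
  exact ⟨neg_ne_zero.2 h.1, h.2.neg⟩

theorem exists_ne_zero_actsAlong (ℓ : Line) : ∃ F, F ≠ 0 ∧ ActsAlong F ℓ := by
  obtain ⟨p, q, hs, -⟩ := exists_span_pair ℓ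
  have : IsLineOfForce (wedge p q) ℓ := ⟨p, q, rfl, hs⟩
  exact ⟨_, isLineOfForce_iff.1 this⟩

theorem exists_mem_ne (ℓ : Line) (p : Point) : ∃ r ∈ ℓ, r ≠ p := by
  have : ¬ ℓ.1 ≤ p.submodule := by
    intro h
    have := Submodule.finrank_mono h
    rw [ℓ.2, Projectivization.finrank_submodule] at this
    omega
  obtain ⟨x, hx, hxp⟩ := SetLike.not_le_iff_exists.1 this
  have hx0 : x ≠ 0 := by rintro rfl; exact hxp (Submodule.zero_mem _)
  refine ⟨Projectivization.mk ℝ x hx0, ?_, ?_⟩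
  · change (Projectivization.mk ℝ x hx0).submodule ≤ ℓ.1
    rw [Projectivization.submodule_mk, Submodule.span_singleton_le_iff_mem]
    exact hx
  · rintro rfl
    apply hxp
    rw [Projectivization.submodule_mk]
    exact Submodule.mem_span_singleton_self x

/-- A force at `p` is the sum of forces along two given lines through `p`. -/
theorem exists_decomposition {F : Force} {p : Point} {ℓ m : Line} (hne : ℓ ≠ m) (hℓ : p ∈ ℓ)
    (hm : p ∈ m) (h : Through F p) : ∃ E, ActsAlong E ℓ ∧ ActsAlong (F - E) m := by
  obtain ⟨r, hr, hrp⟩ := exists_mem_ne m p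
  obtain ⟨E, hE0, hE⟩ := exists_ne_zero_actsAlong ℓ
  -- If `E` passed through `r`, its line would contain `p` and `r` and would be `m`. So some
  -- multiple of `E` has the same pairing with `r` as `F`, and subtracting it leaves a force through
  -- `r` and `p`.
  have hEr : forceVec E ⬝ᵥ r.rep ≠ 0 := fun h0 =>
    hne (line_unique hrp (hE.mem_of_through hE0 h0) hℓ hr hm)
  refine ⟨(forceVec F ⬝ᵥ r.rep / forceVec E ⬝ᵥ r.rep) • E, hE.smul _, ?_⟩
  refine actsAlong_of_through hrp hr hm ?_ (h.sub ((hE.through hℓ).smul _))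
  simp only [Through, map_sub, map_smul, sub_dotProduct, smul_dotProduct, smul_eq_mul]
  field_simp
  ring

/-- The forces along a line form a one-dimensional space: subtract the multiple of `E` that makes
the rest pass through a point off the line. -/
theorem ActsAlong.exists_smul {F E : Force} {ℓ : Line} (hF : ActsAlong F ℓ) (hE : ActsAlong E ℓ)
    (h0 : E ≠ 0) : ∃ c : ℝ, F = c • E := by
  obtain ⟨m, hm, -⟩ := exists_isLineOfForce h0
  have : ∃ r : Point, ¬ Through E r := by
    have hv : forceVec E ≠ 0 := fun h' => h0 (forceVec_eq_zero.1 h')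
    -- The coordinate vector of `E`, read as a point, is off the line of `E`, because a nonzero real
    -- vector is not orthogonal to itself.
    refine ⟨Projectivization.mk ℝ (forceVec E) hv, ?_⟩
    intro h
    have := hE.mem_of_through h0 h
    have h2 : forceVec E ∈ ℓ.1 := this (by
      rw [Projectivization.submodule_mk]; exact Submodule.mem_span_singleton_self _)
    exact hv (dotProduct_self_eq_zero.1 (actsAlong_iff.1 hE _ h2))
  obtain ⟨r, hr⟩ := this
  refine ⟨forceVec F ⬝ᵥ r.rep / forceVec E ⬝ᵥ r.rep, ?_⟩
  rw [← sub_eq_zero]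
  have h1 : ActsAlong (F - (forceVec F ⬝ᵥ r.rep / forceVec E ⬝ᵥ r.rep) • E) ℓ :=
    hF.sub (hE.smul _)
  by_contra hne
  have h2 : Through (F - (forceVec F ⬝ᵥ r.rep / forceVec E ⬝ᵥ r.rep) • E) r := by
    simp only [Through] at hr ⊢
    simp only [map_sub, map_smul, sub_dotProduct, smul_dotProduct, smul_eq_mul]
    field_simp
    ring
  exact hr (hE.through (h1.mem_of_through hne h2))

/-! ### Joins and meets -/

theorem join_eq_some {p q : Point} {ℓ : Line} :
    join p q = some ℓ ↔ p ≠ q ∧ p ∈ ℓ ∧ q ∈ ℓ := by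
  unfold join
  split_ifs with h
  · simp [h]
  · refine Iff.trans Option.some_inj ⟨?_, ?_⟩
    · rintro rfl
      exact ⟨h, le_sup_left, le_sup_right⟩
    · rintro ⟨-, hp, hq⟩
      exact Subtype.ext (sup_eq_of_mem h hp hq)

theorem meet_eq_some {ℓ m : Line} {p : Point} :
    meet ℓ m = some p ↔ ℓ ≠ m ∧ p ∈ ℓ ∧ p ∈ m := by
  unfold meet
  split_ifs with h
  · simp [h]
  · rw [Option.some_inj]
    constructor
    · rintro rfl
      refine ⟨h, ?_, ?_⟩
      · change Projectivization.submodule _ ≤ ℓ.1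
        rw [Projectivization.submodule_mk'']
        exact inf_le_left
      · change Projectivization.submodule _ ≤ m.1
        rw [Projectivization.submodule_mk'']
        exact inf_le_right
    · rintro ⟨-, hp, hq⟩
      apply Projectivization.submodule_injective
      rw [Projectivization.submodule_mk'']
      exact (Submodule.eq_of_le_of_finrank_eq (le_inf hp hq)
        ((Projectivization.finrank_submodule p).trans (finrank_inf_of_ne h).symm)).symm

theorem exists_join {p q : Point} (h : p ≠ q) : ∃ ℓ, join p q = some ℓ := by
  rw [join, dif_neg h]
  exact ⟨_, rfl⟩

theorem exists_meet {ℓ m : Line} (h : ℓ ≠ m) : ∃ p, meet ℓ m = some p := by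
  simp [meet, h]

/-! ### Evaluation of expressions -/

section Eval

variable {V : Type*} {d : V → ℕ} {σ : GenericChoice d} {P : V → Point} {ξ : Config d P}

theorem eval_meet {ℓ m : GeomExpr d .line} {x y : Line} {p : Point} (hx : ℓ.eval σ ξ = some x)
    (hy : m.eval σ ξ = some y) (h : meet x y = some p) : (ℓ.meet m).eval σ ξ = some p := by
  simp only [GeomExpr.eval, hx, hy]
  exact h

theorem eval_join {p q : GeomExpr d .point} {x y : Point} {ℓ : Line} (hx : p.eval σ ξ = some x)
    (hy : q.eval σ ξ = some y) (h : join x y = some ℓ) : (p.join q).eval σ ξ = some ℓ := by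
  simp only [GeomExpr.eval, hx, hy]
  exact h

theorem eval_genericPoint {ℓ : GeomExpr d .line} {a b : GeomExpr d .point} {x : Line} {y z : Point}
    (hx : ℓ.eval σ ξ = some x) (hy : a.eval σ ξ = some y) (hz : b.eval σ ξ = some z) :
    ∃ q : Point, (GeomExpr.genericPoint ℓ a b).eval σ ξ = some q ∧ q ∈ x ∧ q ≠ y ∧ q ≠ z := by
  refine ⟨σ.point (.genericPoint ℓ a b) x y z, ?_, σ.point_mem _ _ _ _, σ.point_ne_left _ _ _ _,
    σ.point_ne_right _ _ _ _⟩
  simp only [GeomExpr.eval, hx, hy, hz]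
  rfl

theorem eval_genericLine {p : GeomExpr d .point} {m : GeomExpr d .line} {x : Point} {y : Line}
    (hx : p.eval σ ξ = some x) (hy : m.eval σ ξ = some y) :
    ∃ k : Line, (GeomExpr.genericLine p m).eval σ ξ = some k ∧ x ∈ k ∧ k ≠ y := by
  refine ⟨σ.line (.genericLine p m) x y, ?_, σ.line_mem _ _ _, σ.line_ne _ _ _⟩
  simp only [GeomExpr.eval, hx, hy]
  rfl

end Eval

/-! ### Framed cycles -/

/-- A vertex of a framed cycle, its framing line and the line of the edge to the next vertex. -/
structure CycleDatum where
  pt : Point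
  fr : Line
  out : Line

/-- The incidences of a framed cycle, where `c` is the line of the edge before the first vertex. -/
def IsFramedChain (c : Line) : List CycleDatum → Prop
  | [] => True
  | x :: L => x.pt ∈ c ∧ x.pt ∈ x.out ∧ x.pt ∈ x.fr ∧ x.fr ≠ c ∧ x.fr ≠ x.out ∧
      IsFramedChain x.out L

/-- There are nonzero forces along the edges, after the force `h₀` and ending in `h₁`, that are
balanced by forces along the framing lines. -/
def Balanced (h₀ h₁ : Force) : List CycleDatum → Prop
  | [] => h₀ = h₁
  | x :: L => ∃ h, h ≠ 0 ∧ ActsAlong h x.out ∧ ActsAlong (h - h₀) x.fr ∧ Balanced h h₁ L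

/-- No three different lines of the set have a common point. -/
def NoThreeConcurrent (S : Set Line) : Prop :=
  ∀ a ∈ S, ∀ b ∈ S, ∀ c ∈ S, a ≠ b → a ≠ c → b ≠ c → ∀ q : Point, q ∈ a → q ∈ b → ¬ q ∈ c

/-- The projection of two consecutive vertices of a framed cycle. -/
theorem exists_projection {c : Line} {x y : CycleDatum} (hch : IsFramedChain c [x, y])
    (hcx : c ≠ x.out) (hcy : c ≠ y.out)
    (hno : ∀ q : Point, q ∈ c → q ∈ x.out → ¬ q ∈ y.out) :
    ∃ (q o : Point) (ℓ : Line), meet c y.out = some q ∧ meet x.fr y.fr = some o ∧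
      join q o = some ℓ ∧ ℓ ≠ c ∧ ℓ ≠ y.out ∧ ∀ h₀ h₂ : Force, h₀ ≠ 0 → ActsAlong h₀ c →
        ActsAlong h₂ y.out →
        ((∃ h, h ≠ 0 ∧ ActsAlong h x.out ∧ ActsAlong (h - h₀) x.fr ∧ ActsAlong (h₂ - h) y.fr) ↔
          ActsAlong (h₂ - h₀) ℓ) := by
  obtain ⟨x1, x2, x3, x4, x5, y1, y2, y3, y4, y5, -⟩ := hch
  have hpt : x.pt ≠ y.pt := fun h => hno x.pt x1 x2 (h ▸ y2)
  have hfr : x.fr ≠ y.fr := fun h => x5 (line_unique hpt x3 (h ▸ y3) x2 y1)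
  obtain ⟨q, hq⟩ := exists_meet hcy
  obtain ⟨o, ho⟩ := exists_meet hfr
  obtain ⟨-, qc, qy⟩ := meet_eq_some.1 hq
  obtain ⟨-, ox, oy⟩ := meet_eq_some.1 ho
  have hqx : q ≠ x.pt := fun h => hno q qc (h ▸ x2) qy
  have hqo : q ≠ o := fun h => x4 (line_unique hqx (h ▸ ox) x3 qc x1)
  have hoy : o ≠ y.pt := fun h => x5 (line_unique hpt x3 (h ▸ ox) x2 y1)
  have hox : o ≠ x.pt := fun h => y4 (line_unique hpt (h ▸ oy) y3 x2 y1)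
  obtain ⟨ℓ, hℓ⟩ := exists_join hqo
  obtain ⟨-, qℓ, oℓ⟩ := join_eq_some.1 hℓ
  refine ⟨q, o, ℓ, hq, ho, hℓ, ?_, ?_, ?_⟩
  · rintro rfl
    exact x4 (line_unique hox ox x3 oℓ x1)
  · rintro rfl
    exact y5 (line_unique hoy oy y3 oℓ y2)
  · intro h₀ h₂ h₀0 h₀c h₂y
    constructor
    · rintro ⟨h, -, -, hx, hy⟩
      refine actsAlong_of_through hqo qℓ oℓ ((h₂y.through qy).sub (h₀c.through qc)) ?_
      have := (hy.through oy).add (hx.through ox)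
      rwa [sub_add_sub_cancel] at this
    · intro h
      -- The force of the eliminated edge is forced to be the `x.out`-component of `h₀`. It remains
      -- to see that `h₂ - E` passes through `o` and `y.pt`.
      obtain ⟨E, hE, hE'⟩ := exists_decomposition x5.symm x2 x3 (h₀c.through x1)
      have hE'' : ActsAlong (E - h₀) x.fr := by simpa using hE'.neg
      refine ⟨E, ?_, hE, hE'', ?_⟩
      · rintro rfl
        rw [sub_zero] at hE'
        exact x4 (hE'.eq_line h₀c h₀0)
      · refine actsAlong_of_through hoy oy y3 ?_ ((h₂y.through y2).sub (hE.through y1))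
        have := (h.through oℓ).sub (hE''.through ox)
        rwa [sub_sub_sub_cancel_right] at this

/-- Projecting `x` and `y` puts the new vertex at `z.pt`, so that a two-gon with framings `ℓ` and
`z.fr` is left; it is balanced exactly when these lines coincide. Since `ℓ` joins `z.pt` to `x.fr ∩
y.fr`, this is concurrency. -/
theorem balanced_triangle_iff {x y z : CycleDatum} (hch : IsFramedChain z.out [x, y, z])
    (hzx : z.out ≠ x.out) (hzy : z.out ≠ y.out)
    (hno : ∀ q : Point, q ∈ z.out → q ∈ x.out → ¬ q ∈ y.out) :
    (∃ h₀, h₀ ≠ 0 ∧ ActsAlong h₀ z.out ∧ Balanced h₀ h₀ [x, y, z]) ↔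
      ∃ q : Point, q ∈ x.fr ∧ q ∈ y.fr ∧ q ∈ z.fr := by
  have hch' := hch
  obtain ⟨x1, x2, x3, x4, x5, y1, y2, y3, y4, y5, z1, z2, z3, z4, z5, -⟩ := hch'
  obtain ⟨q, o, ℓ, hq, ho, hℓ, hℓc, hℓy, H⟩ :=
    exists_projection (x := x) (y := y) (c := z.out)
      ⟨x1, x2, x3, x4, x5, y1, y2, y3, y4, y5, trivial⟩ hzx hzy hno
  obtain ⟨-, qc, qy⟩ := meet_eq_some.1 hq
  obtain ⟨hfr, ox, oy⟩ := meet_eq_some.1 ho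
  obtain ⟨hqo, qℓ, oℓ⟩ := join_eq_some.1 hℓ
  have hqz : q = z.pt := point_unique hzy qc z2 qy z1
  have key : (∃ h₀, h₀ ≠ 0 ∧ ActsAlong h₀ z.out ∧ Balanced h₀ h₀ [x, y, z]) ↔ ℓ = z.fr := by
    constructor
    · rintro ⟨h₀, h0, h0z, h1, h10, h1x, h1x', h2, h20, h2y, h2y', h3, h30, h3z, h3z', rfl⟩
      have := (H h3 h2 h0 h0z h2y).1 ⟨h1, h10, h1x, h1x', h2y'⟩
      have hz : ActsAlong (h2 - h3) z.fr := by simpa using h3z'.neg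
      refine this.eq_line hz ?_
      intro h
      rw [sub_eq_zero] at h
      subst h
      exact hzy (h3z.eq_line h2y h30)
    -- Conversely, choose the closing force freely and let `h2` be its component along `y.out` in
    -- the decomposition along `y.out` and the common framing line.
    · rintro rfl
      obtain ⟨h₀, h0, h0z⟩ := exists_ne_zero_actsAlong z.out
      obtain ⟨h2, h2y, h2z⟩ := exists_decomposition hℓy.symm qy qℓ (h0z.through qc)
      have hz' : ActsAlong (h2 - h₀) z.fr := by simpa using h2z.neg
      obtain ⟨h1, h10, h1x, h1x', h1y⟩ := (H h₀ h2 h0 h0z h2y).2 hz'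
      refine ⟨h₀, h0, h0z, h1, h10, h1x, h1x', h2, ?_, h2y, h1y, h₀, h0, h0z, h2z, rfl⟩
      rintro rfl
      rw [sub_zero] at h2z
      exact hℓc (h2z.eq_line h0z h0)
  rw [key]
  constructor
  · rintro rfl
    exact ⟨o, ox, oy, oℓ⟩
  · rintro ⟨r, rx, ry, rz⟩
    obtain rfl : r = o := point_unique hfr rx ox ry oy
    exact line_unique hqo qℓ oℓ (hqz ▸ z3) rz

/-- The line found is that of the edge entering the last vertex. Membership in this list suffices
later to distinguish it from the edge that leaves this vertex. -/
theorem IsFramedChain.exists_mem_getLast {c : Line} {L : List CycleDatum}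
    (h : IsFramedChain c L) (hL : L ≠ []) :
    ∃ a ∈ c :: L.dropLast.map CycleDatum.out, (L.getLast hL).pt ∈ a := by
  induction L generalizing c with
  | nil => exact absurd rfl hL
  | cons x L ih =>
    obtain ⟨x1, -, -, -, -, h'⟩ := h
    cases L with
    | nil => exact ⟨c, by simp, x1⟩
    | cons y L =>
      obtain ⟨a, ha, ha'⟩ := ih h' (by simp)
      refine ⟨a, ?_, ?_⟩
      · simp only [List.dropLast_cons_cons, List.map_cons]
        exact List.mem_cons_of_mem _ ha
      · rw [List.getLast_cons_cons]
        exact ha'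

theorem IsFramedChain.mem_getLast_out {c : Line} {L : List CycleDatum}
    (h : IsFramedChain c L) (hL : L ≠ []) : (L.getLast hL).pt ∈ (L.getLast hL).out := by
  induction L generalizing c with
  | nil => exact absurd rfl hL
  | cons x L ih =>
    obtain ⟨-, x2, -, -, -, h'⟩ := h
    cases L with
    | nil => exact x2
    | cons y L =>
      rw [List.getLast_cons_cons]
      exact ih h' (by simp)

section Cycle

variable {V : Type*} {d : V → ℕ} {σ : GenericChoice d} {P : V → Point} {ξ : Config d P}

/-- The expressions of a framed vertex evaluate to the given point and line. -/
def FramedVertex.EvalsTo (σ : GenericChoice d) {P : V → Point} (ξ : Config d P)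
    (v : FramedVertex d) (x : CycleDatum) : Prop :=
  v.pt.eval σ ξ = some x.pt ∧ v.framing.eval σ ξ = some x.fr

theorem forall₂_getLast {α β : Type*} {R : α → β → Prop} {l : List α} {L : List β}
    (h : List.Forall₂ R l L) (hl : l ≠ []) (hL : L ≠ []) : R (l.getLast hl) (L.getLast hL) := by
  induction h with
  | nil => exact absurd rfl hl
  | @cons a b l L hab h ih =>
    cases h with
    | nil => exact hab
    | cons h1 h2 =>
      rw [List.getLast_cons_cons, List.getLast_cons_cons]
      exact ih (by simp) (by simp)

/-- Induction on the number `n + 3` of vertices. A projection is one step of `cycleCondition` on the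
left, and eliminates one edge force on the right. The list of edge lines only loses `x.out`, so
general position is inherited. -/
theorem cycleCondition_holds_iff_aux (n : ℕ) : ∀ (v : FramedVertex d) (l : List (FramedVertex d))
    (x : CycleDatum) (L : List CycleDatum), l.length = n + 2 → v.EvalsTo σ ξ x →
    List.Forall₂ (FramedVertex.EvalsTo σ ξ) l L →
    IsFramedChain ((x :: L).getLast (by simp)).out (x :: L) →
    ((x :: L).map CycleDatum.out).Nodup →
    NoThreeConcurrent {a | a ∈ (x :: L).map CycleDatum.out} →
    ((cycleCondition v l).Holds σ ξ ↔ ∃ h₀, h₀ ≠ 0 ∧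
      ActsAlong h₀ ((x :: L).getLast (by simp)).out ∧ Balanced h₀ h₀ (x :: L)) := by
  induction n with
  | zero =>
    intro v l x L hlen hv hl hch hnd hno
    obtain ⟨v2, v3, rfl⟩ := List.length_eq_two.1 hlen
    rcases hl with _ | @⟨_, y, _, _, h2, hl⟩
    rcases hl with _ | @⟨_, z, _, _, h3, hl⟩
    rcases hl with _ | _
    simp only [List.map_cons, List.map_nil, List.nodup_cons, List.mem_cons, List.not_mem_nil,
      or_false, not_or] at hnd
    obtain ⟨⟨e1, e2⟩, e3, -⟩ := hnd
    have := balanced_triangle_iff (x := x) (y := y) (z := z) hch (Ne.symm e2) (Ne.symm e3)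
      (fun q => hno _ (by simp) _ (by simp) _ (by simp) (Ne.symm e2) (Ne.symm e3) e1 q)
    refine Iff.trans ?_ this.symm
    simp only [cycleCondition, GeomCondition.Holds, hv.2, h2.2, h3.2]
    constructor
    · intro h
      exact h _ _ _ rfl rfl rfl
    · rintro h _ _ _ ⟨⟩ ⟨⟩ ⟨⟩
      exact h
  | succ n ih =>
    intro v l x L hlen hv hl hch hnd hno
    rcases hl with _ | @⟨v2, y, l1, L1, h2, hl1⟩
    · simp at hlen
    rcases hl1 with _ | @⟨v3, t, l2, L2, h3, hl2⟩
    · simp at hlen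
    rcases hl2 with _ | @⟨v4, z, l3, L3, h4, hl3⟩
    · simp at hlen
    have hfor : List.Forall₂ (FramedVertex.EvalsTo σ ξ) (v4 :: l3) (z :: L3) := .cons h4 hl3
    set w := (z :: L3).getLast (by simp) with hw
    have hlast : (x :: y :: t :: z :: L3).getLast (by simp) = w := by simp [hw]
    rw [hlast] at hch ⊢
    have hwE := forall₂_getLast hfor (by simp) (by simp)
    rw [← hw] at hwE
    have hwmem : w ∈ z :: L3 := List.getLast_mem _
    obtain ⟨x1, x2, x3, x4, x5, y1, y2, y3, y4, y5, hch'⟩ := hch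
    have hw_out : w.out ∈ (z :: L3).map CycleDatum.out := List.mem_map_of_mem hwmem
    have hcx : w.out ≠ x.out := by
      intro h
      rw [List.map_cons, List.nodup_cons] at hnd
      exact hnd.1 (h ▸ by simp only [List.map_cons] at hw_out ⊢; simp [hw_out])
    have hxy : x.out ≠ y.out := by
      intro h
      rw [List.map_cons, List.nodup_cons] at hnd
      exact hnd.1 (h ▸ by simp)
    have hnd' : ((y :: t :: z :: L3).map CycleDatum.out).Nodup := by
      rw [List.map_cons, List.nodup_cons] at hnd
      exact hnd.2
    have hcy : w.out ≠ y.out := by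
      intro h
      rw [List.map_cons, List.nodup_cons] at hnd'
      exact hnd'.1 (h ▸ by simp only [List.map_cons] at hw_out ⊢; simp [hw_out])
    have hw_out' : w.out ∈ (x :: y :: t :: z :: L3).map CycleDatum.out := by
      simp only [List.map_cons] at hw_out ⊢
      simp [hw_out]
    obtain ⟨q, o, ℓ, hq, ho, hℓ, hℓc, hℓy, H⟩ :=
      exists_projection (x := x) (y := y) (c := w.out)
        ⟨x1, x2, x3, x4, x5, y1, y2, y3, y4, y5, trivial⟩ hcx hcy
        (fun q => hno _ hw_out' _ (by simp) _ (by simp) hcx hcy hxy q)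
    obtain ⟨-, qc, qy⟩ := meet_eq_some.1 hq
    obtain ⟨hqo, qℓ, oℓ⟩ := join_eq_some.1 hℓ
    -- the vertices that span the lines of the edges
    have hwx : w.pt ≠ x.pt := by
      intro h
      -- If the last vertex were `x.pt`, the edge entering it, the closing edge and `x.out` would be
      -- three different lines with a common point.
      obtain ⟨a, ha, hwa⟩ := hch'.2.2.2.2.2.exists_mem_getLast (by simp)
      rw [← hw] at hwa
      have hsplit : (z :: L3).map CycleDatum.out =
          (z :: L3).dropLast.map CycleDatum.out ++ [w.out] := by
        conv_lhs => rw [← List.dropLast_append_getLast (l := z :: L3) (by simp)]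
        simp [hw]
      have hmem : t.out :: (z :: L3).map CycleDatum.out =
          (t.out :: (z :: L3).dropLast.map CycleDatum.out) ++ [w.out] := by
        rw [hsplit, List.cons_append]
      have hnd2 : ((t :: z :: L3).map CycleDatum.out).Nodup := by
        rw [List.map_cons, List.nodup_cons] at hnd'
        exact hnd'.2
      have haw : a ≠ w.out := by
        rintro rfl
        rw [List.map_cons, hmem, List.nodup_append] at hnd2
        exact hnd2.2.2 _ ha _ (by simp) rfl
      have ha' : a ∈ (t :: z :: L3).map CycleDatum.out := by
        rw [List.map_cons, hmem]
        exact List.mem_append_left _ ha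
      have hax : a ≠ x.out := by
        rintro rfl
        rw [List.map_cons, List.nodup_cons] at hnd
        exact hnd.1 (by rw [List.map_cons]; exact List.mem_cons_of_mem _ ha')
      exact hno a (by
        rw [List.map_cons, List.map_cons]
        exact List.mem_cons_of_mem _ (List.mem_cons_of_mem _ ha')) _ hw_out' x.out (by simp)
        haw hax hcx w.pt hwa (h ▸ x1) (h ▸ x2)
    have hw_self : w.pt ∈ w.out := by
      have := hch'.2.2.2.2.2.mem_getLast_out (by simp)
      rwa [← hw] at this
    have hyt : y.pt ≠ t.pt := by
      intro h
      have hne : x.out ≠ t.out ∧ y.out ≠ t.out := by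
        simp only [List.map_cons, List.nodup_cons, List.mem_cons, not_or] at hnd
        exact ⟨hnd.1.2.1, hnd.2.1.1⟩
      exact hno x.out (by simp) y.out (by simp) t.out (by simp) hxy hne.1 hne.2 y.pt y1 y2
        (h ▸ hch'.2.1)
    have hEl : (v4 :: l3).getLast (List.cons_ne_nil v4 l3) = (v4 :: l3).getLast (by simp) := rfl
    -- The projected vertex lies on the closing edge and keeps the outgoing edge of `y`, so the rest
    -- of the chain is unchanged.
    let x' : CycleDatum := ⟨q, ℓ, y.out⟩
    have hv' : (projectVertices ((v4 :: l3).getLast (List.cons_ne_nil v4 l3)) v v2 v3).EvalsTo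
        σ ξ x' := by
      have e1 : (projectVertices ((v4 :: l3).getLast (List.cons_ne_nil v4 l3)) v v2 v3).pt.eval
          σ ξ = some q := by
        refine eval_meet (eval_join hwE.1 hv.1 (join_eq_some.2 ⟨hwx, hw_self, x1⟩))
          (eval_join h2.1 h3.1 (join_eq_some.2 ⟨hyt, y2, hch'.1⟩)) hq
      exact ⟨e1, eval_join e1 (eval_meet hv.2 h2.2 ho) hℓ⟩
    have hlast' : (x' :: t :: z :: L3).getLast (by simp) = w := by simp [hw]
    have IH := ih (projectVertices ((v4 :: l3).getLast (List.cons_ne_nil v4 l3)) v v2 v3)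
      (v3 :: v4 :: l3) x' (t :: z :: L3) (by simpa using hlen) hv' (.cons h3 hfor)
      (by
        rw [hlast']
        exact ⟨qc, qy, qℓ, hℓc, hℓy, hch'⟩)
      hnd' (fun a ha b hb c hc => hno a (List.mem_cons_of_mem _ ha) b (List.mem_cons_of_mem _ hb)
        c (List.mem_cons_of_mem _ hc))
    rw [hlast'] at IH
    rw [cycleCondition, IH]
    refine exists_congr fun h₀ => and_congr_right fun h0 => and_congr_right fun h0c => ?_
    constructor
    · rintro ⟨h2, h20, h2y, h2l, hb⟩
      obtain ⟨h1, h10, h1x, h1x', h1y⟩ := (H h₀ h2 h0 h0c h2y).2 h2l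
      exact ⟨h1, h10, h1x, h1x', h2, h20, h2y, h1y, hb⟩
    · rintro ⟨h1, h10, h1x, h1x', h2, h20, h2y, h1y, hb⟩
      exact ⟨h2, h20, h2y, (H h₀ h2 h0 h0c h2y).1 ⟨h1, h10, h1x, h1x', h1y⟩, hb⟩

/-- The condition of a framed cycle holds if and only if the cycle carries nonzero forces that
are balanced by forces along the framing lines. -/
theorem cycleCondition_holds_iff {v : FramedVertex d} {l : List (FramedVertex d)}
    {x : CycleDatum} {L : List CycleDatum} (hlen : 2 ≤ l.length) (hv : v.EvalsTo σ ξ x)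
    (hl : List.Forall₂ (FramedVertex.EvalsTo σ ξ) l L)
    (hch : IsFramedChain ((x :: L).getLast (by simp)).out (x :: L))
    (hnd : ((x :: L).map CycleDatum.out).Nodup)
    (hno : NoThreeConcurrent {a | a ∈ (x :: L).map CycleDatum.out}) :
    (cycleCondition v l).Holds σ ξ ↔ ∃ h₀, h₀ ≠ 0 ∧
      ActsAlong h₀ ((x :: L).getLast (by simp)).out ∧ Balanced h₀ h₀ (x :: L) :=
  cycleCondition_holds_iff_aux (l.length - 2) v l x L (by omega) hv hl hch hnd hno

end Cycle

/-! ### Partial sums of non-parallelizable families -/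

section NonParallelizable

variable {ι : Type*} [Fintype ι] {f : ι → Force}

theorem NonParallelizable.sum_ne_zero (h : NonParallelizable f) {A : Finset ι} (h0 : A.Nonempty)
    (h1 : A ≠ Finset.univ) : ∑ j ∈ A, f j ≠ 0 := fun hs =>
  (h.1 A hs).elim h0.ne_empty h1

open Classical in
theorem sum_compl_eq_neg (h0 : ∑ j, f j = 0) (A : Finset ι) :
    ∑ j ∈ Aᶜ, f j = -∑ j ∈ A, f j := by
  rw [eq_neg_iff_add_eq_zero, Finset.sum_compl_add_sum, h0]

open Classical in
-- The definition compares only subfamilies with a common member. In equilibrium a complement has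
-- the opposite sum and hence the same line, so a disjoint pair reduces to this case by
-- complementing `B`.
theorem NonParallelizable.line_ne (h : NonParallelizable f) (h0 : ∑ j, f j = 0) {A B : Finset ι}
    (hA : A.Nonempty) (hA' : A ≠ Finset.univ) (hB : B.Nonempty) (hB' : B ≠ Finset.univ)
    (hAB : A ≠ B) (hABc : A ≠ Bᶜ) {ℓ m : Line} (hℓ : IsLineOfForce (∑ j ∈ A, f j) ℓ)
    (hm : IsLineOfForce (∑ j ∈ B, f j) m) : ℓ ≠ m := by
  rintro rfl
  obtain ⟨j, hj⟩ := hA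
  by_cases hjB : j ∈ B
  · exact h.2 j A B hj hjB hA' hB' hAB ℓ ⟨hℓ, hm⟩
  · refine h.2 j A Bᶜ hj (by simpa using hjB) hA' ?_ hABc ℓ ⟨hℓ, ?_⟩
    · rw [Ne, Finset.compl_eq_univ_iff]
      exact hB.ne_empty
    · rw [sum_compl_eq_neg h0]
      exact hm.neg

/-- The members `i` and `j` exclude `A = B` and properness fails for neither set; the member `k`
outside both excludes `A = Bᶜ`. -/
theorem NonParallelizable.line_ne_of_mem (h : NonParallelizable f) (h0 : ∑ j, f j = 0)
    {A B : Finset ι} (i j k : ι) (hijk : i ∈ A ∧ i ∉ B ∧ j ∉ A ∧ j ∈ B ∧ k ∉ A ∧ k ∉ B)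
    {ℓ m : Line} (hℓ : IsLineOfForce (∑ j ∈ A, f j) ℓ) (hm : IsLineOfForce (∑ j ∈ B, f j) m) :
    ℓ ≠ m := by
  obtain ⟨hi, hi', hj, hj', hk, hk'⟩ := hijk
  refine h.line_ne h0 ⟨i, hi⟩ (fun hu => hj (hu ▸ Finset.mem_univ _)) ⟨j, hj'⟩
    (fun hu => hi' (hu ▸ Finset.mem_univ _)) (fun hu => hi' (hu ▸ hi)) ?_ hℓ hm
  intro hu
  apply hk
  rw [hu]
  simpa using hk'

end NonParallelizable

/-! ### The line constructed by a surgery -/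

/-- Resolve `f₃ + f₄` at `pInf` into `E` along `lHat` and a force along `lInf`. Then `f₃ - E` acts
along `l'` and `f₅ + E` along `l''`, so their sum `f₃ + f₅` passes through `l' ∩ l''` as well as
through `o`. The three inequalities of lines keep the construction from degenerating: `n₂₅` gives
`pInf ∉ m₂₅`, `n₄₆` gives `l' ≠ l''`, and `n₃₄` gives `o ∉ l'`. -/
theorem eval_surgeryLine {V : Type*} {d : V → ℕ} {σ : GenericChoice d} {P : V → Point}
    {ξ : Config d P} {p : GeomExpr d .point} {l₁₂ l₁₃ l₁₄ l₂₅ l₂₆ : GeomExpr d .line}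
    {o : Point} {m₁₂ m₁₃ m₁₄ m₂₅ m₂₆ m : Line} {f₃ f₄ f₅ f₆ : Force}
    (hp : p.eval σ ξ = some o) (h₁₂ : l₁₂.eval σ ξ = some m₁₂) (h₁₃ : l₁₃.eval σ ξ = some m₁₃)
    (h₁₄ : l₁₄.eval σ ξ = some m₁₄) (h₂₅ : l₂₅.eval σ ξ = some m₂₅)
    (h₂₆ : l₂₆.eval σ ξ = some m₂₆) (hf : f₃ + f₄ + (f₅ + f₆) = 0)
    (t₃ : Through f₃ o) (t₄ : Through f₄ o) (t₅ : Through f₅ o) (t₆ : Through f₆ o)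
    (k₁₂ : IsLineOfForce (f₃ + f₄) m₁₂) (k₁₃ : IsLineOfForce f₃ m₁₃) (k₁₄ : IsLineOfForce f₄ m₁₄)
    (k₂₅ : IsLineOfForce f₅ m₂₅) (k₂₆ : IsLineOfForce f₆ m₂₆) (k : IsLineOfForce (f₃ + f₅) m)
    (n₃₄ : m₁₃ ≠ m₁₄) (n₂₅ : m₁₂ ≠ m₂₅) (n₄₆ : m₁₄ ≠ m₂₆) :
    (surgeryLine p l₁₂ l₁₃ l₁₄ l₂₅ l₂₆).eval σ ξ = some m := by
  have o₁₂ : o ∈ m₁₂ := k₁₂.mem_of_through (t₃.add t₄)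
  have o₁₃ : o ∈ m₁₃ := k₁₃.mem_of_through t₃
  have o₁₄ : o ∈ m₁₄ := k₁₄.mem_of_through t₄
  have o₂₅ : o ∈ m₂₅ := k₂₅.mem_of_through t₅
  have o₂₆ : o ∈ m₂₆ := k₂₆.mem_of_through t₆
  have om : o ∈ m := k.mem_of_through (t₃.add t₅)
  obtain ⟨pInf, epInf, pInf₁₂, pInf_ne, -⟩ := eval_genericPoint h₁₂ hp hp
  obtain ⟨lInf, elInf, pInf_l, lInf_ne⟩ := eval_genericLine epInf h₁₂
  have o_lInf : ¬ o ∈ lInf := fun h => lInf_ne (line_unique pInf_ne pInf_l h pInf₁₂ o₁₂)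
  have ne_lInf : ∀ {n : Line}, o ∈ n → n ≠ lInf := fun h h' => o_lInf (h' ▸ h)
  obtain ⟨a₁₃, ha₁₃⟩ := exists_meet (ne_lInf o₁₃)
  obtain ⟨a₁₄, ha₁₄⟩ := exists_meet (ne_lInf o₁₄)
  obtain ⟨a₂₆, ha₂₆⟩ := exists_meet (ne_lInf o₂₆)
  obtain ⟨-, i₁₃, i₁₃'⟩ := meet_eq_some.1 ha₁₃
  obtain ⟨-, i₁₄, i₁₄'⟩ := meet_eq_some.1 ha₁₄
  obtain ⟨-, i₂₆, i₂₆'⟩ := meet_eq_some.1 ha₂₆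
  obtain ⟨p', ep', p'₁₃, p'_ne, p'_ne'⟩ := eval_genericPoint h₁₃ hp (eval_meet h₁₃ elInf ha₁₃)
  have p'_lInf : ¬ p' ∈ lInf := fun h => p'_ne' (point_unique (ne_lInf o₁₃) p'₁₃ i₁₃ h i₁₃')
  have p'_pInf : p' ≠ pInf := fun h => p'_lInf (h ▸ pInf_l)
  -- The intersection of `l₁₂` with the line at infinity, as the construction writes it, is the
  -- chosen point `pInf` again.
  have epInf' := eval_meet h₁₂ elInf (meet_eq_some.2 ⟨ne_lInf o₁₂, pInf₁₂, pInf_l⟩)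
  obtain ⟨lHat, hlHat⟩ := exists_join p'_pInf
  have elHat := eval_join ep' epInf' hlHat
  obtain ⟨-, p'_lHat, pInf_lHat⟩ := join_eq_some.1 hlHat
  have pInf₂₅ : ¬ pInf ∈ m₂₅ := fun h => n₂₅ (line_unique pInf_ne pInf₁₂ o₁₂ h o₂₅)
  obtain ⟨p'', hp''⟩ := exists_meet (ℓ := lHat) (m := m₂₅) fun h => pInf₂₅ (h ▸ pInf_lHat)
  have ep'' := eval_meet elHat h₂₅ hp''
  obtain ⟨-, p''_lHat, p''₂₅⟩ := meet_eq_some.1 hp''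
  have lHat_ne : lHat ≠ lInf := fun h => p'_lInf (h ▸ p'_lHat)
  have p''_lInf : ¬ p'' ∈ lInf := fun h =>
    pInf₂₅ (point_unique lHat_ne p''_lHat pInf_lHat h pInf_l ▸ p''₂₅)
  have p'_a : p' ≠ a₁₄ := fun h => p'_lInf (h ▸ i₁₄')
  have p''_a : p'' ≠ a₂₆ := fun h => p''_lInf (h ▸ i₂₆')
  obtain ⟨l', hl'⟩ := exists_join p'_a
  obtain ⟨l'', hl''⟩ := exists_join p''_a
  have el' := eval_join ep' (eval_meet h₁₄ elInf ha₁₄) hl'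
  have el'' := eval_join ep'' (eval_meet h₂₆ elInf ha₂₆) hl''
  obtain ⟨-, p'_l', a_l'⟩ := join_eq_some.1 hl'
  obtain ⟨-, p''_l'', a_l''⟩ := join_eq_some.1 hl''
  have a_o : a₁₄ ≠ o := by
    rintro rfl
    exact o_lInf i₁₄'
  have a_ne : a₁₄ ≠ a₂₆ := by
    rintro rfl
    exact n₄₆ (line_unique a_o i₁₄ o₁₄ i₂₆ o₂₆)
  have l_ne : l' ≠ l'' := by
    rintro rfl
    exact p'_lInf (line_unique a_ne a_l' a_l'' i₁₄' i₂₆' ▸ p'_l')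
  obtain ⟨p₃, hp₃⟩ := exists_meet l_ne
  have ep₃ := eval_meet el' el'' hp₃
  obtain ⟨-, p₃_l', p₃_l''⟩ := meet_eq_some.1 hp₃
  have o_l' : ¬ o ∈ l' := by
    intro h
    have h1 : l' = m₁₃ := line_unique p'_ne p'_l' h p'₁₃ o₁₃
    exact n₃₄ (line_unique a_o (h1 ▸ a_l') o₁₃ i₁₄ o₁₄)
  have o_p₃ : o ≠ p₃ := fun h => o_l' (h ▸ p₃_l')
  refine eval_join hp ep₃ (join_eq_some.2 ⟨o_p₃, om, k.mem_of_through ?_⟩)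
  have tInf : Through (f₃ + f₄) pInf := ActsAlong.through (Or.inr k₁₂) pInf₁₂
  obtain ⟨E, hE, hE'⟩ := exists_decomposition lHat_ne pInf_lHat pInf_l tInf
  have A' : ActsAlong (f₃ - E) l' := by
    refine actsAlong_of_through p'_a p'_l' a_l'
      ((ActsAlong.through (Or.inr k₁₃) p'₁₃).sub (hE.through p'_lHat)) ?_
    have e : f₃ - E = (f₃ + f₄ - E) - f₄ := by abel
    rw [e]
    exact (hE'.through i₁₄').sub (ActsAlong.through (Or.inr k₁₄) i₁₄)
  have A'' : ActsAlong (f₅ + E) l'' := by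
    refine actsAlong_of_through p''_a p''_l'' a_l''
      ((ActsAlong.through (Or.inr k₂₅) p''₂₅).add (hE.through p''_lHat)) ?_
    -- Equilibrium of the four forces makes the components along `lInf` opposite on the two sides.
    have e : f₅ + E = -(f₃ + f₄ - E) - f₆ := by
      rw [← sub_eq_zero, ← hf]
      abel
    rw [e]
    exact (hE'.through i₂₆').neg.sub (ActsAlong.through (Or.inr k₂₆) i₂₆)
  have e : f₃ + f₅ = (f₃ - E) + (f₅ + E) := by abel
  rw [e]
  exact (A'.through p₃_l').add (A''.through p₃_l'')

/-! ### The sets of leaves beyond the edges of a tree -/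

section LeafSplit

open Classical

variable {W ι : Type*} [Fintype ι]

/-- `T` has vertices of degree one, the leaves, and of degree three. For adjacent `v, w`, the leaves
beyond `w` as seen from `v` are those with index in `A v w`. -/
structure IsLeafSplit (T : SimpleGraph W) (leaf : ι → W) (A : W → W → Finset ι) : Prop where
  compl : ∀ v w, T.Adj v w → A w v = (A v w)ᶜ
  star : ∀ v, (∃ j w, v = leaf j ∧ (∀ u, T.Adj v u ↔ u = w) ∧ A v w = {j}ᶜ) ∨
    ((∀ j, v ≠ leaf j) ∧ ∃ x y z, x ≠ y ∧ x ≠ z ∧ y ≠ z ∧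
      (∀ u, T.Adj v u ↔ u = x ∨ u = y ∨ u = z) ∧
      (A v x).Nonempty ∧ (A v y).Nonempty ∧ (A v z).Nonempty ∧
      (∀ i ∈ A v x, i ∉ A v y) ∧ (∀ i ∈ A v x, i ∉ A v z) ∧ (∀ i ∈ A v y, i ∉ A v z) ∧
      ∀ i, i ∈ A v x ∨ i ∈ A v y ∨ i ∈ A v z)

namespace IsLeafSplit

variable {T : SimpleGraph W} {leaf : ι → W} {A : W → W → Finset ι}

theorem nonempty [Nontrivial ι] (h : IsLeafSplit T leaf A) {v w : W} (hvw : T.Adj v w) :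
    (A v w).Nonempty := by
  rcases h.star v with ⟨j, x, -, hx, hA⟩ | ⟨-, x, y, z, -, -, -, hadj, hx, hy, hz, -⟩
  · obtain rfl := (hx w).1 hvw
    obtain ⟨k, hk⟩ := exists_ne j
    exact ⟨k, by simp [hA, hk]⟩
  · rcases (hadj w).1 hvw with rfl | rfl | rfl <;> assumption

theorem ne_univ [Nontrivial ι] (h : IsLeafSplit T leaf A) {v w : W} (hvw : T.Adj v w) :
    A v w ≠ Finset.univ := by
  have := h.nonempty hvw.symm
  rw [h.compl v w hvw] at this
  rintro h'
  simp [h'] at this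

theorem not_mem (h : IsLeafSplit T leaf A) {v w x : W} (hw : T.Adj v w) (hx : T.Adj v x)
    (hwx : w ≠ x) : ∀ i ∈ A v w, i ∉ A v x := by
  rcases h.star v with ⟨j, a, -, ha, hA⟩ | ⟨-, a, b, c, -, -, -, hadj, -, -, -, h1, h2, h3, -⟩
  · exact absurd (((ha w).1 hw).trans ((ha x).1 hx).symm) hwx
  · intro i hi hi'
    rcases (hadj w).1 hw with rfl | rfl | rfl <;> rcases (hadj x).1 hx with rfl | rfl | rfl <;>
      first | exact hwx rfl | exact h1 i hi hi' | exact h2 i hi hi' | exact h3 i hi hi' |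
        exact h1 i hi' hi | exact h2 i hi' hi | exact h3 i hi' hi

theorem ne_leaf (h : IsLeafSplit T leaf A) {v w x : W} (hw : T.Adj v w) (hx : T.Adj v x)
    (hwx : w ≠ x) (j : ι) : v ≠ leaf j := by
  rcases h.star v with ⟨j, a, -, ha, hA⟩ | ⟨h', -⟩
  · exact absurd (((ha w).1 hw).trans ((ha x).1 hx).symm) hwx
  · exact h' j

theorem cover (h : IsLeafSplit T leaf A) {v w x y : W} (hw : T.Adj v w) (hx : T.Adj v x)
    (hy : T.Adj v y) (hwx : w ≠ x) (hwy : w ≠ y) (hxy : x ≠ y) (i : ι) :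
    i ∈ A v w ∨ i ∈ A v x ∨ i ∈ A v y := by
  rcases h.star v with ⟨j, a, -, ha, hA⟩ | ⟨-, a, b, c, -, -, -, hadj, -, -, -, -, -, -, hc⟩
  · exact absurd (((ha w).1 hw).trans ((ha x).1 hx).symm) hwx
  · have := hc i
    have := (hadj w).1 hw
    have := (hadj x).1 hx
    have := (hadj y).1 hy
    grind

theorem adj_iff (h : IsLeafSplit T leaf A) {v w x y : W} (hw : T.Adj v w) (hx : T.Adj v x)
    (hy : T.Adj v y) (hwx : w ≠ x) (hwy : w ≠ y) (hxy : x ≠ y) (u : W) :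
    T.Adj v u ↔ u = w ∨ u = x ∨ u = y := by
  rcases h.star v with ⟨j, a, -, ha, hA⟩ | ⟨-, a, b, c, -, -, -, hadj, -⟩
  · exact absurd (((ha w).1 hw).trans ((ha x).1 hx).symm) hwx
  · rw [hadj]
    have := (hadj w).1 hw
    have := (hadj x).1 hx
    have := (hadj y).1 hy
    grind

theorem exists_third (h : IsLeafSplit T leaf A) {v w x : W} (hw : T.Adj v w) (hx : T.Adj v x)
    (hwx : w ≠ x) : ∃ y, T.Adj v y ∧ y ≠ w ∧ y ≠ x := by
  rcases h.star v with ⟨j, a, -, ha, hA⟩ | ⟨-, a, b, c, hab, hac, hbc, hadj, -⟩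
  · exact absurd (((ha w).1 hw).trans ((ha x).1 hx).symm) hwx
  · rcases (hadj w).1 hw with rfl | rfl | rfl <;> rcases (hadj x).1 hx with rfl | rfl | rfl <;>
      first | exact absurd rfl hwx | exact ⟨a, (hadj _).2 (by simp), by tauto, by tauto⟩ |
        exact ⟨b, (hadj _).2 (by simp), by tauto, by tauto⟩ |
        exact ⟨c, (hadj _).2 (by simp), by tauto, by tauto⟩

theorem split_leaf (h : IsLeafSplit T leaf A) (hleaf : Function.Injective leaf) {v : W} {j : ι}
    (hv : T.Adj v (leaf j)) : A v (leaf j) = {j} := by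
  rcases h.star (leaf j) with ⟨k, a, hk, ha, hA⟩ | ⟨h', -⟩
  · obtain rfl := hleaf hk
    obtain rfl := (ha v).1 hv.symm
    rw [h.compl _ _ hv.symm, hA, compl_compl]
  · exact absurd rfl (h' j)

/-- A leaf beyond the third edge at `a` lies in the direction of `a` both from `b` and from `c`,
hence on neither side of the edge `bc`. Acyclicity is not part of `IsLeafSplit`; this much of it
follows from the leaf sets. -/
theorem no_triangle [Nontrivial ι] (h : IsLeafSplit T leaf A) {a b c : W} (hab : T.Adj a b)
    (hbc : T.Adj b c) : ¬ T.Adj a c := by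
  intro hac
  obtain ⟨x, hx, hxb, hxc⟩ := h.exists_third hab hac hbc.ne
  obtain ⟨i, hi⟩ := h.nonempty hx
  have h1 := h.not_mem hx hab hxb i hi
  have h2 := h.not_mem hx hac hxc i hi
  have h3 : i ∈ A b a := by simpa [h.compl a b hab] using h1
  have h4 : i ∈ A c a := by simpa [h.compl a c hac] using h2
  have h5 := h.not_mem hab.symm hbc hac.ne i h3
  have h6 := h.not_mem hac.symm hbc.symm hab.ne i h4
  rw [h.compl b c hbc] at h6
  simp [h5] at h6

end IsLeafSplit

/-! ### Effect of a surgery on the leaf sets -/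

/-- The sets of leaves beyond the edges after a surgery. -/
def surgerySplit (A : W → W → Finset ι) (v₁ v₂ v₃ v₄ v₅ v₆ : W) : W → W → Finset ι := fun a b =>
  if a = v₁ ∧ b = v₂ then A v₁ v₄ ∪ A v₂ v₆
  else if a = v₂ ∧ b = v₁ then A v₁ v₃ ∪ A v₂ v₅
  else if a = v₁ ∧ b = v₅ then A v₂ v₅
  else if a = v₅ ∧ b = v₁ then A v₅ v₂
  else if a = v₂ ∧ b = v₄ then A v₁ v₄
  else if a = v₄ ∧ b = v₂ then A v₄ v₁
  else A a b

theorem surgeryGraph_adj {T : SimpleGraph W} {v₁ v₂ v₄ v₅ a b : W} (h₁₅ : v₁ ≠ v₅)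
    (h₂₄ : v₂ ≠ v₄) :
    (surgeryGraph T v₁ v₂ v₄ v₅).Adj a b ↔
      (a = v₁ ∧ b = v₅ ∨ a = v₅ ∧ b = v₁ ∨ a = v₂ ∧ b = v₄ ∨ a = v₄ ∧ b = v₂) ∨
      T.Adj a b ∧ ¬ (a = v₁ ∧ b = v₄) ∧ ¬ (a = v₄ ∧ b = v₁) ∧ ¬ (a = v₂ ∧ b = v₅) ∧
        ¬ (a = v₅ ∧ b = v₂) := by
  simp only [surgeryGraph, SimpleGraph.sup_adj, SimpleGraph.deleteEdges_adj,
    SimpleGraph.fromEdgeSet_adj, Set.mem_insert_iff, Set.mem_singleton_iff, Sym2.eq_iff]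
  constructor
  · rintro (h | ⟨h, -⟩)
    · right; tauto
    · left; tauto
  · rintro (h | h)
    · right
      refine ⟨by tauto, ?_⟩
      rcases h with ⟨rfl, rfl⟩ | ⟨rfl, rfl⟩ | ⟨rfl, rfl⟩ | ⟨rfl, rfl⟩
      exacts [h₁₅, h₁₅.symm, h₂₄, h₂₄.symm]
    · left; tauto

namespace IsLeafSplit

variable {T : SimpleGraph W} {leaf : ι → W} {A : W → W → Finset ι} {v₁ v₂ v₃ v₄ v₅ v₆ : W}

/-- The four outer edges of the subgraph partition the leaves. Identities between leaf sets around a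
surgery thereby reduce to a check of four cases. -/
theorem quadrisect [Nontrivial ι] (h : IsLeafSplit T leaf A)
    (H : IsHSubgraph T v₁ v₂ v₃ v₄ v₅ v₆) (i : ι) :
    (i ∈ A v₁ v₃ ∧ i ∉ A v₁ v₄ ∧ i ∉ A v₂ v₅ ∧ i ∉ A v₂ v₆) ∨
      (i ∉ A v₁ v₃ ∧ i ∈ A v₁ v₄ ∧ i ∉ A v₂ v₅ ∧ i ∉ A v₂ v₆) ∨
      (i ∉ A v₁ v₃ ∧ i ∉ A v₁ v₄ ∧ i ∈ A v₂ v₅ ∧ i ∉ A v₂ v₆) ∨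
      (i ∉ A v₁ v₃ ∧ i ∉ A v₁ v₄ ∧ i ∉ A v₂ v₅ ∧ i ∈ A v₂ v₆) := by
  obtain ⟨hnd, a₁₂, a₁₃, a₁₄, a₂₅, a₂₆⟩ := H
  simp only [List.nodup_cons, List.mem_cons, List.not_mem_nil, or_false, not_or] at hnd
  obtain ⟨⟨n₁₂, n₁₃, n₁₄, n₁₅, n₁₆⟩, ⟨n₂₃, n₂₄, n₂₅, n₂₆⟩, ⟨n₃₄, n₃₅, n₃₆⟩, ⟨n₄₅, n₄₆⟩, n₅₆, -⟩ := hnd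
  have c₁ := h.cover a₁₂ a₁₃ a₁₄ n₂₃ n₂₄ n₃₄ i
  have c₂ := h.cover a₁₂.symm a₂₅ a₂₆ n₁₅ n₁₆ n₅₆ i
  have c₃ : i ∈ A v₂ v₁ ↔ i ∉ A v₁ v₂ := by simp [h.compl _ _ a₁₂]
  have d₁ := h.not_mem a₁₂ a₁₃ n₂₃ i
  have d₂ := h.not_mem a₁₂ a₁₄ n₂₄ i
  have d₃ := h.not_mem a₁₃ a₁₄ n₃₄ i
  have d₄ := h.not_mem a₁₂.symm a₂₅ n₁₅ i
  have d₅ := h.not_mem a₁₂.symm a₂₆ n₁₆ i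
  have d₆ := h.not_mem a₂₅ a₂₆ n₅₆ i
  grind

/-- The edges after a surgery and the sets of leaves beyond them. -/
theorem surgery_cases [Nontrivial ι] (h : IsLeafSplit T leaf A)
    (H : IsHSubgraph T v₁ v₂ v₃ v₄ v₅ v₆) {a b : W}
    (hab : (surgeryGraph T v₁ v₂ v₄ v₅).Adj a b) :
    (a = v₁ ∧ b = v₂ ∧ surgerySplit A v₁ v₂ v₃ v₄ v₅ v₆ a b = A v₁ v₄ ∪ A v₂ v₆) ∨
    (a = v₂ ∧ b = v₁ ∧ surgerySplit A v₁ v₂ v₃ v₄ v₅ v₆ a b = A v₁ v₃ ∪ A v₂ v₅) ∨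
    (a = v₁ ∧ b = v₅ ∧ surgerySplit A v₁ v₂ v₃ v₄ v₅ v₆ a b = A v₂ v₅) ∨
    (a = v₅ ∧ b = v₁ ∧ surgerySplit A v₁ v₂ v₃ v₄ v₅ v₆ a b = A v₅ v₂) ∨
    (a = v₂ ∧ b = v₄ ∧ surgerySplit A v₁ v₂ v₃ v₄ v₅ v₆ a b = A v₁ v₄) ∨
    (a = v₄ ∧ b = v₂ ∧ surgerySplit A v₁ v₂ v₃ v₄ v₅ v₆ a b = A v₄ v₁) ∨
    (T.Adj a b ∧ surgerySplit A v₁ v₂ v₃ v₄ v₅ v₆ a b = A a b ∧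
      surgerySplit A v₁ v₂ v₃ v₄ v₅ v₆ b a = A b a ∧ s(a, b) ≠ s(v₁, v₂) ∧
      s(a, b) ≠ s(v₁, v₅) ∧ s(a, b) ≠ s(v₂, v₄)) := by
  have na₁₅ : ¬ T.Adj v₁ v₅ := h.no_triangle H.adj₁₂ H.adj₂₅
  have na₂₄ : ¬ T.Adj v₂ v₄ := h.no_triangle H.adj₁₂.symm H.adj₁₄
  have hnd := H.nodup
  simp only [List.nodup_cons, List.mem_cons, List.not_mem_nil, or_false, not_or] at hnd
  obtain ⟨⟨n₁₂, n₁₃, n₁₄, n₁₅, n₁₆⟩, ⟨n₂₃, n₂₄, n₂₅, n₂₆⟩, ⟨n₃₄, n₃₅, n₃₆⟩, ⟨n₄₅, n₄₆⟩, n₅₆, -⟩ := hnd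
  rw [surgeryGraph_adj n₁₅ n₂₄] at hab
  by_cases e₁ : a = v₁ ∧ b = v₂
  · exact Or.inl ⟨e₁.1, e₁.2, by simp [surgerySplit, e₁]⟩
  by_cases e₂ : a = v₂ ∧ b = v₁
  · exact Or.inr (Or.inl ⟨e₂.1, e₂.2, by simp [surgerySplit, e₂, Ne.symm n₁₂]⟩)
  rcases hab with (⟨rfl, rfl⟩ | ⟨rfl, rfl⟩ | ⟨rfl, rfl⟩ | ⟨rfl, rfl⟩) | ⟨hab, m₁, m₂, m₃, m₄⟩
  · exact Or.inr (Or.inr (Or.inl ⟨rfl, rfl, by simp [surgerySplit, Ne.symm n₂₅, n₁₂]⟩))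
  · exact Or.inr (Or.inr (Or.inr (Or.inl ⟨rfl, rfl, by
      simp [surgerySplit, Ne.symm n₂₅, Ne.symm n₁₅]⟩)))
  · exact Or.inr (Or.inr (Or.inr (Or.inr (Or.inl ⟨rfl, rfl, by
      simp [surgerySplit, n₂₅, Ne.symm n₁₂, Ne.symm n₁₄]⟩))))
  · exact Or.inr (Or.inr (Or.inr (Or.inr (Or.inr (Or.inl ⟨rfl, rfl, by
      simp [surgerySplit, n₄₅, Ne.symm n₂₄, Ne.symm n₁₄]⟩)))))
  · have f₁ : ¬ (a = v₁ ∧ b = v₅) := by rintro ⟨rfl, rfl⟩; exact na₁₅ hab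
    have f₂ : ¬ (a = v₅ ∧ b = v₁) := by rintro ⟨rfl, rfl⟩; exact na₁₅ hab.symm
    have f₃ : ¬ (a = v₂ ∧ b = v₄) := by rintro ⟨rfl, rfl⟩; exact na₂₄ hab
    have f₄ : ¬ (a = v₄ ∧ b = v₂) := by rintro ⟨rfl, rfl⟩; exact na₂₄ hab.symm
    have not_eq : ∀ {x y : W}, ¬ (a = x ∧ b = y) → ¬ (a = y ∧ b = x) → s(a, b) ≠ s(x, y) :=
      fun h h' h'' => (Sym2.eq_iff.1 h'').elim h h'
    refine Or.inr (Or.inr (Or.inr (Or.inr (Or.inr (Or.inr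
      ⟨hab, ?_, ?_, not_eq e₁ e₂, not_eq f₁ f₂, not_eq f₃ f₄⟩)))))
    · rw [surgerySplit, if_neg e₁, if_neg e₂, if_neg f₁, if_neg f₂, if_neg f₃, if_neg f₄]
    · rw [surgerySplit, if_neg (mt And.symm e₂), if_neg (mt And.symm e₁), if_neg (mt And.symm f₂),
        if_neg (mt And.symm f₁), if_neg (mt And.symm f₄), if_neg (mt And.symm f₃)]

theorem surgery_compl [Nontrivial ι] (h : IsLeafSplit T leaf A)
    (H : IsHSubgraph T v₁ v₂ v₃ v₄ v₅ v₆) {a b : W}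
    (hab : (surgeryGraph T v₁ v₂ v₄ v₅).Adj a b) :
    surgerySplit A v₁ v₂ v₃ v₄ v₅ v₆ b a = (surgerySplit A v₁ v₂ v₃ v₄ v₅ v₆ a b)ᶜ := by
  have hnd := H.nodup
  simp only [List.nodup_cons, List.mem_cons, List.not_mem_nil, or_false, not_or] at hnd
  obtain ⟨⟨n₁₂, n₁₃, n₁₄, n₁₅, n₁₆⟩, ⟨n₂₃, n₂₄, n₂₅, n₂₆⟩, ⟨n₃₄, n₃₅, n₃₆⟩, ⟨n₄₅, n₄₆⟩, n₅₆, -⟩ := hnd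
  rcases h.surgery_cases H hab with ⟨rfl, rfl, e⟩ | ⟨rfl, rfl, e⟩ | ⟨rfl, rfl, e⟩ |
      ⟨rfl, rfl, e⟩ | ⟨rfl, rfl, e⟩ | ⟨rfl, rfl, e⟩ | ⟨hab', e, e', -⟩
  · ext i
    rw [e]
    rcases h.quadrisect H i with q | q | q | q <;> simp [surgerySplit, Ne.symm n₁₂, q]
  · ext i
    rw [e]
    rcases h.quadrisect H i with q | q | q | q <;> simp [surgerySplit, q]
  · rw [e, ← h.compl _ _ H.adj₂₅]
    simp [surgerySplit, Ne.symm n₂₅, Ne.symm n₁₅]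
  · rw [e, ← h.compl _ _ H.adj₂₅.symm]
    simp [surgerySplit, Ne.symm n₂₅, n₁₂]
  · rw [e, ← h.compl _ _ H.adj₁₄]
    simp [surgerySplit, n₄₅, Ne.symm n₂₄, Ne.symm n₁₄]
  · rw [e, ← h.compl _ _ H.adj₁₄.symm]
    simp [surgerySplit, n₂₅, Ne.symm n₁₂, Ne.symm n₁₄]
  · rw [e, e', h.compl _ _ hab']

/-- Away from `v₁` and `v₂` a surgery only renames neighbors: `v₄` and `v₅` exchange their neighbor
among `v₁, v₂`, and all other vertices keep theirs. The local structure is then transported along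
`π`. -/
theorem surgery_involution [Nontrivial ι] (h : IsLeafSplit T leaf A)
    (H : IsHSubgraph T v₁ v₂ v₃ v₄ v₅ v₆) {v : W} (hv₁ : v ≠ v₁) (hv₂ : v ≠ v₂) :
    ∃ π : Equiv.Perm W, (∀ u, π (π u) = u) ∧
      (∀ u, (surgeryGraph T v₁ v₂ v₄ v₅).Adj v u ↔ T.Adj v (π u)) ∧
      ∀ u, T.Adj v (π u) → surgerySplit A v₁ v₂ v₃ v₄ v₅ v₆ v u = A v (π u) := by
  have na₁₅ : ¬ T.Adj v₅ v₁ := fun h' => h.no_triangle H.adj₁₂ H.adj₂₅ h'.symm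
  have na₂₄ : ¬ T.Adj v₄ v₂ := fun h' => h.no_triangle H.adj₁₂.symm H.adj₁₄ h'.symm
  have a₁₄ := H.adj₁₄.symm
  have a₂₅ := H.adj₂₅.symm
  have hnd := H.nodup
  simp only [List.nodup_cons, List.mem_cons, List.not_mem_nil, or_false, not_or] at hnd
  obtain ⟨⟨n₁₂, n₁₃, n₁₄, n₁₅, n₁₆⟩, ⟨n₂₃, n₂₄, n₂₅, n₂₆⟩, ⟨n₃₄, n₃₅, n₃₆⟩, ⟨n₄₅, n₄₆⟩, n₅₆, -⟩ := hnd
  clear h H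
  have adj' := @surgeryGraph_adj _ T v₁ v₂ v₄ v₅
  by_cases hv₄ : v = v₄
  · subst hv₄
    refine ⟨Equiv.swap v₁ v₂, Equiv.swap_apply_self _ _, ?_, ?_⟩
    · intro u
      rw [adj' n₁₅ n₂₄, Equiv.swap_apply_def]
      split_ifs <;> grind
    · intro u
      rw [Equiv.swap_apply_def]
      split_ifs with u1 u2 <;> intro hu
      · exact absurd hu na₂₄
      · simp [surgerySplit, u2, hv₁, hv₂, Ne.symm n₁₂]
      · simp [surgerySplit, u1, u2, hv₁, hv₂]
  by_cases hv₅ : v = v₅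
  · subst hv₅
    refine ⟨Equiv.swap v₁ v₂, Equiv.swap_apply_self _ _, ?_, ?_⟩
    · intro u
      rw [adj' n₁₅ n₂₄, Equiv.swap_apply_def]
      split_ifs <;> grind
    · intro u
      rw [Equiv.swap_apply_def]
      split_ifs with u1 u2 <;> intro hu
      · simp [surgerySplit, u1, hv₁, hv₂]
      · exact absurd hu na₁₅
      · simp [surgerySplit, u1, u2, hv₁, hv₂]
  refine ⟨1, fun _ => rfl, ?_, ?_⟩
  · intro u
    rw [adj' n₁₅ n₂₄]
    simp [hv₁, hv₂, hv₄, hv₅]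
  · intro u _
    simp [surgerySplit, hv₁, hv₂, hv₄, hv₅]

theorem surgery [Nontrivial ι] (h : IsLeafSplit T leaf A)
    (H : IsHSubgraph T v₁ v₂ v₃ v₄ v₅ v₆) :
    IsLeafSplit (surgeryGraph T v₁ v₂ v₄ v₅) leaf (surgerySplit A v₁ v₂ v₃ v₄ v₅ v₆) := by
  have a₁₂ := H.adj₁₂
  have a₁₃ := H.adj₁₃
  have a₁₄ := H.adj₁₄
  have a₂₅ := H.adj₂₅
  have a₂₆ := H.adj₂₆
  have hnd := H.nodup
  simp only [List.nodup_cons, List.mem_cons, List.not_mem_nil, or_false, not_or] at hnd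
  obtain ⟨⟨n₁₂, n₁₃, n₁₄, n₁₅, n₁₆⟩, ⟨n₂₃, n₂₄, n₂₅, n₂₆⟩, ⟨n₃₄, n₃₅, n₃₆⟩, ⟨n₄₅, n₄₆⟩, n₅₆, -⟩ := hnd
  refine ⟨fun a b hab => h.surgery_compl H hab, fun v => ?_⟩
  have hq := h.quadrisect H
  by_cases hv₁ : v = v₁
  · subst hv₁
    have s₂ : surgerySplit A v v₂ v₃ v₄ v₅ v₆ v v₂ = A v v₄ ∪ A v₂ v₆ := by simp [surgerySplit]
    have s₃ : surgerySplit A v v₂ v₃ v₄ v₅ v₆ v v₃ = A v v₃ := by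
      simp [surgerySplit, n₁₂, Ne.symm n₂₃, n₃₅, n₁₅, n₁₄]
    have s₅ : surgerySplit A v v₂ v₃ v₄ v₅ v₆ v v₅ = A v₂ v₅ := by
      simp [surgerySplit, n₁₂, Ne.symm n₂₅]
    refine Or.inr ⟨h.ne_leaf a₁₂ a₁₃ n₂₃, v₂, v₃, v₅, n₂₃, n₂₅, n₃₅, ?_, ?_⟩
    · intro u
      rw [surgeryGraph_adj n₁₅ n₂₄, h.adj_iff a₁₂ a₁₃ a₁₄ n₂₃ n₂₄ n₃₄]
      clear h hq s₂ s₃ s₅ H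
      grind
    · rw [s₂, s₃, s₅]
      refine ⟨(h.nonempty a₁₄).mono Finset.subset_union_left, h.nonempty a₁₃, h.nonempty a₂₅,
        ?_⟩
      refine ⟨?_, ?_, ?_, ?_⟩ <;> intro i <;>
        rcases hq i with q | q | q | q <;> simp [q]
  by_cases hv₂ : v = v₂
  · subst hv₂
    have s₁ : surgerySplit A v₁ v v₃ v₄ v₅ v₆ v v₁ = A v₁ v₃ ∪ A v v₅ := by
      simp [surgerySplit, Ne.symm n₁₂]
    have s₄ : surgerySplit A v₁ v v₃ v₄ v₅ v₆ v v₄ = A v₁ v₄ := by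
      simp [surgerySplit, n₂₅, Ne.symm n₁₂, Ne.symm n₁₄]
    have s₆ : surgerySplit A v₁ v v₃ v₄ v₅ v₆ v v₆ = A v v₆ := by
      simp [surgerySplit, n₂₅, n₂₄, Ne.symm n₁₂, Ne.symm n₁₆, Ne.symm n₄₆]
    refine Or.inr ⟨h.ne_leaf a₂₅ a₂₆ n₅₆, v₁, v₄, v₆, n₁₄, n₁₆, n₄₆, ?_, ?_⟩
    · intro u
      rw [surgeryGraph_adj n₁₅ n₂₄, h.adj_iff a₁₂.symm a₂₅ a₂₆ n₁₅ n₁₆ n₅₆]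
      clear h hq s₁ s₄ s₆ H
      grind
    · rw [s₁, s₄, s₆]
      refine ⟨(h.nonempty a₁₃).mono Finset.subset_union_left, h.nonempty a₁₄, h.nonempty a₂₆,
        ?_⟩
      refine ⟨?_, ?_, ?_, ?_⟩ <;> intro i <;>
        rcases hq i with q | q | q | q <;> simp [q]
  obtain ⟨π, hinv, hadj, hA⟩ := h.surgery_involution H hv₁ hv₂
  have hπ_eq : ∀ u x, π u = x ↔ u = π x := fun u x =>
    ⟨fun h => by rw [← h, hinv], fun h => by rw [h, hinv]⟩
  have hs : ∀ x, T.Adj v x → surgerySplit A v₁ v₂ v₃ v₄ v₅ v₆ v (π x) = A v x := by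
    intro x hx
    have := hA (π x) (by rwa [hinv])
    rwa [hinv] at this
  rcases h.star v with ⟨j, w, hj, hw, hAw⟩ |
    ⟨hl, x, y, z, hxy, hxz, hyz, hadj', hx, hy, hz, d1, d2, d3, hc⟩
  · refine Or.inl ⟨j, π w, hj, fun u => by rw [hadj, hw, hπ_eq], ?_⟩
    rw [hs _ ((hw w).2 rfl), hAw]
  · refine Or.inr ⟨hl, π x, π y, π z, π.injective.ne hxy, π.injective.ne hxz, π.injective.ne hyz,
      fun u => by rw [hadj, hadj', hπ_eq, hπ_eq, hπ_eq], ?_⟩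
    rw [hs _ ((hadj' x).2 (by simp)), hs _ ((hadj' y).2 (by simp)), hs _ ((hadj' z).2 (by simp))]
    exact ⟨hx, hy, hz, d1, d2, d3, hc⟩

end IsLeafSplit

end LeafSplit

/-! ### Labels of the edges by lines of force -/

section Labels

open Classical

variable {W ι : Type*} [Fintype ι] {V : Type*} {d : V → ℕ}

/-- Every edge is labelled by an expression whose value is the line of force of the sum of the
leaf forces beyond the edge. -/
def IsForceLabelling (σ : GenericChoice d) {P : V → Point} (ξ : Config d P) (f : ι → Force)
    (T : SimpleGraph W) (A : W → W → Finset ι) (Λ : Sym2 W → GeomExpr d .line) : Prop :=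
  ∀ a b, T.Adj a b → ∃ ℓ : Line, (Λ s(a, b)).eval σ ξ = some ℓ ∧
    IsLineOfForce (∑ j ∈ A a b, f j) ℓ

variable {σ : GenericChoice d} {P : V → Point} {ξ : Config d P} {f : ι → Force}
  {T : SimpleGraph W} {leaf : ι → W} {A : W → W → Finset ι} {Λ : Sym2 W → GeomExpr d .line}

/-- Reversing an edge complements its leaf set, which negates the force and preserves its line, so
one orientation of each edge suffices. -/
theorem exists_label_symm (hf : ∑ j, f j = 0) {X Y : Finset ι} (hXY : Y = Xᶜ)
    {e e' : GeomExpr d .line} (he : e = e')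
    (h : ∃ ℓ : Line, e.eval σ ξ = some ℓ ∧ IsLineOfForce (∑ j ∈ X, f j) ℓ) :
    ∃ ℓ : Line, e'.eval σ ξ = some ℓ ∧ IsLineOfForce (∑ j ∈ Y, f j) ℓ := by
  obtain ⟨ℓ, h1, h2⟩ := h
  refine ⟨ℓ, he ▸ h1, ?_⟩
  rw [hXY, sum_compl_eq_neg hf]
  exact h2.neg

/-- One leaf from each of the four blocks supplies the witnesses for
`NonParallelizable.line_ne_of_mem`: two blocks compared always leave a leaf outside both. This
yields all inequalities of lines required by the construction. -/
theorem eval_surgeryLine_of_partition {l₁₂ l₁₃ l₁₄ l₂₅ l₂₆ : GeomExpr d .line}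
    {X₃ X₄ X₅ X₆ : Finset ι} (ne₃ : X₃.Nonempty) (ne₄ : X₄.Nonempty) (ne₅ : X₅.Nonempty)
    (ne₆ : X₆.Nonempty)
    (hq : ∀ i, (i ∈ X₃ ∧ i ∉ X₄ ∧ i ∉ X₅ ∧ i ∉ X₆) ∨ (i ∉ X₃ ∧ i ∈ X₄ ∧ i ∉ X₅ ∧ i ∉ X₆) ∨
      (i ∉ X₃ ∧ i ∉ X₄ ∧ i ∈ X₅ ∧ i ∉ X₆) ∨ (i ∉ X₃ ∧ i ∉ X₄ ∧ i ∉ X₅ ∧ i ∈ X₆))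
    (hnp : NonParallelizable f) (hf : ∑ j, f j = 0)
    {p : GeomExpr d .point} {o : Point} (hp : p.eval σ ξ = some o) (ho : ∀ j, Through (f j) o)
    (h₁₂ : ∃ ℓ : Line, l₁₂.eval σ ξ = some ℓ ∧ IsLineOfForce (∑ j ∈ X₃ ∪ X₄, f j) ℓ)
    (h₁₃ : ∃ ℓ : Line, l₁₃.eval σ ξ = some ℓ ∧ IsLineOfForce (∑ j ∈ X₃, f j) ℓ)
    (h₁₄ : ∃ ℓ : Line, l₁₄.eval σ ξ = some ℓ ∧ IsLineOfForce (∑ j ∈ X₄, f j) ℓ)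
    (h₂₅ : ∃ ℓ : Line, l₂₅.eval σ ξ = some ℓ ∧ IsLineOfForce (∑ j ∈ X₅, f j) ℓ)
    (h₂₆ : ∃ ℓ : Line, l₂₆.eval σ ξ = some ℓ ∧ IsLineOfForce (∑ j ∈ X₆, f j) ℓ) :
    ∃ ℓ : Line, (surgeryLine p l₁₂ l₁₃ l₁₄ l₂₅ l₂₆).eval σ ξ = some ℓ ∧
      IsLineOfForce (∑ j ∈ X₃ ∪ X₅, f j) ℓ := by
  obtain ⟨m₁₂, e₁₂, k₁₂⟩ := h₁₂
  obtain ⟨m₁₃, e₁₃, k₁₃⟩ := h₁₃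
  obtain ⟨m₁₄, e₁₄, k₁₄⟩ := h₁₄
  obtain ⟨m₂₅, e₂₅, k₂₅⟩ := h₂₅
  obtain ⟨m₂₆, e₂₆, k₂₆⟩ := h₂₆
  obtain ⟨i₃, hi₃⟩ := ne₃
  obtain ⟨i₄, hi₄⟩ := ne₄
  obtain ⟨i₅, hi₅⟩ := ne₅
  obtain ⟨i₆, hi₆⟩ := ne₆
  have q₃ := hq i₃
  have q₄ := hq i₄
  have q₅ := hq i₅
  have q₆ := hq i₆
  simp only [hi₃, hi₄, hi₅, hi₆, not_true_eq_false, true_and, false_and, and_false, or_false,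
    false_or, and_true] at q₃ q₄ q₅ q₆
  have dj : ∀ {X Y : Finset ι}, (∀ i, i ∈ X → i ∉ Y) →
      ∑ j ∈ X ∪ Y, f j = ∑ j ∈ X, f j + ∑ j ∈ Y, f j := fun hd =>
    Finset.sum_union (Finset.disjoint_left.2 hd)
  have d₃₄ := dj (X := X₃) (Y := X₄) fun i => by
    rcases hq i with q | q | q | q <;> simp [q]
  have d₃₅ := dj (X := X₃) (Y := X₅) fun i => by
    rcases hq i with q | q | q | q <;> simp [q]
  have d₅₆ := dj (X := X₅) (Y := X₆) fun i => by
    rcases hq i with q | q | q | q <;> simp [q]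
  have d := dj (X := X₃ ∪ X₄) (Y := X₅ ∪ X₆) fun i => by
    rcases hq i with q | q | q | q <;> simp [q]
  have hu : (X₃ ∪ X₄) ∪ (X₅ ∪ X₆) = Finset.univ := by
    ext i
    rcases hq i with q | q | q | q <;> simp [q]
  rw [hu, hf, d₃₄, d₅₆] at d
  have hne : ∑ j ∈ X₃ ∪ X₅, f j ≠ 0 := by
    apply hnp.sum_ne_zero ⟨i₃, Finset.mem_union_left _ hi₃⟩
    intro hu
    have : i₄ ∈ X₃ ∪ X₅ := hu ▸ Finset.mem_univ _
    simp [q₄] at this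
  obtain ⟨m, hm, -⟩ := exists_isLineOfForce hne
  refine ⟨m, ?_, hm⟩
  rw [d₃₅] at hm
  have t : ∀ X : Finset ι, Through (∑ j ∈ X, f j) o := fun X => Through.sum X fun j _ => ho j
  have n₁ : m₁₂ ≠ m₂₅ := hnp.line_ne_of_mem hf i₃ i₅ i₆ (by simp [hi₃, hi₅, q₃, q₅, q₆]) k₁₂ k₂₅
  rw [d₃₄] at k₁₂
  exact eval_surgeryLine hp e₁₂ e₁₃ e₁₄ e₂₅ e₂₆ d.symm (t _) (t _) (t _) (t _) k₁₂ k₁₃ k₁₄ k₂₅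
    k₂₆ hm (hnp.line_ne_of_mem hf i₃ i₄ i₅ (by simp [hi₃, hi₄, q₃, q₄, q₅]) k₁₃ k₁₄) n₁
    (hnp.line_ne_of_mem hf i₄ i₆ i₃ (by simp [hi₄, hi₆, q₃, q₄, q₆]) k₁₄ k₂₆)

/-- Only the middle edge gets a new line. From `v₂` the leaves beyond `v₁` are now those beyond `v₃`
and `v₅`, which is the regrouping computed by `surgeryLine`; the outer edges keep their forces up to
orientation. -/
theorem IsForceLabelling.surgery [Nontrivial ι] {v₁ v₂ v₃ v₄ v₅ v₆ : W}
    (h : IsForceLabelling σ ξ f T A Λ) (hT : IsLeafSplit T leaf A)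
    (H : IsHSubgraph T v₁ v₂ v₃ v₄ v₅ v₆) (hnp : NonParallelizable f) (hf : ∑ j, f j = 0)
    {p : GeomExpr d .point} {o : Point} (hp : p.eval σ ξ = some o) (ho : ∀ j, Through (f j) o) :
    IsForceLabelling σ ξ f (surgeryGraph T v₁ v₂ v₄ v₅) (surgerySplit A v₁ v₂ v₃ v₄ v₅ v₆)
      (surgeryLabel p Λ v₁ v₂ v₃ v₄ v₅ v₆) := by
  have hq := hT.quadrisect H
  have hnd := H.nodup
  simp only [List.nodup_cons, List.mem_cons, List.not_mem_nil, or_false, not_or] at hnd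
  obtain ⟨⟨n₁₂, n₁₃, n₁₄, n₁₅, n₁₆⟩, ⟨n₂₃, n₂₄, n₂₅, n₂₆⟩, ⟨n₃₄, n₃₅, n₃₆⟩, ⟨n₄₅, n₄₆⟩, n₅₆, -⟩ := hnd
  have b₁₂ : ∃ ℓ : Line, (surgeryLabel p Λ v₁ v₂ v₃ v₄ v₅ v₆ s(v₁, v₂)).eval σ ξ = some ℓ ∧
      IsLineOfForce (∑ j ∈ A v₁ v₃ ∪ A v₂ v₅, f j) ℓ := by
    have s₁₂ : A v₂ v₁ = A v₁ v₃ ∪ A v₁ v₄ := by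
      ext i
      have c := hT.cover H.adj₁₂.symm H.adj₂₅ H.adj₂₆ n₁₅ n₁₆ n₅₆ i
      have c₁ := hT.not_mem H.adj₁₂.symm H.adj₂₅ n₁₅ i
      have c₂ := hT.not_mem H.adj₁₂.symm H.adj₂₆ n₁₆ i
      rw [Finset.mem_union]
      have := hq i
      tauto
    have h₁₂ := h _ _ H.adj₁₂.symm
    rw [Sym2.eq_swap, s₁₂] at h₁₂
    simp only [surgeryLabel, if_true]
    exact eval_surgeryLine_of_partition (hT.nonempty H.adj₁₃) (hT.nonempty H.adj₁₄)
      (hT.nonempty H.adj₂₅) (hT.nonempty H.adj₂₆) hq hnp hf hp ho h₁₂ (h _ _ H.adj₁₃)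
      (h _ _ H.adj₁₄) (h _ _ H.adj₂₅) (h _ _ H.adj₂₆)
  have b₁₅ : surgeryLabel p Λ v₁ v₂ v₃ v₄ v₅ v₆ s(v₁, v₅) = Λ s(v₂, v₅) := by
    have : s(v₁, v₅) ≠ s(v₁, v₂) := by simp [Ne.symm n₂₅, n₁₂]
    simp [surgeryLabel, this]
  have b₂₄ : surgeryLabel p Λ v₁ v₂ v₃ v₄ v₅ v₆ s(v₂, v₄) = Λ s(v₁, v₄) := by
    have h1 : s(v₂, v₄) ≠ s(v₁, v₂) := by simp [Ne.symm n₁₂, Ne.symm n₁₄]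
    have h2 : s(v₂, v₄) ≠ s(v₁, v₅) := by simp [Ne.symm n₁₂, n₂₅]
    simp only [surgeryLabel, if_neg h1, if_neg h2, if_true]
  intro a b hab
  rcases hT.surgery_cases H hab with ⟨rfl, rfl, e⟩ | ⟨rfl, rfl, e⟩ | ⟨rfl, rfl, e⟩ |
      ⟨rfl, rfl, e⟩ | ⟨rfl, rfl, e⟩ | ⟨rfl, rfl, e⟩ | ⟨hab', e, -, e₁, e₂, e₃⟩ <;> rw [e]
  · refine exists_label_symm hf ?_ rfl b₁₂
    ext i
    rcases hq i with q | q | q | q <;> simp [q]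
  · rwa [Sym2.eq_swap]
  · rw [b₁₅]
    exact h _ _ H.adj₂₅
  · rw [Sym2.eq_swap, b₁₅, Sym2.eq_swap]
    exact h _ _ H.adj₂₅.symm
  · rw [b₂₄]
    exact h _ _ H.adj₁₄
  · rw [Sym2.eq_swap, b₂₄, Sym2.eq_swap]
    exact h _ _ H.adj₁₄.symm
  · simp only [surgeryLabel, if_neg e₁, if_neg e₂, if_neg e₃]
    exact h _ _ hab'

theorem SurgeryReachable.exists_isForceLabelling [Nontrivial ι] {T' : SimpleGraph W}
    {Λ' : Sym2 W → GeomExpr d .line} {p : GeomExpr d .point} {o : Point}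
    (hr : SurgeryReachable p T Λ T' Λ') (h : IsForceLabelling σ ξ f T A Λ)
    (hT : IsLeafSplit T leaf A) (hnp : NonParallelizable f) (hf : ∑ j, f j = 0)
    (hp : p.eval σ ξ = some o) (ho : ∀ j, Through (f j) o) :
    ∃ A', IsLeafSplit T' leaf A' ∧ IsForceLabelling σ ξ f T' A' Λ' := by
  induction hr with
  | refl => exact ⟨A, hT, h⟩
  | surgery _ H ih =>
    obtain ⟨A', h1, h2⟩ := ih
    exact ⟨_, h1.surgery H, h2.surgery h1 H hnp hf hp ho⟩

/-- The value of an associated framing is the line of force of the sum of two leaf forces. -/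
theorem eval_framing [Nontrivial ι] {T' : SimpleGraph W}
    {Λ' : Sym2 W → GeomExpr d .line} {p : GeomExpr d .point} {o : Point}
    (hr : SurgeryReachable p T Λ T' Λ') (h : IsForceLabelling σ ξ f T A Λ)
    (hT : IsLeafSplit T leaf A) (hleaf : Function.Injective leaf) (hnp : NonParallelizable f)
    (hf : ∑ j, f j = 0) (hp : p.eval σ ξ = some o) (ho : ∀ j, Through (f j) o) {v u : W} {j k : ι}
    (hjk : j ≠ k) (hj : T'.Adj v (leaf j)) (hk : T'.Adj v (leaf k)) (hu : T'.Adj v u)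
    (huj : u ≠ leaf j) (huk : u ≠ leaf k) :
    ∃ ℓ : Line, (Λ' s(v, u)).eval σ ξ = some ℓ ∧ IsLineOfForce (f j + f k) ℓ := by
  obtain ⟨A', h1, h2⟩ := hr.exists_isForceLabelling h hT hnp hf hp ho
  -- Beyond the third edge lie all leaves except `j` and `k`, so its force is opposite to `f j + f
  -- k`.
  have hs : A' v u = {j, k}ᶜ := by
    ext i
    have c := h1.cover hu hj hk huj huk (hleaf.ne hjk) i
    have d₁ := h1.not_mem hu hj huj i
    have d₂ := h1.not_mem hu hk huk i
    rw [h1.split_leaf hleaf hj] at c d₁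
    rw [h1.split_leaf hleaf hk] at c d₂
    simp only [Finset.mem_singleton, Finset.mem_compl, Finset.mem_insert] at *
    tauto
  have := exists_label_symm hf (Y := {j, k}) (by rw [hs, compl_compl]) rfl (h2 v u hu)
  rwa [Finset.sum_pair hjk] at this

end Labels

/-! ### Trees with vertices of degree one and three -/

section Trees

open Classical

variable {W ι : Type*} [Fintype ι]

theorem exists_adj_dist_lt {T : SimpleGraph W} (hT : T.Connected) {k v : W} (h : k ≠ v) :
    ∃ x, T.Adj v x ∧ T.dist k x < T.dist k v := by
  obtain ⟨p, hp, hlen⟩ := hT.exists_path_of_dist k v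
  have hnil : ¬ p.Nil := fun hn => h hn.eq
  refine ⟨p.penultimate, (p.adj_penultimate hnil).symm, ?_⟩
  have h1 := SimpleGraph.dist_le p.dropLast
  have h2 : p.length ≠ 0 := fun h0 => hnil (SimpleGraph.Walk.length_eq_zero_iff.1 h0)
  have h3 := p.length_dropLast_add_one hnil
  omega

/-- In a tree the only neighbor of `v` closer to `k` is the penultimate vertex of the path from `k`
to `v`. -/
theorem eq_of_adj_of_dist_lt {T : SimpleGraph W} (hT : T.IsTree) {k v x y : W} (hx : T.Adj v x)
    (hy : T.Adj v y) (hkx : T.dist k x < T.dist k v) (hky : T.dist k y < T.dist k v) : x = y := by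
  obtain ⟨p, hp, hlen⟩ := hT.connected.exists_path_of_dist k v
  have key : ∀ z, T.Adj v z → T.dist k z < T.dist k v → z = p.penultimate := by
    intro z hz hkz
    obtain ⟨q, hq, hq'⟩ := hT.connected.exists_path_of_dist k z
    have hv : v ∉ q.support := by
      intro hv
      have h1 := SimpleGraph.dist_le (q.takeUntil v hv)
      have h2 := q.length_takeUntil_le_length hv
      omega
    exact hT.isAcyclic.eq_penultimate_of_adj_end hp hz
      (hT.isAcyclic.mem_support_of_ne_mem_support_of_adj_of_isPath hp hq hz hv)
  rw [key x hx hkx, key y hy hky]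

theorem IsLeafSplit.mem_symm {T : SimpleGraph W} {leaf : ι → W} {A : W → W → Finset ι}
    (h : IsLeafSplit T leaf A) {v w : W} (hvw : T.Adj v w) (i : ι) : i ∈ A w v ↔ i ∉ A v w := by
  rw [h.compl v w hvw, Finset.mem_compl]

theorem IsLeafSplit.sum_add_sum_symm {M : Type*} [AddCommMonoid M] {T : SimpleGraph W}
    {leaf : ι → W} {A : W → W → Finset ι} (h : IsLeafSplit T leaf A) {v w : W} (hvw : T.Adj v w)
    (f : ι → M) : ∑ j ∈ A v w, f j + ∑ j ∈ A w v, f j = ∑ j, f j := by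
  rw [h.compl v w hvw, Finset.sum_add_sum_compl]

/-- The leaves beyond the edge `v w`, seen from `v`. -/
def treeSplit (T : SimpleGraph W) (leaf : ι → W) (v w : W) : Finset ι :=
  Finset.univ.filter fun j => T.dist (leaf j) w < T.dist (leaf j) v

/-- Take a vertex beyond the edge at maximal distance from `v`. If it had degree three, all its
neighbors would be closer to `v`, but in a tree only one can be. -/
theorem exists_leaf_beyond [Fintype W] {T : SimpleGraph W} (hT : T.IsTree)
    (hdeg : ∀ v, (T.neighborSet v).ncard = 1 ∨ (T.neighborSet v).ncard = 3) {v w : W}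
    (hvw : T.Adj v w) : ∃ u, (T.neighborSet u).ncard = 1 ∧ T.dist u w < T.dist u v := by
  obtain ⟨u, hu, hmax⟩ := Finset.exists_max_image
    (Finset.univ.filter fun u => T.dist u w < T.dist u v) (fun u => T.dist v u)
    ⟨w, by
      simp only [Finset.mem_filter, Finset.mem_univ, true_and, SimpleGraph.dist_self]
      exact hT.connected.pos_dist_of_ne hvw.ne'⟩
  simp only [Finset.mem_filter, Finset.mem_univ, true_and] at hu hmax
  refine ⟨u, (hdeg u).resolve_right fun h3 => ?_, hu⟩
  obtain ⟨x, y, z, hxy, hxz, hyz, hN⟩ := Set.ncard_eq_three.1 h3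
  have hx : T.Adj u x := by rw [← SimpleGraph.mem_neighborSet, hN]; simp
  have hy : T.Adj u y := by rw [← SimpleGraph.mem_neighborSet, hN]; simp
  have key : ∀ a, T.Adj u a → T.dist v a < T.dist v u := by
    intro a ha
    by_contra hlt
    have h1 := (hT.dist_eq_dist_add_one_of_adj v ha)
    have h2 : T.dist a w ≤ T.dist u w + 1 := by
      have := hT.connected.dist_triangle (u := a) (v := u) (w := w)
      rw [SimpleGraph.dist_eq_one_iff_adj.2 ha.symm] at this
      omega
    have h3 := hmax a (by
      rw [SimpleGraph.dist_comm (u := a) (v := v)]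
      rw [SimpleGraph.dist_comm (u := u) (v := v)] at hu
      omega)
    omega
  exact hxy (eq_of_adj_of_dist_lt hT hx hy (key x hx) (key y hy))

/-- Exactly one end of an edge is closer to a given leaf, which gives complements. At a vertex of
degree three, uniqueness of the closer neighbor gives disjointness, its existence gives the
covering. -/
theorem isLeafSplit_treeSplit [Fintype W] {T : SimpleGraph W} (hT : T.IsTree)
    (hdeg : ∀ v, (T.neighborSet v).ncard = 1 ∨ (T.neighborSet v).ncard = 3)
    (leaf : ι ≃ {v : W // (T.neighborSet v).ncard = 1}) :
    IsLeafSplit T (fun j => (leaf j : W)) (treeSplit T fun j => (leaf j : W)) := by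
  have hmem : ∀ j v w, j ∈ treeSplit T (fun j => (leaf j : W)) v w ↔
      T.dist (leaf j : W) w < T.dist (leaf j : W) v := by simp [treeSplit]
  refine ⟨?_, ?_⟩
  · intro v w hvw
    ext j
    rw [Finset.mem_compl, hmem, hmem]
    have := hT.dist_ne_of_adj (leaf j : W) hvw
    omega
  · intro v
    rcases hdeg v with h1 | h3
    · obtain ⟨w, hw⟩ := Set.ncard_eq_one.1 h1
      have hw' : ∀ u, T.Adj v u ↔ u = w := fun u => by
        rw [← SimpleGraph.mem_neighborSet, hw, Set.mem_singleton_iff]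
      obtain ⟨j, hj⟩ := leaf.surjective ⟨v, h1⟩
      have hj' : (leaf j : W) = v := by rw [hj]
      refine Or.inl ⟨j, w, hj'.symm, hw', ?_⟩
      ext k
      rw [hmem, Finset.mem_compl, Finset.mem_singleton]
      constructor
      · rintro h rfl
        rw [hj', SimpleGraph.dist_self] at h
        omega
      · intro hk
        have hne : (leaf k : W) ≠ v := by
          rw [← hj']
          exact fun h => hk (leaf.injective (Subtype.ext h))
        obtain ⟨x, hx, hlt⟩ := exists_adj_dist_lt hT.connected hne
        rwa [(hw' x).1 hx] at hlt
    · obtain ⟨x, y, z, hxy, hxz, hyz, hN⟩ := Set.ncard_eq_three.1 h3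
      have hadj : ∀ u, T.Adj v u ↔ u = x ∨ u = y ∨ u = z := fun u => by
        rw [← SimpleGraph.mem_neighborSet, hN]
        simp
      have hx := (hadj x).2 (by simp)
      have hy := (hadj y).2 (by simp)
      have hz := (hadj z).2 (by simp)
      have hne : ∀ j, (leaf j : W) ≠ v := by
        intro j hj
        have := (leaf j).2
        rw [hj] at this
        omega
      have hnon : ∀ u, T.Adj v u → (treeSplit T (fun j => (leaf j : W)) v u).Nonempty := by
        intro u hu
        obtain ⟨a, ha, hlt⟩ := exists_leaf_beyond hT hdeg hu
        refine ⟨leaf.symm ⟨a, ha⟩, ?_⟩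
        rw [hmem]
        simpa using hlt
      refine Or.inr ⟨fun j hj => hne j hj.symm, x, y, z, hxy, hxz, hyz, hadj, hnon x hx, hnon y hy,
        hnon z hz, ?_, ?_, ?_, ?_⟩
      · intro i
        rw [hmem, hmem]
        exact fun h h' => hxy (eq_of_adj_of_dist_lt hT hx hy h h')
      · intro i
        rw [hmem, hmem]
        exact fun h h' => hxz (eq_of_adj_of_dist_lt hT hx hz h h')
      · intro i
        rw [hmem, hmem]
        exact fun h h' => hyz (eq_of_adj_of_dist_lt hT hy hz h h')
      · intro i
        obtain ⟨u, hu, hlt⟩ := exists_adj_dist_lt hT.connected (hne i)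
        rw [hmem, hmem, hmem]
        rcases (hadj u).1 hu with rfl | rfl | rfl <;> simp [hlt]

/-- Surgeries shorten the path between two leaves until they have a common neighbor. -/
theorem exists_surgeryReachable_of_path [Nontrivial ι] {V : Type*} {d : V → ℕ}
    {p : GeomExpr d .point} {T : SimpleGraph W} {Λ : Sym2 W → GeomExpr d .line} {leaf : ι → W}
    (m : ℕ) : ∀ {T' : SimpleGraph W} {Λ' : Sym2 W → GeomExpr d .line} {A : W → W → Finset ι}
      (x : ℕ → W), SurgeryReachable p T Λ T' Λ' → IsLeafSplit T' leaf A →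
      (∀ i < m + 2, T'.Adj (x i) (x (i + 1))) → Set.InjOn x (Set.Iic (m + 2)) →
      ∃ (T'' : SimpleGraph W) (Λ'' : Sym2 W → GeomExpr d .line) (v u : W),
        SurgeryReachable p T Λ T'' Λ'' ∧ T''.Adj v (x 0) ∧ T''.Adj v (x (m + 2)) ∧ T''.Adj v u ∧
        u ≠ x 0 ∧ u ≠ x (m + 2) := by
  induction m with
  | zero =>
    intro T' Λ' A x hr hA hadj hinj
    have h1 := (hadj 0 (by omega)).symm
    have h2 := hadj 1 (by omega)
    obtain ⟨u, hu, hu1, hu2⟩ := hA.exists_third h1 h2 (hinj.ne (by simp) (by simp) (by simp))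
    exact ⟨T', Λ', x 1, u, hr, h1, h2, hu, hu1, hu2⟩
  | succ m ih =>
    intro T' Λ' A x hr hA hadj hinj
    have hne : ∀ i j, i ≤ m + 3 → j ≤ m + 3 → i ≠ j → x i ≠ x j := fun i j hi hj hij =>
      hinj.ne hi hj hij
    have a₁₃ := (hadj 0 (by omega)).symm
    have a₁₂ := hadj 1 (by omega)
    have a₂₅ := hadj 2 (by omega)
    obtain ⟨v₄, a₁₄, n₄₃, n₄₂⟩ := hA.exists_third a₁₃ a₁₂ (hne _ _ (by omega) (by omega) (by omega))
    obtain ⟨v₆, a₂₆, n₆₁, n₆₅⟩ :=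
      hA.exists_third a₁₂.symm a₂₅ (hne _ _ (by omega) (by omega) (by omega))
    -- The surgery at the second edge of the path makes `x 1` adjacent to `x 3`.
    have H : IsHSubgraph T' (x 1) (x 2) (x 0) v₄ (x 3) v₆ := by
      refine ⟨?_, a₁₂, a₁₃, a₁₄, a₂₅, a₂₆⟩
      have n₄₅ : v₄ ≠ x 3 := fun h => hA.no_triangle a₁₂ a₂₅ (h ▸ a₁₄)
      have n₄₆ : v₄ ≠ v₆ := fun h => hA.no_triangle a₁₂ a₂₆ (h ▸ a₁₄)
      have n₃₆ : x 0 ≠ v₆ := fun h => hA.no_triangle a₁₂ a₂₆ (h ▸ a₁₃)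
      simp only [List.nodup_cons, List.mem_cons, List.not_mem_nil, or_false, not_or,
        List.nodup_nil, not_false_eq_true, and_true]
      exact ⟨⟨a₁₂.ne, a₁₃.ne, a₁₄.ne, hne _ _ (by omega) (by omega) (by omega), n₆₁.symm⟩,
        ⟨hne _ _ (by omega) (by omega) (by omega), n₄₂.symm, a₂₅.ne, a₂₆.ne⟩,
        ⟨n₄₃.symm, hne _ _ (by omega) (by omega) (by omega), n₃₆⟩, ⟨n₄₅, n₄₆⟩, n₆₅.symm⟩
    have n₁₅ : x 1 ≠ x 3 := hne _ _ (by omega) (by omega) (by omega)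
    -- The shortened path omits `x 2`; both ends are retained.
    let y : ℕ → W := fun i => if i ≤ 1 then x i else x (i + 1)
    have hy : ∀ i, 2 ≤ i → y i = x (i + 1) := fun i hi => if_neg (by omega)
    have hadj' : ∀ i < m + 2, (surgeryGraph T' (x 1) (x 2) v₄ (x 3)).Adj (y i) (y (i + 1)) := by
      intro i hi
      rw [surgeryGraph_adj n₁₅ n₄₂.symm]
      rcases i with _ | _ | i
      · right
        refine ⟨a₁₃.symm, fun h => a₁₃.ne h.1.symm, fun h => n₄₃ h.1.symm,
          fun h => hne 0 2 (by omega) (by omega) (by omega) h.1,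
          fun h => hne 0 3 (by omega) (by omega) (by omega) h.1⟩
      · left
        left
        exact ⟨rfl, rfl⟩
      · right
        rw [hy _ (by omega), hy _ (by omega)]
        exact ⟨hadj _ (by omega), fun h => hne _ 1 (by omega) (by omega) (by omega) h.1,
          fun h => hne _ 1 (by omega) (by omega) (by omega) h.2,
          fun h => hne _ 2 (by omega) (by omega) (by omega) h.1,
          fun h => hne _ 2 (by omega) (by omega) (by omega) h.2⟩
    have hinj' : Set.InjOn y (Set.Iic (m + 2)) := by
      intro i hi j hj hij
      simp only [Set.mem_Iic] at hi hj
      simp only [y] at hij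
      by_contra hne'
      split_ifs at hij <;> exact hne _ _ (by omega) (by omega) (by omega) hij
    obtain ⟨T'', Λ'', v, u, h1, h2, h3, h4, h5, h6⟩ :=
      ih y (hr.surgery H) (hA.surgery H) hadj' hinj'
    rw [hy _ (by omega)] at h3 h6
    exact ⟨T'', Λ'', v, u, h1, h2, h3, h4, h5, h6⟩

end Trees

/-! ### Resolution trees -/

section ResolutionTrees

variable {V : Type*} [Fintype V] {G : SimpleGraph V} [DecidableRel G.Adj] {i : V}

/-- The sets of leaves beyond the edges of a resolution tree. -/
def ResolutionTree.split (T : ResolutionTree G i) : T.W → T.W → Finset (G.neighborSet i) :=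
  treeSplit T.graph fun j => (T.leaf j : T.W)

theorem ResolutionTree.isLeafSplit (T : ResolutionTree G i) :
    IsLeafSplit T.graph (fun j => (T.leaf j : T.W)) T.split :=
  isLeafSplit_treeSplit T.isTree T.degree_eq T.leaf

theorem ResolutionTree.leaf_injective (T : ResolutionTree G i) :
    Function.Injective fun j => (T.leaf j : T.W) :=
  Subtype.val_injective.comp T.leaf.injective

theorem exists_ne_ne_of_three_le {α : Type*} [Fintype α] (h : 3 ≤ Fintype.card α) (a b : α) :
    ∃ c, c ≠ a ∧ c ≠ b := by
  classical
  by_contra! hc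
  have : (Finset.univ : Finset α) ⊆ {a, b} := fun c _ => by
    by_cases h : c = a
    · simp [h]
    · simp [hc c h]
  have := (Finset.card_le_card this).trans Finset.card_le_two
  rw [Finset.card_univ] at this
  omega

theorem nontrivial_of_three_le {α : Type*} [Fintype α] (h : 3 ≤ Fintype.card α) : Nontrivial α :=
  Fintype.one_lt_card_iff_nontrivial.1 (by omega)

/-- Only one leaf lies beyond each end of an edge joining two leaves, leaving no place for a third.
-/
theorem ResolutionTree.not_adj_leaf (T : ResolutionTree G i) (hdeg : 3 ≤ G.degree i)
    (j k : G.neighborSet i) : ¬ T.graph.Adj (T.leaf j : T.W) (T.leaf k) := by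
  intro h
  rw [← SimpleGraph.card_neighborSet_eq_degree] at hdeg
  obtain ⟨l, hlj, hlk⟩ := exists_ne_ne_of_three_le hdeg j k
  have h1 := T.isLeafSplit.split_leaf T.leaf_injective h
  have h2 := T.isLeafSplit.split_leaf T.leaf_injective h.symm
  have h4 := T.isLeafSplit.mem_symm h l
  rw [h1, h2, Finset.mem_singleton, Finset.mem_singleton] at h4
  exact hlj (h4.2 hlk)

theorem ResolutionTree.exists_isFraming (T : ResolutionTree G i) (hdeg : 3 ≤ G.degree i)
    {j k : G.neighborSet i} (hjk : j ≠ k) : ∃ τ, T.IsFraming j k τ := by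
  have hdeg' := hdeg
  rw [← SimpleGraph.card_neighborSet_eq_degree] at hdeg'
  have := nontrivial_of_three_le hdeg'
  obtain ⟨q, hq, -⟩ := T.isTree.connected.exists_path_of_dist (T.leaf j : T.W) (T.leaf k)
  have hlen : 2 ≤ q.length := by
    by_contra hlt
    have h01 : q.length = 0 ∨ q.length = 1 := by omega
    rcases h01 with h0 | h1
    · exact hjk (T.leaf_injective (SimpleGraph.Walk.eq_of_length_eq_zero h0))
    · exact T.not_adj_leaf hdeg j k (SimpleGraph.Walk.adj_of_length_eq_one h1)
  obtain ⟨m, hm⟩ := Nat.exists_eq_add_of_le' hlen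
  obtain ⟨T', Λ', v, u, hr, h1, h2, h3, h4, h5⟩ :=
    exists_surgeryReachable_of_path (p := .fixedPoint i) (Λ := T.edgeExpr) m q.getVert .refl
      T.isLeafSplit (fun l hl => q.adj_getVert_succ (by omega))
      (by
        have := hq.getVert_injOn
        rw [hm] at this
        exact this)
  rw [← hm, q.getVert_length] at h2 h5
  rw [q.getVert_zero] at h1 h4
  exact ⟨_, T', Λ', v, u, hr, h1, h2, h3, h4, h5, rfl⟩

theorem nonempty_systemChoice (hdeg : ∀ i, 3 ≤ G.degree i) (T : ∀ i, ResolutionTree G i) :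
    Nonempty (SystemChoice T) := by
  classical
  have hw : ∀ c : ShortCycle G, ∃ (u : V) (w : G.Walk u u), w.IsCycle ∧ w.toSubgraph = c.1 := by
    rintro ⟨H, u, w, h1, h2, -⟩
    exact ⟨u, w, h1, h2⟩
  choose base walk hcyc hsub using hw
  -- Triples that are not two different edges at `i` get an arbitrary expression.
  refine ⟨fun i j k => if h : ∃ (hj : j ∈ G.neighborSet i) (hk : k ∈ G.neighborSet i),
      (⟨j, hj⟩ : G.neighborSet i) ≠ ⟨k, hk⟩ then
      ((T i).exists_isFraming (hdeg i) h.choose_spec.choose_spec).choose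
    else .join (.fixedPoint i) (.fixedPoint i), ?_, base, walk, hcyc, hsub⟩
  intro i j k hjk
  have h : ∃ (hj : j.1 ∈ G.neighborSet i) (hk : k.1 ∈ G.neighborSet i),
      (⟨j, hj⟩ : G.neighborSet i) ≠ ⟨k, hk⟩ := ⟨j.2, k.2, hjk⟩
  rw [dif_pos h]
  exact ((T i).exists_isFraming (hdeg i) h.choose_spec.choose_spec).choose_spec

end ResolutionTrees

/-! ### Gain graphs -/

section Gain

variable {V Γ : Type*} [Group Γ] {G : SimpleGraph V}

/-- The product of the gains along a walk. -/
def walkGain (g : V → V → Γ) : {u v : V} → G.Walk u v → Γ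
  | _, _, .nil => 1
  | u, _, .cons (v := v) _ p => g u v * walkGain g p

theorem walkGain_append (g : V → V → Γ) {u v w : V} (p : G.Walk u v) (q : G.Walk v w) :
    walkGain g (p.append q) = walkGain g p * walkGain g q := by
  induction p with
  | nil => simp [walkGain]
  | cons h p ih => simp [walkGain, ih, mul_assoc]

theorem potential_mul_walkGain {g : V → V → Γ} {lam : V → Γ} {u v : V} (p : G.Walk u v)
    (h : ∀ a b, s(a, b) ∈ p.edges → lam b = lam a * g a b) :
    lam v = lam u * walkGain g p := by
  induction p with
  | nil => simp [walkGain]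
  | @cons u x v hux p ih =>
    rw [walkGain, ← mul_assoc, ← h u x (by simp),
      ih fun a b hab => h a b (by rw [SimpleGraph.Walk.edges_cons]; exact List.mem_cons_of_mem _ hab)]

/-- A path from `v` to `u` that uses the edge `uv` consists of this edge alone, so closing it up
traverses the edge back and forth. -/
theorem walkGain_eq_inv_of_mem_edges {g : V → V → Γ} {u v : V} {p : G.Walk v u} (hp : p.IsPath)
    (hg : ∀ a b, G.Adj a b → g b a = (g a b)⁻¹) (huv : G.Adj u v) (h : s(u, v) ∈ p.edges) :
    g u v * walkGain g p = 1 := by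
  cases p with
  | nil => simp at h
  | @cons _ x _ hvx q =>
    rw [SimpleGraph.Walk.cons_isPath_iff] at hp
    rw [SimpleGraph.Walk.edges_cons, List.mem_cons] at h
    rcases h with h | h
    · have hx : x = u := by
        rcases Sym2.eq_iff.1 h with ⟨h1, -⟩ | ⟨h1, -⟩
        · exact absurd h1 huv.ne
        · exact h1.symm
      subst hx
      rw [(SimpleGraph.Walk.isPath_iff_nil.1 hp.1).eq_nil]
      simp [walkGain, hg v x hvx]
    · exact absurd (q.snd_mem_support_of_mem_edges h) hp.2

/-- If all cycles have trivial gain, then there is a potential. -/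
theorem exists_potential_of_cycles (hconn : G.Connected) {g : V → V → Γ}
    (hg : ∀ a b, G.Adj a b → g b a = (g a b)⁻¹)
    (hc : ∀ (u : V) (w : G.Walk u u), w.IsCycle → walkGain g w = 1) :
    ∃ lam : V → Γ, ∀ a b, G.Adj a b → lam b = lam a * g a b := by
  classical
  -- Each closed piece cut off by `bypass` is an edge followed by a path: either a cycle or an edge
  -- run back and forth, and its gain is trivial in both cases.
  have hby : ∀ {u v : V} (p : G.Walk u v), walkGain g p = walkGain g p.bypass := by
    intro u v p
    induction p with
    | nil => rfl
    | @cons u x v h p ih =>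
      rw [SimpleGraph.Walk.bypass, walkGain, ih]
      split_ifs with hs
      · have h1 : g u x * walkGain g (p.bypass.takeUntil u hs) = 1 := by
          have hpath := p.bypass_isPath.takeUntil hs
          by_cases he : s(u, x) ∈ (p.bypass.takeUntil u hs).edges
          · exact walkGain_eq_inv_of_mem_edges hpath hg h he
          · exact hc u _ (SimpleGraph.Path.cons_isCycle ⟨_, hpath⟩ h he)
        conv_lhs => rw [← p.bypass.take_spec hs, walkGain_append, ← mul_assoc, h1, one_mul]
      · rfl
  have hclosed : ∀ {u : V} (p : G.Walk u u), walkGain g p = 1 := by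
    intro u p
    rw [hby, (SimpleGraph.Walk.isPath_iff_nil.1 p.bypass_isPath).eq_nil]
    rfl
  obtain ⟨r⟩ := hconn.nonempty
  let W : ∀ v, G.Walk r v := fun v => (hconn r v).some
  have hrev : ∀ {u v : V} (p : G.Walk u v), walkGain g p * walkGain g p.reverse = 1 := by
    intro u v p
    rw [← walkGain_append, hclosed]
  -- The potential is the gain of a walk from a fixed root; its choice is immaterial since closed
  -- walks have trivial gain.
  refine ⟨fun v => walkGain g (W v), fun a b hab => ?_⟩
  have h1 := hclosed (((W a).append (.cons hab .nil)).append (W b).reverse)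
  rw [walkGain_append, walkGain_append] at h1
  have h2 := hrev (W b)
  simp only [walkGain, mul_one] at h1
  rw [← h2] at h1
  exact (mul_right_cancel h1).symm

/-! ### Reduction to cycles that miss a vertex -/

variable [Fintype V]

/-- A cycle through all vertices has a chord at `u`, since `u` has at least three neighbors and only
two along the cycle. The two arcs closed up by the chord are shorter cycles, and the gains of the
chord in its two directions cancel. -/
theorem walkGain_eq_one_of_short [DecidableRel G.Adj] (hdeg : ∀ v, 3 ≤ G.degree v) {g : V → V → Γ}
    (hg : ∀ a b, G.Adj a b → g b a = (g a b)⁻¹)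
    (hc : ∀ (u : V) (w : G.Walk u u), w.IsCycle → w.length < Fintype.card V → walkGain g w = 1)
    {u : V} (w : G.Walk u u) (hw : w.IsCycle) : walkGain g w = 1 := by
  classical
  by_cases hlen : w.length < Fintype.card V
  · exact hc u w hw hlen
  have htail : w.support.tail.length = w.length := by simp
  have hle : w.length ≤ Fintype.card V := htail ▸ hw.support_nodup.length_le_card
  have hmem : ∀ x, x ∈ w.support := by
    intro x
    have hcard : w.support.tail.toFinset.card = Fintype.card V := by
      rw [List.toFinset_card_of_nodup hw.support_nodup]
      omega
    have := Finset.eq_univ_of_card _ hcard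
    have hx : x ∈ w.support.tail.toFinset := this ▸ Finset.mem_univ x
    exact List.mem_of_mem_tail (List.mem_toFinset.1 hx)
  obtain ⟨x, hux, hxe⟩ : ∃ x, G.Adj u x ∧ s(u, x) ∉ w.edges := by
    by_contra! hall
    have h2 := hw.ncard_neighborSet_toSubgraph_eq_two (u := u) w.start_mem_support
    have hsub : (↑(G.neighborFinset u) : Set V) ⊆ w.toSubgraph.neighborSet u := by
      intro y hy
      rw [Finset.mem_coe, SimpleGraph.mem_neighborFinset] at hy
      rw [SimpleGraph.Subgraph.mem_neighborSet, ← SimpleGraph.Subgraph.mem_edgeSet,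
        SimpleGraph.Walk.mem_edges_toSubgraph]
      exact hall y hy
    have h3 := Set.ncard_le_ncard hsub (Set.toFinite _)
    rw [Set.ncard_coe_finset, SimpleGraph.card_neighborFinset_eq_degree, h2] at h3
    have := hdeg u
    omega
  have hx := hmem x
  have hspec := w.take_spec hx
  have hlen2 : (w.takeUntil x hx).length + (w.dropUntil x hx).length = w.length := by
    rw [← SimpleGraph.Walk.length_append, hspec]
  have hpt : (w.takeUntil x hx).IsPath := hw.isPath_takeUntil hx
  have hnil : ¬ (w.takeUntil x hx).Nil := fun h => hux.ne h.eq
  have hpd : (w.dropUntil x hx).IsPath := by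
    rw [← hspec] at hw
    exact hw.isPath_of_append_right hnil
  have het : s(x, u) ∉ (w.takeUntil x hx).edges := fun h =>
    hxe (by rw [Sym2.eq_swap]; exact w.edges_takeUntil_subset_edges hx h)
  have hed : s(u, x) ∉ (w.dropUntil x hx).edges := fun h => hxe (w.edges_dropUntil_subset_edges hx h)
  -- An arc of length at least two makes the other arc, closed up by the chord, shorter than the
  -- whole cycle.
  have two_le : ∀ {a b : V} (p : G.Walk a b), a ≠ b → s(a, b) ∉ p.edges → 2 ≤ p.length := by
    intro a b p hab he
    rcases p with _ | ⟨h, p⟩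
    · exact absurd rfl hab
    · rcases p with _ | ⟨h', p⟩
      · simp at he
      · simp
  have ht2 := two_le _ hux.ne (by rwa [Sym2.eq_swap] at het)
  have hd2 := two_le _ hux.ne' (by rwa [Sym2.eq_swap] at hed)
  have h1 := hc _ _ (SimpleGraph.Path.cons_isCycle ⟨_, hpt⟩ hux.symm het) (by
    rw [SimpleGraph.Walk.length_cons]
    change (w.takeUntil x hx).length + 1 < _
    omega)
  have h2 := hc _ _ (SimpleGraph.Path.cons_isCycle ⟨_, hpd⟩ hux hed) (by
    rw [SimpleGraph.Walk.length_cons]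
    change (w.dropUntil x hx).length + 1 < _
    omega)
  simp only [walkGain, hg u x hux] at h1 h2
  rw [← hspec, walkGain_append, eq_inv_of_mul_eq_one_right h1, eq_inv_of_mul_eq_one_right h2]
  simp

/-- Potentials on the cycles that miss a vertex yield a global potential. -/
theorem exists_potential [DecidableRel G.Adj] (hconn : G.Connected) (hdeg : ∀ v, 3 ≤ G.degree v)
    {g : V → V → Γ} (hg : ∀ a b, G.Adj a b → g b a = (g a b)⁻¹)
    (hc : ∀ (u : V) (w : G.Walk u u), w.IsCycle → w.length < Fintype.card V →
      ∃ lam : V → Γ, ∀ a b, w.toSubgraph.Adj a b → lam b = lam a * g a b) :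
    ∃ lam : V → Γ, ∀ a b, G.Adj a b → lam b = lam a * g a b := by
  refine exists_potential_of_cycles hconn hg fun u w hw =>
    walkGain_eq_one_of_short hdeg hg (fun u w hw hlen => ?_) w hw
  obtain ⟨lam, hlam⟩ := hc u w hw hlen
  have := potential_mul_walkGain w fun a b hab => hlam a b (by
    rwa [← SimpleGraph.Subgraph.mem_edgeSet, SimpleGraph.Walk.mem_edges_toSubgraph])
  exact mul_eq_left.1 this.symm

end Gain

/-! ### Equilibrium force-loads on resolution trees -/

section

variable {V : Type*} [Fintype V] {G : SimpleGraph V} [DecidableRel G.Adj] {i : V}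

open Classical in
theorem sum_eq_of_three {W M : Type*} [Fintype W] [AddCommMonoid M] {φ : W → M} {a b c : W}
    (hab : a ≠ b) (hac : a ≠ c) (hbc : b ≠ c) (h : ∀ u, u ≠ a → u ≠ b → u ≠ c → φ u = 0) :
    ∑ u, φ u = φ a + (φ b + φ c) := by
  rw [← Finset.sum_pair hbc, ← Finset.sum_insert (by simp [hab, hac])]
  refine (Finset.sum_subset (Finset.subset_univ _) fun u _ hu => ?_).symm
  simp only [Finset.mem_insert, Finset.mem_singleton, not_or] at hu
  exact h u hu.1 hu.2.1 hu.2.2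

open Classical in
theorem IsLeafSplit.sum_add_sum {W ι M : Type*} [Fintype ι] [AddCommMonoid M] {T : SimpleGraph W}
    {leaf : ι → W} {A : W → W → Finset ι} (h : IsLeafSplit T leaf A) {v a b c : W}
    (ha : T.Adj v a) (hb : T.Adj v b) (hc : T.Adj v c) (hab : a ≠ b) (hac : a ≠ c) (hbc : b ≠ c)
    (f : ι → M) : ∑ j ∈ A a v, f j = ∑ j ∈ A v b, f j + ∑ j ∈ A v c, f j := by
  rw [← Finset.sum_union (Finset.disjoint_left.2 (h.not_mem hb hc hbc))]
  congr 1
  ext j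
  rw [h.mem_symm ha, Finset.mem_union]
  have := h.cover ha hb hc hab hac hbc j
  have := h.not_mem ha hb hab j
  have := h.not_mem ha hc hac j
  tauto

theorem ResolutionTree.ncard_eq_three (T : ResolutionTree G i) {v a b : T.W}
    (ha : T.graph.Adj v a) (hb : T.graph.Adj v b) (hab : a ≠ b) :
    (T.graph.neighborSet v).ncard = 3 := by
  refine (T.degree_eq v).resolve_left fun h1 => hab ?_
  obtain ⟨x, hx⟩ := Set.ncard_eq_one.1 h1
  have ha' : a ∈ T.graph.neighborSet v := ha
  have hb' : b ∈ T.graph.neighborSet v := hb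
  rw [hx, Set.mem_singleton_iff] at ha' hb'
  rw [ha', hb']

theorem ResolutionTree.sum_leaf (T : ResolutionTree G i) {F : T.W → T.W → Force}
    (hF : ∀ v w, ¬ T.graph.Adj v w → F v w = 0) {v : T.W} {j : G.neighborSet i}
    (hv : T.graph.Adj v (T.leaf j)) : ∑ u, F u (T.leaf j) = F v (T.leaf j) := by
  refine Finset.sum_eq_single v (fun u _ huv => hF _ _ fun hu => ?_) (by simp)
  exact T.isLeafSplit.ne_leaf hu.symm hv.symm huv j rfl

/-- The force at an edge of the tree is the sum of the leaf forces beyond it. -/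
theorem ResolutionTree.IsEquilibriumForceLoad.eq_sum {T : ResolutionTree G i} {L : Sym2 T.W → Line}
    {F : T.W → T.W → Force} (h : T.IsEquilibriumForceLoad L F) (hdeg : 3 ≤ G.degree i) (n : ℕ) :
    ∀ v w, T.graph.Adj v w → (T.split v w).card = n →
      F v w = ∑ j ∈ T.split v w, ∑ u, F u (T.leaf j) := by
  rw [← SimpleGraph.card_neighborSet_eq_degree] at hdeg
  have := nontrivial_of_three_le hdeg
  have hS := T.isLeafSplit
  induction n using Nat.strong_induction_on with
  | _ n ih =>
    intro v w hvw hn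
    -- At an inner vertex `w`, equilibrium and antisymmetry give `F v w = F w a + F w b`. The leaves
    -- beyond `w` are split between `a` and `b` into smaller nonempty sets, to which the induction
    -- applies.
    have key : ∀ a b, T.graph.Adj w a → T.graph.Adj w b → v ≠ a → v ≠ b → a ≠ b →
        F v w = ∑ j ∈ T.split v w, ∑ u, F u (T.leaf j) := by
      intro a b ha hb hva hvb hab
      have hsum := fun φ : G.neighborSet i → ℕ => hS.sum_add_sum hvw.symm ha hb hva hvb hab φ
      have hcard := hsum fun _ => 1
      simp only [Finset.sum_const, smul_eq_mul, mul_one] at hcard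
      have ha0 := Finset.card_pos.2 (hS.nonempty ha)
      have hb0 := Finset.card_pos.2 (hS.nonempty hb)
      rw [hS.sum_add_sum hvw.symm ha hb hva hvb hab, ← ih _ (by omega) w a ha rfl,
        ← ih _ (by omega) w b hb rfl]
      have he := h.equilibrium w (T.ncard_eq_three ha hb hab)
      rw [sum_eq_of_three hva hvb hab fun u hu1 hu2 hu3 => h.eq_zero _ _ fun hu => ?_] at he
      · have := h.antisymm v w
        rw [add_comm] at this
        exact add_left_cancel (this.trans he.symm)
      · rcases (hS.adj_iff hvw.symm ha hb hva hvb hab u).1 hu with rfl | rfl | rfl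
        exacts [hu1 rfl, hu2 rfl, hu3 rfl]
    rcases hS.star w with ⟨j, u, rfl, -⟩ | ⟨-, x, y, z, hxy, hxz, hyz, hadj, -⟩
    · have hs : T.split v (T.leaf j) = {j} := hS.split_leaf T.leaf_injective hvw
      rw [hs, Finset.sum_singleton, T.sum_leaf h.eq_zero hvw]
    · have hx := (hadj x).2 (by simp)
      have hy := (hadj y).2 (by simp)
      have hz := (hadj z).2 (by simp)
      rcases (hadj v).1 hvw.symm with rfl | rfl | rfl
      · exact key y z hy hz hxy hxz hyz
      · exact key x z hx hz hxy.symm hyz hxz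
      · exact key x y hx hy hxz.symm hyz.symm hxy

theorem exists_leaf_of_ncard_ne (T : ResolutionTree G i) {v : T.W}
    (h : (T.graph.neighborSet v).ncard ≠ 3) : ∃ j, (T.leaf j : T.W) = v := by
  obtain ⟨j, hj⟩ := T.leaf.surjective ⟨v, (T.degree_eq v).resolve_right h⟩
  exact ⟨j, by rw [hj]⟩

theorem ResolutionTree.eval_edgeExpr {T : ∀ i, ResolutionTree G i} {P : V → Point}
    (Q : Quantization T P) (σ : GenericChoice (numLines G)) {i : V} {a b : (T i).W}
    (hab : (T i).graph.Adj a b) :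
    ((T i).edgeExpr s(a, b)).eval σ Q.toConfig = some (Q.line i s(a, b)) := by
  unfold ResolutionTree.edgeExpr
  split_ifs with h1 h2
  · change some (Q.line i (((T i).enum.symm ((T i).enum ⟨s(a, b), h1⟩)).1)) = _
    rw [Equiv.symm_apply_apply]
  · refine eval_join rfl rfl ?_
    -- Whichever leaf of the edge is chosen, `leaf_line` prescribes the label of the edge.
    have hj := h2.choose_spec
    generalize h2.choose = j at hj
    rcases Sym2.mem_iff.1 hj with rfl | rfl
    · rw [Sym2.eq_swap]
      exact Q.leaf_line i j _ hab.symm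
    · exact Q.leaf_line i j _ hab
  · exfalso
    apply h1
    refine ⟨hab, fun v hv => ?_⟩
    by_contra h3
    obtain ⟨j, rfl⟩ := exists_leaf_of_ncard_ne (T i) h3
    exact h2 ⟨j, hv⟩

theorem join_comm {p q : Point} {ℓ : Line} (h : join p q = some ℓ) : join q p = some ℓ := by
  rw [join_eq_some] at *
  exact ⟨h.1.symm, h.2.2, h.2.1⟩

/-- Leaf forces at the vertex `i`, acting along the edges of the framework, that are carried by the
labels of the resolution trees. -/
structure IsLeafForces {T : ∀ i, ResolutionTree G i} {P : V → Point} (Q : Quantization T P)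
    (f : V → V → Force) : Prop where
  along : ∀ i j, G.Adj i j → ∀ ℓ, join (P i) (P j) = some ℓ → IsLineOfForce (f i j) ℓ
  nonParallelizable : ∀ i, NonParallelizable fun j : G.neighborSet i => f i j
  sum_eq_zero : ∀ i, ∑ j : G.neighborSet i, f i j = 0
  line : ∀ i a b, (T i).graph.Adj a b →
    IsLineOfForce (∑ j ∈ (T i).split a b, f i j) (Q.line i s(a, b))

-- The forces are the leaf forces of the loads provided by strong genericity. By
-- `IsEquilibriumForceLoad.eq_sum` each edge force is a proper partial sum, hence nonzero, so the
-- label along which it acts is its line.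
open Classical in
theorem exists_isLeafForces {T : ∀ i, ResolutionTree G i} {P : V → Point} {Q : Quantization T P}
    (hdeg : ∀ i, 3 ≤ G.degree i) (hQ : Q.Generic) : ∃ f, IsLeafForces Q f := by
  choose hweak F hF hne hnp using hQ
  have hdeg' : ∀ i, 3 ≤ Fintype.card (G.neighborSet i) := fun i => by
    rw [SimpleGraph.card_neighborSet_eq_degree]
    exact hdeg i
  have hS := fun i => (T i).isLeafSplit
  have hline : ∀ i a b, (T i).graph.Adj a b →
      IsLineOfForce (∑ j ∈ (T i).split a b, ∑ u, F i u ((T i).leaf j)) (Q.line i s(a, b)) := by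
    intro i a b hab
    have := nontrivial_of_three_le (hdeg' i)
    have h1 := (hnp i).sum_ne_zero ((hS i).nonempty hab) ((hS i).ne_univ hab)
    have h2 := (hF i).eq_sum (hdeg i) _ a b hab rfl
    have h3 := (hF i).stress_along a b hab
    rw [isLineOfForce_iff]
    exact ⟨h1, h2 ▸ h3⟩
  let f : V → V → Force := fun i j => if h : j ∈ G.neighborSet i then
    ∑ u, F i u ((T i).leaf ⟨j, h⟩) else 0
  have hf : ∀ i (j : G.neighborSet i), f i j = ∑ u, F i u ((T i).leaf j) := fun i j =>
    dif_pos j.2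
  refine ⟨f, ?_, ?_, ?_, ?_⟩
  · intro i j hij ℓ hℓ
    have hj : (⟨j, hij⟩ : G.neighborSet i).1 = j := rfl
    rw [← hj, hf]
    obtain ⟨w, hw⟩ : ∃ w, (T i).graph.Adj w ((T i).leaf ⟨j, hij⟩) := by
      obtain ⟨w, hw⟩ := Set.ncard_eq_one.1 ((T i).leaf ⟨j, hij⟩).2
      have : w ∈ (T i).graph.neighborSet ((T i).leaf ⟨j, hij⟩ : (T i).W) := by rw [hw]; rfl
      exact ⟨w, this.symm⟩
    have h1 := hline i _ _ hw
    have h2 : (T i).split w ((T i).leaf ⟨j, hij⟩) = {⟨j, hij⟩} :=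
      (hS i).split_leaf (T i).leaf_injective hw
    rw [h2, Finset.sum_singleton] at h1
    have h3 := Q.leaf_line i ⟨j, hij⟩ w hw
    rw [hj, hℓ, Option.some_inj] at h3
    rwa [h3]
  · intro i
    simpa only [hf] using hnp i
  · intro i
    simp only [hf]
    have := nontrivial_of_three_le (hdeg' i)
    -- The two opposite forces at any edge are the sums over complementary leaf sets, so all leaf
    -- forces together sum to zero.
    obtain ⟨v, w, hvw⟩ := hne i
    have hadj : (T i).graph.Adj v w := by
      by_contra h
      exact hvw ((hF i).eq_zero v w h)
    have h1 := (hF i).eq_sum (hdeg i) _ v w hadj rfl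
    have h2 := (hF i).eq_sum (hdeg i) _ w v hadj.symm rfl
    have h3 := (hF i).antisymm v w
    rwa [h1, h2, (hS i).sum_add_sum_symm hadj] at h3
  · intro i a b hab
    simp only [hf]
    exact hline i a b hab

/-- The values of the framing expressions. -/
theorem IsLeafForces.eval_framing {T : ∀ i, ResolutionTree G i} {P : V → Point}
    {Q : Quantization T P} {f : V → V → Force} (hf : IsLeafForces Q f)
    (hP : Function.Injective P) (σ : GenericChoice (numLines G))
    {i : V} {j k : G.neighborSet i} (hjk : j ≠ k) {τ : GeomExpr (numLines G) .line}
    (hτ : (T i).IsFraming j k τ) :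
    ∃ ℓ : Line, τ.eval σ Q.toConfig = some ℓ ∧ IsLineOfForce (f i j + f i k) ℓ := by
  obtain ⟨T', Λ', v, u, hr, h1, h2, h3, h4, h5, rfl⟩ := hτ
  have : Nontrivial (G.neighborSet i) := ⟨j, k, hjk⟩
  refine Tensegrity.eval_framing (f := fun j : G.neighborSet i => f i j) hr ?_ (T i).isLeafSplit
    (T i).leaf_injective (hf.nonParallelizable i) (hf.sum_eq_zero i)
    (show (GeomExpr.fixedPoint i).eval σ Q.toConfig = some (P i) from rfl) ?_ hjk h1 h2 h3 h4 h5
  · intro a b hab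
    exact ⟨_, ResolutionTree.eval_edgeExpr Q σ hab, hf.line i a b hab⟩
  · intro l
    obtain ⟨ℓ, hℓ⟩ := exists_join (hP.ne (SimpleGraph.Adj.ne l.2))
    exact ActsAlong.through (Or.inr (hf.along i l l.2 ℓ hℓ)) (join_eq_some.1 hℓ).2.1

/-! ### From non-parallelizable forces to generic quantizations -/

theorem NonParallelizable.ne_zero {ι : Type*} [Fintype ι] [Nontrivial ι] {f : ι → Force}
    (h : NonParallelizable f) (j : ι) : f j ≠ 0 := by
  have := h.sum_ne_zero (A := {j}) (Finset.singleton_nonempty j) ?_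
  · simpa using this
  · obtain ⟨k, hk⟩ := exists_ne j
    intro hu
    have : k ∈ ({j} : Finset ι) := hu ▸ Finset.mem_univ k
    exact hk (Finset.mem_singleton.1 this)

/-- Labels of a tree by the lines of force of the partial sums. -/
theorem ResolutionTree.exists_lines (T : ResolutionTree G i) (hdeg : 3 ≤ G.degree i)
    {f : G.neighborSet i → Force} (hnp : NonParallelizable f) (hf : ∑ j, f j = 0) :
    ∃ L : Sym2 T.W → Line, ∀ a b, T.graph.Adj a b →
      IsLineOfForce (∑ j ∈ T.split a b, f j) (L s(a, b)) := by
  rw [← SimpleGraph.card_neighborSet_eq_degree] at hdeg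
  have := nontrivial_of_three_le hdeg
  have hS := T.isLeafSplit
  have key : ∀ e : Sym2 T.W, ∃ ℓ, ∀ a b, T.graph.Adj a b → e = s(a, b) →
      IsLineOfForce (∑ j ∈ T.split a b, f j) ℓ := by
    intro e
    induction e with
    | _ a b =>
      by_cases hab : T.graph.Adj a b
      · obtain ⟨ℓ, hℓ, -⟩ := exists_isLineOfForce
          (hnp.sum_ne_zero (hS.nonempty hab) (hS.ne_univ hab))
        refine ⟨ℓ, fun c d _ he => ?_⟩
        rcases Sym2.eq_iff.1 he with ⟨rfl, rfl⟩ | ⟨rfl, rfl⟩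
        · exact hℓ
        · rw [eq_neg_of_add_eq_zero_right ((hS.sum_add_sum_symm hab f).trans hf)]
          exact hℓ.neg
      · obtain ⟨j⟩ := this.to_nonempty
        obtain ⟨ℓ, -⟩ := exists_isLineOfForce (hnp.ne_zero j)
        refine ⟨ℓ, fun c d hcd he => absurd ?_ hab⟩
        rw [← SimpleGraph.mem_edgeSet, he]
        exact hcd
  choose L hL using key
  exact ⟨L, fun a b hab => hL _ a b hab rfl⟩

-- The load consists of the partial sums: complementary leaf sets make it antisymmetric, and the
-- partition of leaves at an inner vertex puts it in equilibrium. Labels of adjacent edges differ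
-- because the third edge at their vertex has a leaf beyond it that belongs to neither sum.
open Classical in
theorem ResolutionTree.stronglyGeneric (T : ResolutionTree G i) (hdeg : 3 ≤ G.degree i)
    {f : G.neighborSet i → Force} (hnp : NonParallelizable f) (hf : ∑ j, f j = 0)
    {L : Sym2 T.W → Line} (hL : ∀ a b, T.graph.Adj a b →
      IsLineOfForce (∑ j ∈ T.split a b, f j) (L s(a, b))) : T.StronglyGeneric L := by
  rw [← SimpleGraph.card_neighborSet_eq_degree] at hdeg
  have := nontrivial_of_three_le hdeg
  have hS := T.isLeafSplit
  refine ⟨?_, ?_⟩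
  · intro u v w huv hvw huw
    obtain ⟨x, hx, hxu, hxw⟩ := hS.exists_third huv.symm hvw huw
    have h1 := hL _ _ huv.symm
    rw [Sym2.eq_swap] at h1
    obtain ⟨j, hj⟩ := hS.nonempty huv.symm
    obtain ⟨k, hk⟩ := hS.nonempty hx
    obtain ⟨l, hl⟩ := hS.nonempty hvw
    exact hnp.line_ne_of_mem hf j l k ⟨hj, hS.not_mem huv.symm hvw huw j hj,
      hS.not_mem hvw huv.symm huw.symm l hl, hl, hS.not_mem hx huv.symm hxu k hk,
      hS.not_mem hx hvw hxw k hk⟩ h1 (hL _ _ hvw)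
  · let F : T.W → T.W → Force := fun v w =>
      if T.graph.Adj v w then ∑ j ∈ T.split v w, f j else 0
    have hFadj : ∀ {v w}, T.graph.Adj v w → F v w = ∑ j ∈ T.split v w, f j := fun h => if_pos h
    have hF0 : ∀ v w, ¬ T.graph.Adj v w → F v w = 0 := fun v w h => if_neg h
    have hanti : ∀ v w, F v w + F w v = 0 := by
      intro v w
      by_cases h : T.graph.Adj v w
      · rw [hFadj h, hFadj h.symm, hS.sum_add_sum_symm h, hf]
      · rw [hF0 _ _ h, hF0 _ _ fun h' => h h'.symm, add_zero]
    have hleaf : ∀ j, ∃ w, T.graph.Adj w (T.leaf j) := by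
      intro j
      obtain ⟨w, hw⟩ := Set.ncard_eq_one.1 (T.leaf j).2
      have : w ∈ T.graph.neighborSet (T.leaf j : T.W) := by rw [hw]; rfl
      exact ⟨w, this.symm⟩
    have hFleaf : ∀ {j w}, T.graph.Adj w (T.leaf j) → F w (T.leaf j) = f j := by
      intro j w hw
      have h2 : T.split w (T.leaf j) = {j} := hS.split_leaf T.leaf_injective hw
      rw [hFadj hw, h2, Finset.sum_singleton]
    refine ⟨F, ⟨?_, hanti, hF0, ?_⟩, ?_, ?_⟩
    · intro v w h
      rw [hFadj h]
      exact Or.inr (hL v w h)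
    · intro v hv
      obtain ⟨x, y, z, hxy, hxz, hyz, hN⟩ := Set.ncard_eq_three.1 hv
      have hadj : ∀ u, T.graph.Adj v u ↔ u = x ∨ u = y ∨ u = z := fun u => by
        rw [← SimpleGraph.mem_neighborSet, hN]
        simp
      have hx := (hadj x).2 (by simp)
      have hy := (hadj y).2 (by simp)
      have hz := (hadj z).2 (by simp)
      rw [sum_eq_of_three hxy hxz hyz fun u h1 h2 h3 => hF0 _ _ fun hu => by
        rcases (hadj u).1 hu with h | h | h
        exacts [h1 h, h2 h, h3 h], hFadj hy, hFadj hz,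
        ← hS.sum_add_sum hx hy hz hxy hxz hyz, ← hFadj hx.symm]
      exact hanti _ _
    · obtain ⟨j⟩ := this.to_nonempty
      obtain ⟨w, hw⟩ := hleaf j
      exact ⟨w, T.leaf j, by rw [hFleaf hw]; exact hnp.ne_zero j⟩
    · have : (fun j : G.neighborSet i => ∑ v, F v (T.leaf j)) = f := by
        funext j
        obtain ⟨w, hw⟩ := hleaf j
        rw [T.sum_leaf hF0 hw, hFleaf hw]
      rw [this]
      exact hnp

/-- Non-parallelizable forces in equilibrium at all vertices define a generic quantization. -/
theorem exists_quantization {P : V → Point} (hP : Function.Injective P)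
    (hdeg : ∀ i, 3 ≤ G.degree i) (T : ∀ i, ResolutionTree G i) {f : V → V → Force}
    (halong : ∀ i j, G.Adj i j → ∃ ℓ, join (P i) (P j) = some ℓ ∧ ActsAlong (f i j) ℓ)
    (hnp : ∀ i, NonParallelizable fun j : G.neighborSet i => f i j)
    (hsum : ∀ i, ∑ j : G.neighborSet i, f i j = 0) :
    ∃ Q : Quantization T P, Q.Generic ∧ IsLeafForces Q f := by
  choose L hL using fun i => (T i).exists_lines (hdeg i) (hnp i) (hsum i)
  have hdeg' : ∀ i, 3 ≤ Fintype.card (G.neighborSet i) := fun i => by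
    rw [SimpleGraph.card_neighborSet_eq_degree]
    exact hdeg i
  have hline : ∀ i j, G.Adj i j → ∀ ℓ, join (P i) (P j) = some ℓ → IsLineOfForce (f i j) ℓ := by
    intro i j hij ℓ hℓ
    have := nontrivial_of_three_le (hdeg' i)
    obtain ⟨m, hm, hm'⟩ := halong i j hij
    rw [hℓ, Option.some_inj] at hm
    exact isLineOfForce_iff.2 ⟨(hnp i).ne_zero ⟨j, hij⟩, hm ▸ hm'⟩
  let Q : Quantization T P :=
    { line := L
      leaf_line := by
        intro i j v hv
        have h2 : (T i).split v ((T i).leaf j) = {j} :=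
          (T i).isLeafSplit.split_leaf (T i).leaf_injective hv
        have h1 := hL i _ _ hv
        rw [h2, Finset.sum_singleton] at h1
        obtain ⟨ℓ, hℓ⟩ := exists_join (hP.ne (SimpleGraph.Adj.ne j.2))
        rw [hℓ, (hline i j j.2 ℓ hℓ).eq_line h1]
      interior_mem := by
        intro i e he _
        induction e with
        | _ a b =>
          refine (hL i a b he).mem_of_through (Through.sum _ fun j _ => ?_)
          obtain ⟨ℓ, hℓ⟩ := exists_join (hP.ne (SimpleGraph.Adj.ne j.2))
          exact ActsAlong.through (Or.inr (hline i j j.2 ℓ hℓ)) (join_eq_some.1 hℓ).2.1 }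
  exact ⟨Q, fun i => (T i).stronglyGeneric (hdeg i) (hnp i) (hsum i) (hL i), hline, hnp, hsum, hL⟩

end

/-! ### Lines in general position -/

theorem infinite_points (ℓ : Line) : {q : Point | q ∈ ℓ}.Infinite := by
  obtain ⟨p, q, hs, hli⟩ := exists_span_pair ℓ
  rw [LinearIndependent.pair_iff] at hli
  have hne : ∀ t : ℝ, p + t • q ≠ 0 := by
    intro t h
    have := (hli 1 t (by simpa using h)).1
    simp at this
  refine Set.infinite_of_injective_forall_mem (f := fun t : ℝ => Projectivization.mk ℝ _ (hne t))
    ?_ ?_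
  · intro s t hst
    obtain ⟨a, ha⟩ := (Projectivization.mk_eq_mk_iff' ℝ _ _ (hne s) (hne t)).1 hst
    have h0 : (a - 1) • p + (a * t - s) • q = 0 := by
      rw [sub_smul, sub_smul, mul_smul, one_smul]
      rw [smul_add] at ha
      rw [sub_add_sub_comm, ha, sub_self]
    obtain ⟨h1, h2⟩ := hli _ _ h0
    have : a = 1 := by linarith
    subst this
    linarith
  · intro t
    change Projectivization.submodule _ ≤ ℓ.1
    rw [Projectivization.submodule_mk, Submodule.span_singleton_le_iff_mem, hs,
      Submodule.mem_span_pair]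
    exact ⟨1, t, by simp⟩

/-- Two equal lines would contribute infinitely many common points to a finite set. -/
theorem LinesInGeneralPosition.injective {n : ℕ} {ℓ : Fin n → Line}
    (h : LinesInGeneralPosition ℓ) : Function.Injective ℓ := by
  intro a b hab
  by_contra hne
  have hfin : {q : Point | ∃ a b : Fin n, a ≠ b ∧ q ∈ ℓ a ∧ q ∈ ℓ b}.Finite := by
    rw [← Set.encard_lt_top_iff, h]
    exact ENat.natCast_lt_top _
  exact infinite_points (ℓ a) (hfin.subset fun q hq => ⟨a, b, hne, hq, hab ▸ hq⟩)

/-- Every intersection point comes from a pair of lines. If three lines concur at `q`, the pair `{a,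
b}` can be dropped because `{a, c}` gives the same point, and then there are too few points. -/
theorem LinesInGeneralPosition.not_mem {n : ℕ} {ℓ : Fin n → Line}
    (h : LinesInGeneralPosition ℓ) {a b c : Fin n} (hab : a ≠ b) (hac : a ≠ c) (hbc : b ≠ c)
    {q : Point} (ha : q ∈ ℓ a) (hb : q ∈ ℓ b) : ¬ q ∈ ℓ c := by
  classical
  intro hc
  let φ : Finset (Fin n) → Point := fun s => if h : ∃ q, ∀ a ∈ s, q ∈ ℓ a then h.choose else q
  have hφ : ∀ {a b : Fin n} {q : Point}, a ≠ b → q ∈ ℓ a → q ∈ ℓ b → φ {a, b} = q := by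
    intro a b q hab ha hb
    have hex : ∃ q, ∀ c ∈ ({a, b} : Finset (Fin n)), q ∈ ℓ c := ⟨q, by simp [ha, hb]⟩
    have h1 : φ {a, b} = hex.choose := dif_pos hex
    have h2 := hex.choose_spec
    rw [h1]
    exact point_unique (h.injective.ne hab) (h2 a (by simp)) ha (h2 b (by simp)) hb
  have hS : {q : Point | ∃ a b : Fin n, a ≠ b ∧ q ∈ ℓ a ∧ q ∈ ℓ b} ⊆
      ↑(((Finset.powersetCard 2 (Finset.univ : Finset (Fin n))).erase {a, b}).image φ) := by
    rintro r ⟨a', b', hab', ha', hb'⟩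
    rw [Finset.coe_image, Set.mem_image]
    by_cases he : ({a', b'} : Finset (Fin n)) = {a, b}
    · refine ⟨{a, c}, ?_, ?_⟩
      · rw [Finset.mem_coe, Finset.mem_erase, Finset.mem_powersetCard]
        refine ⟨fun heq => ?_, Finset.subset_univ _, Finset.card_pair hac⟩
        have : c ∈ ({a, b} : Finset (Fin n)) := heq ▸ by simp
        rw [Finset.mem_insert, Finset.mem_singleton] at this
        exact this.elim (fun h => hac h.symm) fun h => hbc h.symm
      · rw [hφ hac ha hc, ← hφ hab ha hb, ← he, hφ hab' ha' hb']
    · refine ⟨{a', b'}, ?_, hφ hab' ha' hb'⟩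
      rw [Finset.mem_coe, Finset.mem_erase, Finset.mem_powersetCard]
      exact ⟨he, Finset.subset_univ _, Finset.card_pair hab'⟩
  have h1 := Set.encard_le_encard hS
  rw [h, Set.encard_coe_eq_coe_finsetCard, Nat.cast_le] at h1
  have h2 := Finset.card_image_le (s := (Finset.powersetCard 2
    (Finset.univ : Finset (Fin n))).erase {a, b}) (f := φ)
  have hmem : ({a, b} : Finset (Fin n)) ∈ Finset.powersetCard 2 (Finset.univ : Finset (Fin n)) := by
    rw [Finset.mem_powersetCard]
    exact ⟨Finset.subset_univ _, Finset.card_pair hab⟩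
  rw [Finset.card_erase_of_mem hmem, Finset.card_powersetCard, Finset.card_univ, Fintype.card_fin,
    Nat.choose_two_right] at h2
  have h3 := Finset.card_pos.2 ⟨_, hmem⟩
  rw [Finset.card_powersetCard, Finset.card_univ, Fintype.card_fin, Nat.choose_two_right] at h3
  omega

/-! ### Framed cycles indexed by numbers -/

theorem isFramedChain_map_range {D : ℕ → CycleDatum} {E : ℕ → Line} (n : ℕ) : ∀ s : ℕ,
    (∀ m, s ≤ m → m < s + n → (D m).out = E (m + 1) ∧ (D m).pt ∈ E m ∧ (D m).pt ∈ E (m + 1) ∧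
      (D m).pt ∈ (D m).fr ∧ (D m).fr ≠ E m ∧ (D m).fr ≠ E (m + 1)) →
    IsFramedChain (E s) ((List.range n).map fun m => D (s + m)) := by
  induction n with
  | zero => intro s _; trivial
  | succ n ih =>
    intro s h
    obtain ⟨h1, h2, h3, h4, h5, h6⟩ := h s le_rfl (by omega)
    rw [List.range_succ_eq_map, List.map_cons, List.map_map]
    refine ⟨h2, h1 ▸ h3, h4, h5, h1 ▸ h6, ?_⟩
    have := ih (s + 1) fun m hm hm' => h m (by omega) (by omega)
    rw [add_zero, h1]
    convert this using 3
    simp only [Function.comp_apply]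
    congr 1
    omega

/-- The nested existentials of `Balanced` become a sequence in which `h m` enters the vertex `D m`
and `h (m + 1)` leaves it. -/
theorem balanced_map_range_iff {D : ℕ → CycleDatum} {h₁ : Force} (n : ℕ) : ∀ (s : ℕ) (h₀ : Force),
    Balanced h₀ h₁ ((List.range n).map fun m => D (s + m)) ↔ ∃ h : ℕ → Force, h s = h₀ ∧
      h (s + n) = h₁ ∧ ∀ m, s ≤ m → m < s + n → h (m + 1) ≠ 0 ∧ ActsAlong (h (m + 1)) (D m).out ∧
        ActsAlong (h (m + 1) - h m) (D m).fr := by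
  induction n with
  | zero =>
    intro s h₀
    constructor
    · rintro (h : h₀ = h₁)
      exact ⟨fun _ => h₀, rfl, h, fun m hm hm' => by omega⟩
    · rintro ⟨h, rfl, rfl, -⟩
      exact rfl
  | succ n ih =>
    intro s h₀
    have hrw : (List.range (n + 1)).map (fun m => D (s + m)) =
        D s :: (List.range n).map fun m => D (s + 1 + m) := by
      rw [List.range_succ_eq_map, List.map_cons, List.map_map, add_zero]
      congr 2
      funext m
      simp only [Function.comp_apply]
      congr 1
      omega
    rw [hrw]
    constructor
    · rintro ⟨k, hk0, hk, hk', hb⟩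
      obtain ⟨h, h1, h2, h3⟩ := (ih (s + 1) k).1 hb
      refine ⟨Function.update h s h₀, by simp, ?_, ?_⟩
      · rw [Function.update_of_ne (by omega), ← h2]
        congr 1
        omega
      · intro m hm hm'
        rw [Function.update_of_ne (by omega)]
        rcases Nat.eq_or_lt_of_le hm with rfl | hlt
        · rw [Function.update_self, h1]
          exact ⟨hk0, hk, hk'⟩
        · rw [Function.update_of_ne (by omega)]
          exact h3 m (by omega) (by omega)
    · rintro ⟨h, rfl, h2, h3⟩
      obtain ⟨a, b, c⟩ := h3 s le_rfl (by omega)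
      refine ⟨h (s + 1), a, b, c, (ih (s + 1) _).2 ⟨h, rfl, ?_, fun m hm hm' =>
        h3 m (by omega) (by omega)⟩⟩
      rw [← h2]
      congr 1
      omega

theorem IsLineOfForce.ne_of_add {f₁ f₂ : Force} {e₁ e₂ ℓ : Line} (he : e₁ ≠ e₂)
    (hf₁ : IsLineOfForce f₁ e₁) (hf₂ : IsLineOfForce f₂ e₂) (hℓ : IsLineOfForce (f₁ + f₂) ℓ) :
    ℓ ≠ e₂ := by
  rintro rfl
  have h1 : ActsAlong (f₁ + f₂ - f₂) ℓ := ActsAlong.sub (Or.inr hℓ) (Or.inr hf₂)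
  rw [add_sub_cancel_right] at h1
  exact he (ActsAlong.eq_line (Or.inr hf₁) h1 hf₁.ne_zero)

/-- Two forces with a prescribed line of their difference are determined up to a factor. -/
theorem exists_common_factor {f₁ f₂ h₁ h₂ : Force} {e₁ e₂ ℓ : Line} (he : e₁ ≠ e₂)
    (hf₁ : IsLineOfForce f₁ e₁) (hf₂ : IsLineOfForce f₂ e₂) (hℓ : IsLineOfForce (f₁ + f₂) ℓ)
    (hh₁ : ActsAlong h₁ e₁) (hh₂ : ActsAlong h₂ e₂) (hd : ActsAlong (h₂ - h₁) ℓ) :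
    ∃ c : ℝ, h₂ = c • f₂ ∧ h₁ = -(c • f₁) := by
  obtain ⟨a, rfl⟩ := hh₂.exists_smul (Or.inr hf₂) hf₂.ne_zero
  obtain ⟨b, rfl⟩ := hh₁.exists_smul (Or.inr hf₁) hf₁.ne_zero
  have hℓe : ℓ ≠ e₂ := hf₁.ne_of_add he hf₂ hℓ
  -- With `h₂ = a • f₂` and `h₁ = b • f₁`, this combination acts along the different lines `ℓ` and
  -- `e₂`, hence vanishes and `b = -a`.
  have h1 : ActsAlong ((a + b) • f₂) ℓ := by
    have : (a + b) • f₂ = (a • f₂ - b • f₁) + b • (f₁ + f₂) := by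
      rw [smul_add, add_smul]
      abel
    rw [this]
    exact hd.add (ActsAlong.smul b (Or.inr hℓ))
  have h2 := h1.eq_zero (ActsAlong.smul _ (Or.inr hf₂)) hℓe
  have h3 := (smul_eq_zero.1 h2).resolve_right hf₂.ne_zero
  refine ⟨a, rfl, ?_⟩
  rw [eq_neg_of_add_eq_zero_right h3]
  exact neg_smul a f₁

/-- Balanced forces along a closed polygon, in terms of factors for forces at its vertices. -/
theorem exists_forces_iff_exists_factors {V : Type*} {f : V → V → Force} {k : ℕ} {q : ℕ → V}
    {E fr : ℕ → Line} (hq0 : q k = q 0) (hq1 : q (k + 1) = q 1) (hinj : Set.InjOn q (Set.Ioc 0 k))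
    (hE : ∀ m ≤ k, IsLineOfForce (f (q m) (q (m + 1))) (E m) ∧
      IsLineOfForce (f (q (m + 1)) (q m)) (E m))
    (hne : ∀ m < k, E m ≠ E (m + 1))
    (hfr : ∀ m < k, IsLineOfForce (f (q (m + 1)) (q m) + f (q (m + 1)) (q (m + 2))) (fr m)) :
    (∃ h : ℕ → Force, h k = h 0 ∧ h 0 ≠ 0 ∧ ActsAlong (h 0) (E 0) ∧ ∀ m < k, h (m + 1) ≠ 0 ∧
      ActsAlong (h (m + 1)) (E (m + 1)) ∧ ActsAlong (h (m + 1) - h m) (fr m)) ↔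
    ∃ lam : V → ℝ, (∀ v, lam v ≠ 0) ∧ ∀ m < k,
      lam (q m) • f (q m) (q (m + 1)) + lam (q (m + 1)) • f (q (m + 1)) (q m) = 0 := by
  classical
  constructor
  · rintro ⟨h, hk, h00, h0, hh⟩
    have hal : ∀ m ≤ k, ActsAlong (h m) (E m) := by
      intro m hm
      rcases m with _ | m
      · exact h0
      · exact (hh m (by omega)).2.1
    -- The factor at the vertex `q (m + 1)` is read off from its two edge forces.
    have hex : ∀ m, ∃ c : ℝ, m < k → c ≠ 0 ∧ h (m + 1) = c • f (q (m + 1)) (q (m + 2)) ∧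
        h m = -(c • f (q (m + 1)) (q m)) := by
      intro m
      by_cases hm : m < k
      · obtain ⟨c, hc, hc'⟩ := exists_common_factor (hne m hm) (hE m hm.le).2
          (hE (m + 1) hm).1 (hfr m hm) (hal m hm.le) (hal (m + 1) hm) (hh m hm).2.2
        refine ⟨c, fun _ => ⟨?_, hc, hc'⟩⟩
        rintro rfl
        exact (hh m hm).1 (by rw [hc, zero_smul])
      · exact ⟨0, fun h => absurd h hm⟩
    choose c hc using hex
    -- Well defined because the vertices are distinct; off the polygon any nonzero value serves.
    let lam : V → ℝ := fun v => if hv : ∃ m, m < k ∧ q (m + 1) = v then c hv.choose else 1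
    have hlam : ∀ m < k, lam (q (m + 1)) = c m := by
      intro m hm
      have hv : ∃ m', m' < k ∧ q (m' + 1) = q (m + 1) := ⟨m, hm, rfl⟩
      have h1 : lam (q (m + 1)) = c hv.choose := dif_pos hv
      obtain ⟨h2, h3⟩ := hv.choose_spec
      have := hinj (Set.mem_Ioc.2 ⟨by omega, by omega⟩) (Set.mem_Ioc.2 ⟨by omega, by omega⟩) h3
      rw [h1]
      congr 1
      omega
    refine ⟨lam, ?_, ?_⟩
    · intro v
      simp only [lam]
      split_ifs with hv
      · exact (hc _ hv.choose_spec.1).1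
      · exact one_ne_zero
    · intro m hm
      have h2 := (hc m hm).2.2
      rw [hlam m hm]
      -- The edge `0` is the edge `k` again, so the factor at `q 0 = q k` is the last one.
      rcases m with _ | m
      · obtain ⟨k, rfl⟩ := Nat.exists_eq_add_of_lt hm
        have h1 := (hc (0 + k) (by omega)).2.1
        rw [← hlam (0 + k) (by omega), hq1, hq0, hk, h2] at h1
        rw [← h1]
        exact neg_add_cancel _
      · have h1 := (hc m (by omega)).2.1
        rw [← hlam m (by omega), h2] at h1
        rw [← h1]
        exact neg_add_cancel _
  · rintro ⟨lam, h0, hlam⟩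
    -- The force of an edge is the rescaled leaf force at its starting vertex; cancellation
    -- identifies it with minus the one at its end.
    refine ⟨fun m => lam (q m) • f (q m) (q (m + 1)), by simp only [hq0, hq1],
      smul_ne_zero (h0 _) (hE 0 (by omega)).1.ne_zero,
      ActsAlong.smul _ (Or.inr (hE 0 (by omega)).1), fun m hm => ⟨?_, ?_, ?_⟩⟩
    · exact smul_ne_zero (h0 _) (hE (m + 1) hm).1.ne_zero
    · exact ActsAlong.smul _ (Or.inr (hE (m + 1) hm).1)
    · have : lam (q (m + 1)) • f (q (m + 1)) (q (m + 1 + 1)) - lam (q m) • f (q m) (q (m + 1)) =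
          lam (q (m + 1)) • (f (q (m + 1)) (q m) + f (q (m + 1)) (q (m + 2))) := by
        rw [eq_neg_of_add_eq_zero_left (hlam m hm), smul_add]
        abel
      rw [this]
      exact ActsAlong.smul _ (Or.inr (hfr m hm))

/-! ### The conditions of cycles -/

section Condition

variable {V : Type*} [Fintype V] {G : SimpleGraph V} [DecidableRel G.Adj]

/-- The framings evaluate to lines of `f i j + f i k`, so a balanced system of edge forces is
proportional to the leaf forces at each vertex. The factors of proportionality are `lam`. -/
theorem IsLeafForces.condition_holds_iff {T : ∀ i, ResolutionTree G i} {P : V → Point}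
    {Q : Quantization T P} {f : V → V → Force} (hf : IsLeafForces Q f)
    (hP : Function.Injective P) (σ : GenericChoice (numLines G)) (Φ : SystemChoice T)
    (c : ShortCycle G) (hpos : CycleInGeneralPosition P (Φ.walk c)) :
    (Φ.condition c).Holds σ Q.toConfig ↔ ∃ lam : V → ℝ, (∀ v, lam v ≠ 0) ∧
      ∀ a b, c.1.Adj a b → lam a • f a b + lam b • f b a = 0 := by
  have hw := Φ.isCycle c
  have hframe : ∀ i j k, G.Adj i j → G.Adj i k → j ≠ k → ∃ ℓ : Line,
      (Φ.framing i j k).eval σ Q.toConfig = some ℓ ∧ IsLineOfForce (f i j + f i k) ℓ :=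
    fun i j k hj hk hjk =>
      have hne : (⟨j, hj⟩ : G.neighborSet i) ≠ ⟨k, hk⟩ := fun h => hjk (congrArg Subtype.val h)
      hf.eval_framing hP σ hne (Φ.isFraming i ⟨j, hj⟩ ⟨k, hk⟩ hne)
  rw [SystemChoice.condition, ← Φ.toSubgraph_eq c]
  simp only [SystemChoice.framedVertex]
  generalize Φ.walk c = w at *
  generalize Φ.base c = u at *
  obtain ⟨ℓ, hℓ, hgen⟩ := hpos
  have hk3 := hw.three_le_length
  obtain ⟨n, hn⟩ : ∃ n, w.length = n + 1 := ⟨w.length - 1, by omega⟩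
  -- The index is shifted by one: `q (m + 1)` is the vertex `m` and `q 0` is the last vertex. Thus
  -- `E m` is the edge entering the vertex `m`, and both `E 0` and `E (n + 1)` are the closing edge.
  let q : ℕ → V := fun m => if m = 0 then w.getVert n else w.getVert (m - 1)
  have q0 : q 0 = w.getVert n := rfl
  have qs : ∀ m, q (m + 1) = w.getVert m := fun m => rfl
  have hlast : w.getVert (n + 1) = w.getVert 0 := by
    rw [← hn, w.getVert_length, w.getVert_zero]
  have hq0 : q (n + 1) = q 0 := rfl
  have hq1 : q (n + 1 + 1) = q 1 := hlast
  have hinj : Set.InjOn q (Set.Ioc 0 (n + 1)) := by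
    intro a ha b hb hab
    obtain ⟨a, rfl⟩ := Nat.exists_eq_succ_of_ne_zero ha.1.ne'
    obtain ⟨b, rfl⟩ := Nat.exists_eq_succ_of_ne_zero hb.1.ne'
    have h1 := hw.getVert_injOn' (by simpa [hn] using ha.2) (by simpa [hn] using hb.2) hab
    simpa using h1
  have hadj' : ∀ m < n + 1, G.Adj (w.getVert m) (w.getVert (m + 1)) := fun m hm =>
    w.adj_getVert_succ (by omega)
  have hadj : ∀ m ≤ n + 1, G.Adj (q m) (q (m + 1)) := by
    intro m hm
    rcases m with _ | m
    · rw [q0, qs, ← hlast]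
      exact hadj' n (by omega)
    · exact hadj' m (by omega)
  have hnext : ∀ m < n + 1, q m ≠ q (m + 2) := by
    intro m hm
    rcases m with _ | m
    · rw [q0, qs]
      intro h
      have := hw.getVert_injOn' (by simp [hn]) (by simp [hn]; omega) h
      omega
    · have := hw.getVert_sub_one_ne_getVert_add_one (i := m + 1) (by omega)
      simpa [qs] using this
  let E : ℕ → Line := fun m => ℓ (if h : 0 < m ∧ m ≤ n + 1 then ⟨m - 1, by omega⟩ else ⟨n, by omega⟩)
  have E0 : E 0 = ℓ ⟨n, by omega⟩ := rfl
  have Es : ∀ m (hm : m < n + 1), E (m + 1) = ℓ ⟨m, by omega⟩ := fun m hm => by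
    have h : 0 < m + 1 ∧ m + 1 ≤ n + 1 := ⟨by omega, by omega⟩
    simp only [E, dif_pos h]
    rfl
  have hjoin : ∀ m ≤ n + 1, join (P (q m)) (P (q (m + 1))) = some (E m) := by
    intro m hm
    rcases m with _ | m
    · rw [E0, q0, qs, ← hlast]
      exact hℓ ⟨n, by omega⟩
    · rw [Es m (by omega)]
      exact hℓ ⟨m, by omega⟩
  have hE : ∀ m ≤ n + 1, IsLineOfForce (f (q m) (q (m + 1))) (E m) ∧
      IsLineOfForce (f (q (m + 1)) (q m)) (E m) := fun m hm =>
    ⟨hf.along _ _ (hadj m hm) _ (hjoin m hm),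
      hf.along _ _ (hadj m hm).symm _ (join_comm (hjoin m hm))⟩
  have hne : ∀ m < n + 1, E m ≠ E (m + 1) := by
    intro m hm
    rw [Es m hm]
    rcases m with _ | m
    · rw [E0]
      refine hgen.injective.ne fun h => ?_
      have := Fin.mk.inj h
      omega
    · rw [Es m (by omega)]
      refine hgen.injective.ne fun h => ?_
      have := Fin.mk.inj h
      omega
  have hfr : ∀ m, ∃ ℓ : Line, m < n + 1 →
      (Φ.framing (q (m + 1)) (q m) (q (m + 2))).eval σ Q.toConfig = some ℓ ∧
      IsLineOfForce (f (q (m + 1)) (q m) + f (q (m + 1)) (q (m + 2))) ℓ := by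
    intro m
    by_cases hm : m < n + 1
    · obtain ⟨ℓ, h⟩ := hframe (q (m + 1)) (q m) (q (m + 2)) (hadj m hm.le).symm
        (hadj (m + 1) hm) (hnext m hm)
      exact ⟨ℓ, fun _ => h⟩
    · exact ⟨E 0, fun h => absurd h hm⟩
  choose fr hfr using hfr
  let D : ℕ → CycleDatum := fun m => ⟨P (q (m + 1)), fr m, E (m + 1)⟩
  have hprev : ∀ m < n + 1, w.getVert ((m + w.length - 1) % w.length) = q m := by
    intro m hm
    rw [hn]
    rcases m with _ | m
    · rw [q0]
      congr 1
      rw [Nat.mod_eq_of_lt] <;> omega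
    · rw [qs]
      congr 1
      rw [show m + 1 + (n + 1) - 1 = m + (n + 1) by omega, Nat.add_mod_right,
        Nat.mod_eq_of_lt (by omega)]
  have hlist : D 0 :: (List.range n).map (fun m => D (m + 1)) =
      (List.range (n + 1)).map fun m => D (0 + m) := by
    rw [List.range_succ_eq_map, List.map_cons, List.map_map]
    simp only [zero_add]
    rfl
  have hgl : (D 0 :: (List.range n).map (fun m => D (m + 1))).getLast (by simp) = D n := by
    simp only [hlist, List.getLast_map, List.getLast_range, zero_add, Nat.add_sub_cancel]
  have hDn : (D n).out = E 0 := by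
    change E (n + 1) = E 0
    rw [Es n (by omega), E0]
  have hevals : ∀ m < n + 1, FramedVertex.EvalsTo σ Q.toConfig
      ⟨.fixedPoint (w.getVert m), Φ.framing (w.getVert m)
        (w.getVert ((m + w.length - 1) % w.length)) (w.getVert (m + 1))⟩ (D m) := by
    intro m hm
    refine ⟨rfl, ?_⟩
    simp only [hprev m hm]
    exact (hfr m hm).1
  have hchain : IsFramedChain (E 0) ((List.range (n + 1)).map fun m => D (0 + m)) := by
    refine isFramedChain_map_range (n + 1) 0 fun m _ hm => ?_
    rw [zero_add] at hm
    obtain ⟨-, -, j1⟩ := join_eq_some.1 (hjoin m hm.le)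
    obtain ⟨-, j2, -⟩ := join_eq_some.1 (hjoin (m + 1) hm)
    refine ⟨rfl, j1, j2, ?_, ?_, ?_⟩
    · exact (hfr m hm).2.mem_of_through ((ActsAlong.through (Or.inr (hE m hm.le).2) j1).add
        (ActsAlong.through (Or.inr (hE (m + 1) hm).1) j2))
    · refine (hE (m + 1) hm).1.ne_of_add (hne m hm).symm (hE m hm.le).2 ?_
      rw [add_comm]
      exact (hfr m hm).2
    · exact (hE m hm.le).2.ne_of_add (hne m hm) (hE (m + 1) hm).1 (hfr m hm).2
  have hout : ((List.range (n + 1)).map fun m => D (0 + m)).map CycleDatum.out =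
      (List.range (n + 1)).map fun m => E (m + 1) := by
    rw [List.map_map]
    simp only [zero_add]
    rfl
  have hnd : (((List.range (n + 1)).map fun m => D (0 + m)).map CycleDatum.out).Nodup := by
    rw [hout]
    refine List.Nodup.map_on (fun a ha b hb hab => ?_) List.nodup_range
    rw [List.mem_range] at ha hb
    rw [Es a ha, Es b hb] at hab
    exact Fin.mk.inj (hgen.injective hab)
  have hno : NoThreeConcurrent
      {a | a ∈ ((List.range (n + 1)).map fun m => D (0 + m)).map CycleDatum.out} := by
    rw [hout]
    rintro a ha b hb d hd hab had hbd p hpa hpb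
    simp only [Set.mem_ofPred_eq, List.mem_map, List.mem_range] at ha hb hd
    obtain ⟨a, ha, rfl⟩ := ha
    obtain ⟨b, hb, rfl⟩ := hb
    obtain ⟨d, hd, rfl⟩ := hd
    rw [Es _ ha] at hab had hpa
    rw [Es _ hb] at hab hbd hpb
    rw [Es _ hd] at had hbd ⊢
    exact hgen.not_mem (fun h => hab (congrArg ℓ h)) (fun h => had (congrArg ℓ h))
      (fun h => hbd (congrArg ℓ h)) hpa hpb
  have hcond := cycleCondition_holds_iff (σ := σ) (ξ := Q.toConfig)
    (v := ⟨.fixedPoint (w.getVert 0), Φ.framing (w.getVert 0)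
        (w.getVert ((0 + w.length - 1) % w.length)) (w.getVert (0 + 1))⟩)
    (l := (List.range n).map fun m => ⟨.fixedPoint (w.getVert (m + 1)),
      Φ.framing (w.getVert (m + 1)) (w.getVert ((m + 1 + w.length - 1) % w.length))
        (w.getVert (m + 1 + 1))⟩)
    (x := D 0) (L := (List.range n).map fun m => D (m + 1))
    (by simp; omega) (hevals 0 (by omega))
    (by
      rw [List.forall₂_map_left_iff, List.forall₂_map_right_iff, List.forall₂_same]
      intro m hm
      rw [List.mem_range] at hm
      exact hevals (m + 1) (by omega))
    (by rw [hgl, hDn, hlist]; exact hchain) (by rw [hlist]; exact hnd) (by rw [hlist]; exact hno)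
  rw [hgl, hDn, hlist] at hcond
  have hfac := exists_forces_iff_exists_factors (E := E) (fr := fr) hq0 hq1 hinj hE hne
    fun m hm => (hfr m hm).2
  have hn' : w.length - 1 = n := by omega
  rw [hn']
  refine hcond.trans (Iff.trans ?_ (hfac.trans ?_))
  · simp only [balanced_map_range_iff]
    simp only [zero_add, Nat.zero_le, true_implies]
    constructor
    · rintro ⟨h₀, h1, h2, h, h3, h4, h5⟩
      exact ⟨h, h4.trans h3.symm, h3 ▸ h1, h3 ▸ h2, h5⟩
    · rintro ⟨h, h1, h2, h3, h4⟩
      exact ⟨h 0, h2, h3, h, rfl, h1, h4⟩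
  · refine exists_congr fun lam => and_congr_right fun _ => ?_
    constructor
    · intro h a b hab
      obtain ⟨m, hm, hm'⟩ := w.toSubgraph_adj_iff.1 hab
      have hstep : lam (w.getVert m) • f (w.getVert m) (w.getVert (m + 1)) +
          lam (w.getVert (m + 1)) • f (w.getVert (m + 1)) (w.getVert m) = 0 := by
        rcases Nat.lt_or_ge (m + 1) (n + 1) with hlt | hge
        · exact h (m + 1) hlt
        · obtain rfl : m = n := by omega
          have := h 0 (by omega)
          rw [q0, qs, ← hlast] at this
          exact this
      rcases Sym2.eq_iff.1 hm with ⟨h1, h2⟩ | ⟨h1, h2⟩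
      · rw [← h1, ← h2]
        exact hstep
      · rw [← h1, ← h2, add_comm]
        exact hstep
    · intro h m hm
      refine h _ _ (w.toSubgraph_adj_iff.2 ?_)
      rcases m with _ | m
      · exact ⟨n, by rw [q0, qs, ← hlast], by omega⟩
      · exact ⟨m, rfl, by omega⟩

end Condition

/-! ### Tensegrities and generic quantizations -/

section Main

theorem isLineOfForce_smul_iff {c : ℝ} (hc : c ≠ 0) {F : Force} {ℓ : Line} :
    IsLineOfForce (c • F) ℓ ↔ IsLineOfForce F ℓ := by
  rw [isLineOfForce_iff, isLineOfForce_iff]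
  refine and_congr (smul_ne_zero_iff_right hc) ⟨fun h => ?_, fun h => h.smul c⟩
  have := h.smul c⁻¹
  rwa [smul_smul, inv_mul_cancel₀ hc, one_smul] at this

theorem NonParallelizable.smul {ι : Type*} [Fintype ι] {f : ι → Force} (h : NonParallelizable f)
    {c : ℝ} (hc : c ≠ 0) : NonParallelizable fun j => c • f j := by
  constructor
  · intro A hA
    rw [← Finset.smul_sum] at hA
    exact h.1 A ((smul_eq_zero_iff_right hc).1 hA)
  · intro j₀ A B hA hB hA' hB' hAB ℓ hℓ
    rw [← Finset.smul_sum, ← Finset.smul_sum, isLineOfForce_smul_iff hc,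
      isLineOfForce_smul_iff hc] at hℓ
    exact h.2 j₀ A B hA hB hA' hB' hAB ℓ hℓ

theorem ncard_verts_toSubgraph {V : Type*} {G : SimpleGraph V} {u : V} {w : G.Walk u u}
    (hw : w.IsCycle) : w.toSubgraph.verts.ncard = w.length := by
  classical
  have h : w.toSubgraph.verts = (w.support.tail.toFinset : Set V) := by
    ext v
    rw [SimpleGraph.Walk.mem_verts_toSubgraph, Finset.mem_coe, List.mem_toFinset,
      SimpleGraph.Walk.mem_support_iff]
    refine ⟨?_, Or.inr⟩
    rintro (rfl | h)
    · exact w.end_mem_tail_support hw.not_nil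
    · exact h
  rw [h, Set.ncard_coe_finset, List.toFinset_card_of_nodup hw.support_nodup, List.length_tail,
    SimpleGraph.Walk.length_support, Nat.add_sub_cancel]

variable {V : Type*} [Fintype V] {G : SimpleGraph V} [DecidableRel G.Adj]

theorem sum_neighborSet {F : V → V → Force} (h : ∀ i j, ¬ G.Adj i j → F i j = 0) (i : V) :
    ∑ j : G.neighborSet i, F i j = ∑ j, F i j := by
  rw [← Finset.sum_filter_of_ne (p := G.Adj i) fun j _ hj => not_not.1 fun hij => hj (h i j hij)]
  exact (Finset.sum_subtype _ (fun j => by simp) _).symm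

/-- The chosen labelling and the walk witnessing shortness trace the same subgraph, hence have
equally many vertices and equal lengths. -/
theorem SystemChoice.length_walk_lt {T : ∀ i, ResolutionTree G i} (Φ : SystemChoice T)
    (c : ShortCycle G) : (Φ.walk c).length < Fintype.card V := by
  obtain ⟨u, w, hw, hc, hlt⟩ := c.2
  rwa [← ncard_verts_toSubgraph (Φ.isCycle c), Φ.toSubgraph_eq c, ← hc, ncard_verts_toSubgraph hw]

/-- The ratios of the two leaf forces of an edge. -/
theorem IsLeafForces.exists_gain {T : ∀ i, ResolutionTree G i} {P : V → Point}
    {Q : Quantization T P} {f : V → V → Force} (hf : IsLeafForces Q f)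
    (hP : Function.Injective P) : ∃ g : V → V → ℝˣ, (∀ i j, G.Adj i j → g j i = (g i j)⁻¹) ∧
      ∀ i j, G.Adj i j → ∀ a b : ℝ, a • f i j + b • f j i = 0 ↔ b = a * g i j := by
  have key : ∀ i j, ∃ r : ℝˣ, G.Adj i j → f i j = (-(r : ℝ)) • f j i ∧ f j i ≠ 0 := by
    intro i j
    by_cases hij : G.Adj i j
    · obtain ⟨ℓ, hℓ⟩ := exists_join (hP.ne hij.ne)
      have h1 := hf.along i j hij ℓ hℓ
      have h2 := hf.along j i hij.symm ℓ (join_comm hℓ)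
      obtain ⟨c, hc⟩ := ActsAlong.exists_smul (Or.inr h1) (Or.inr h2) h2.ne_zero
      have hc0 : c ≠ 0 := by
        rintro rfl
        exact h1.ne_zero (hc.trans (zero_smul ℝ _))
      -- The sign makes the gain the ratio of the factors at `j` and `i` that cancel the two leaf
      -- forces.
      exact ⟨Units.mk0 (-c) (neg_ne_zero.2 hc0), fun _ => ⟨by simpa using hc, h2.ne_zero⟩⟩
    · exact ⟨1, fun h => absurd h hij⟩
  choose g hg using key
  have hiff : ∀ i j, G.Adj i j → ∀ a b : ℝ, a • f i j + b • f j i = 0 ↔ b = a * g i j := by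
    intro i j hij a b
    obtain ⟨h1, h2⟩ := hg i j hij
    have h3 : a • f i j + b • f j i = (b - a * g i j) • f j i := by
      rw [h1]
      module
    rw [h3]
    exact (smul_eq_zero_iff_left h2).trans sub_eq_zero
  refine ⟨g, fun i j hij => ?_, hiff⟩
  have h1 := (hiff i j hij 1 (g i j)).2 (one_mul _).symm
  rw [add_comm] at h1
  have h2 := (hiff j i hij.symm _ _).1 h1
  rw [eq_inv_iff_mul_eq_one, mul_comm]
  exact Units.ext h2.symm

theorem SystemChoice.fulfilledAt_of_isEquilibriumForceLoad {T : ∀ i, ResolutionTree G i}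
    (Φ : SystemChoice T) {P : V → Point} (hdeg : ∀ i, 3 ≤ G.degree i)
    (hP : Function.Injective P) (hgen : FrameworkInGeneralPosition G P)
    (σ : GenericChoice (numLines G)) {F : V → V → Force} (hF : IsEquilibriumForceLoad G P F)
    (hnp : ∀ i, NonParallelizable fun j : G.neighborSet i => F i j) : Φ.FulfilledAt P σ := by
  obtain ⟨Q, hQ, hf⟩ := exists_quantization hP hdeg T hF.stress_along hnp fun i => by
    rw [sum_neighborSet hF.eq_zero]
    exact hF.equilibrium i
  refine ⟨Q.toConfig, ⟨Q, hQ, rfl⟩, fun c => ?_⟩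
  refine (hf.condition_holds_iff hP σ Φ c
    (hgen _ _ (Φ.isCycle c) (Φ.length_walk_lt c))).2 ⟨1, fun v => one_ne_zero, fun a b _ => ?_⟩
  simp only [Pi.one_apply, one_smul]
  exact hF.antisymm a b

/-- The leaf forces are determined only up to a factor at each vertex, and the conditions say that
these factors can be matched along each short cycle. The global potential matches them on all edges,
and rescaling by nonzero factors preserves equilibrium and non-parallelizability. -/
theorem SystemChoice.FulfilledAt.admitsNonParallelizableTensegrity {T : ∀ i, ResolutionTree G i}
    {Φ : SystemChoice T} {P : V → Point} {σ : GenericChoice (numLines G)}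
    (h : Φ.FulfilledAt P σ) (hconn : G.Connected) (hdeg : ∀ i, 3 ≤ G.degree i)
    (hP : Function.Injective P) (hgen : FrameworkInGeneralPosition G P) :
    AdmitsNonParallelizableTensegrity G P := by
  obtain ⟨_, ⟨Q, hQ, rfl⟩, hc⟩ := h
  obtain ⟨f, hf⟩ := exists_isLeafForces hdeg hQ
  obtain ⟨g, hg, hiff⟩ := hf.exists_gain hP
  obtain ⟨lam, hlam⟩ := exists_potential hconn hdeg hg fun u w hw hlt => by
    let c : ShortCycle G := ⟨w.toSubgraph, u, w, hw, rfl, hlt⟩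
    obtain ⟨lam, hne, hl⟩ := (hf.condition_holds_iff hP σ Φ c
      (hgen _ _ (Φ.isCycle c) (Φ.length_walk_lt c))).1 (hc c)
    exact ⟨fun v => Units.mk0 (lam v) (hne v), fun a b hab =>
      Units.ext ((hiff a b hab.adj_sub _ _).1 (hl a b hab))⟩
  let F : V → V → Force := fun i j => if G.Adj i j then (lam i : ℝ) • f i j else 0
  have hF : ∀ i j, G.Adj i j → F i j = (lam i : ℝ) • f i j := fun i j hij => if_pos hij
  have hF0 : ∀ i j, ¬ G.Adj i j → F i j = 0 := fun i j hij => if_neg hij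
  have hFn : ∀ i, (fun j : G.neighborSet i => F i j) =
      fun j : G.neighborSet i => (lam i : ℝ) • f i j := fun i =>
    funext fun j => hF i j j.2
  refine ⟨F, ⟨fun i j hij => ?_, fun i j => ?_, hF0, fun i => ?_⟩, fun i => ?_⟩
  · obtain ⟨ℓ, hℓ⟩ := exists_join (hP.ne hij.ne)
    rw [hF i j hij]
    exact ⟨ℓ, hℓ, ActsAlong.smul _ (Or.inr (hf.along i j hij ℓ hℓ))⟩
  · by_cases hij : G.Adj i j
    · rw [hF i j hij, hF j i hij.symm]
      exact (hiff i j hij _ _).2 (congrArg Units.val (hlam i j hij))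
    · rw [hF0 i j hij, hF0 j i fun h => hij h.symm, add_zero]
  · rw [← sum_neighborSet hF0, hFn i, ← Finset.smul_sum, hf.sum_eq_zero i, smul_zero]
  · rw [hFn i]
    exact (hf.nonParallelizable i).smul (lam i).ne_zero

end Main

end Tensegrity

end

/-! ### The two directions combined -/

theorem theorem2 {V : Type*} [Fintype V] (G : SimpleGraph V) [DecidableRel G.Adj]
    (hconn : G.Connected) (hdeg : ∀ i, 3 ≤ G.degree i)
    (T : ∀ i, Tensegrity.ResolutionTree G i) :
    Nonempty (Tensegrity.SystemChoice T) ∧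
    ∀ (Φ : Tensegrity.SystemChoice T) (P : V → Tensegrity.Point),
      Function.Injective P → Tensegrity.FrameworkInGeneralPosition G P →
      ∀ σ : Tensegrity.GenericChoice (Tensegrity.numLines G),
        (Tensegrity.AdmitsNonParallelizableTensegrity G P ↔ Φ.FulfilledAt P σ) := by
  refine ⟨Tensegrity.nonempty_systemChoice hdeg T, fun Φ P hP hgen σ => ⟨?_, fun h =>
    h.admitsNonParallelizableTensegrity hconn hdeg hP hgen⟩⟩
  rintro ⟨F, hF, hnp⟩
  exact Φ.fulfilledAt_of_isEquilibriumForceLoad hdeg hP hgen σ hF hnp
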